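/- **Setting.** Computability and continuity of partial functions $F:\subseteq\{0,1\}^{\mathbb N}\to\{0,1\}^{\mathbb N}$ are meant in the Type-2 sense and with respect to the product topology. A represented space is a set $X$ with a partial surjection $\delta_X:\subseteq\{0,1\}^{\mathbb N}\to X$; a partial function $F$ realizes a multi-valued partial map $f:\subseteq X\rightrightarrows Y$ ($F\vdash f$) if $\delta_Y(F(p))\in f(\delta_X(p))$ for all $p\in\operatorname{dom}(f\delta_X)$. One writes $f\le_{\mathrm W}g$ (resp. $f\le^{c}_{\mathrm W}g$) if there are computable (resp. continuous) $K,H:\subseteq\{0,1\}^{\mathbb N}\to\{0,1\}^{\mathbb N}$ such that $K\langle\mathrm{id},GH\rangle\vdash f$ for every $G\vdash g$; $\equiv_{\mathrm W}$ and $\equiv^c_{\mathrm W}$ are the induced equivalences. Here $\{0,1\}^{\mathbb N}$ is represented by the identity, $\{0,1\}$ and $\mathbb N$ are discrete represented spaces, $\mathbb R$ carries the standard representation (a name of $x$ is a sequence $(q_i)$ of rationals with $|x-q_i|<2^{-i}$), and $\mathbb R^*=\coprod_{n}\mathbb R^n$ and products carry the induced representations. $C_{\mathbb N}$ is the problem of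 finding an element of a non-empty $A\subseteq\mathbb N$, where $A$ is given by an enumeration of its complement. Let $\mathfrak A=(\mathbb R,(f_i)_{i\in I},(T_j)_{j\in J})$ be a structure with partial operations $f_i:\subseteq\mathbb R^{k_i}\to\mathbb R$, indexed by an effectively coded countable set $I$ (e.g. a finite one), among which is addition, and with finitely many tests $T_j\in\{=,<\}$, among which is $=$. A program over $\mathfrak A$ is a finite list of commands of a register machine with real registers $R_0,R_1,\dots$ and index registers $I_0,I_1,\dots$ over $\mathbb N$: counter operations and zero tests on the $I_n$, $R_{I_0}:=R_{I_1}$, $R_0:=f_i(R_1,\dots,R_{k_i})$, branching on $T_j(R_1,R_2)$, and HALT (with output $R_0,\dots,R_{I_0}$). On input $u\in\mathbb R^n$ the machine starts with $u$ in $R_1,\dots,R_n$, $I_0=n$, all other $I_m=0$, and all other $R_m$ equal to a fixed $a_0\in\mathbb R$; it does not halt if it applies an operation outside its domain. Fix an effective Gödel numbering of the programs and let $\mathbb H=\mathbb H_{\mathfrak A}\subseteq\mathbb N\times\mathbb R^*$ be the set of all $(n,u)$ such that $n$ is the Gödel number of a program that halts on input $u$. Let $\chi_{\mathbb Q}:\mathbb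 R\to\{0,1\}$ and $\chi_{\mathbb H}:\mathbb N\times\mathbb R^*\to\{0,1\}$ be the characteristic functions, and let $\mathsf{isInfinite}:\{0,1\}^{\mathbb N}\to\{0,1\}$ be given by $\mathsf{isInfinite}(p)=1$ iff $p(n)=1$ for infinitely many $n$. **Theorem.** 1. Suppose that $a_0$ is a computable real, that the $f_i$ are computable (uniformly in $i\in I$, with $i\mapsto k_i$ computable), and that their domains are effectively $F_\sigma$ (uniformly in $i$, unions of sequences of sets whose complements are uniformly semidecidable; this is automatic for total operations). Then $$\chi_{\mathbb Q}\equiv_{\mathrm W}\chi_{\mathbb H}\equiv_{\mathrm W}\mathsf{isInfinite}.$$ 2. Suppose that every $f_i$ is continuous on its domain and that its domain is an $F_\sigma$ subset of $\mathbb R^{k_i}$ (automatic for total operations); $a_0$ is arbitrary. Then $$\chi_{\mathbb Q}\equiv^c_{\mathrm W}\chi_{\mathbb H}\equiv^c_{\mathrm W}\mathsf{isInfinite}.$$ 3. (Undecidability for topological reasons.) For every $\mathfrak A$ as in the setting, $\chi_{\mathbb H}\not\le^c_{\mathrm W}C_{\mathbb N}$. Moreover, for every structure $\mathfrak B$ on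 $\mathbb R$ with arbitrarily many partial operations, each continuous on its domain (in particular with arbitrary real constants), and with tests among $=,<$, there is no program over $\mathfrak B$ that decides $\mathbb H_{\mathfrak A}$, i.e. that halts on all inputs $(n,u)\in\mathbb N\times\mathbb R^*$ (given as a tuple of reals with first entry $n$) with output $\chi_{\mathbb H}(n,u)$. -/

import Mathlib

namespace BSSWeihrauch

/-! ### Computability and continuity on Cantor space -/

/-- Cantor space `{0,1}^ℕ`, with the product topology. -/
abbrev Cantor : Type := ℕ → Bool

/-- The finite prefix `p(0) … p(n-1)`. -/
def initSeg (p : Cantor) (n : ℕ) : List Bool := (List.range n).map p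

/-- Type-2 computability of a partial function `F` on Cantor space: a computable, prefix-monotone
word function (what the machine has written on its one-way output tape after reading a given
finite part of its input) produces in the limit `F p`, for every `p` in the domain of `F`.
Nothing is required of the machine on inputs outside the domain of `F`. -/
def TypeTwoComputable (F : Cantor →. Cantor) : Prop :=
  ∃ φ : List Bool → List Bool, Computable φ ∧ (∀ v w, v <+: w → φ v <+: φ w) ∧
    ∀ p, ∀ q ∈ F p, ∀ n, ∃ m, initSeg q n <+: φ (initSeg p m)

/-- Continuity of a partial function, its domain carrying the subspace topology. -/
def PartialContinuous {X Y : Type*} [TopologicalSpace X] [TopologicalSpace Y] (f : X →. Y) :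
    Prop :=
  Continuous fun x : f.Dom => f.fn x.1 x.2

/-- The first component of a pair `⟨p, q⟩` coded in one sequence. -/
def evenPart (p : Cantor) : Cantor := fun n => p (2 * n)

/-- The second component of a pair `⟨p, q⟩` coded in one sequence. -/
def oddPart (p : Cantor) : Cantor := fun n => p (2 * n + 1)

/-- The pairing `⟨p, q⟩ = p(0) q(0) p(1) q(1) …`. -/
def pairing (p q : Cantor) : Cantor := fun n => if n % 2 = 0 then p (n / 2) else q (n / 2)

@[simp] theorem evenPart_pairing (p q : Cantor) : evenPart (pairing p q) = p := by
  funext n; simp [evenPart, pairing]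

@[simp] theorem oddPart_pairing (p q : Cantor) : oddPart (pairing p q) = q := by
  funext n
  have h : (2 * n + 1) / 2 = n := by omega
  simp [oddPart, pairing, h]

/-! ### Represented spaces -/

/-- A representation of `X`: a partial surjection from Cantor space onto `X`, given by its graph
(`names p x` says that `p` is a name of `x`). -/
structure Representation (X : Type) where
  names : Cantor → X → Prop
  unique : ∀ p x y, names p x → names p y → x = y
  surj : ∀ x, ∃ p, names p x

/-- Cantor space represented by the identity. -/
def cantorRep : Representation Cantor where
  names p x := x = p
  unique _ _ _ h h' := h.trans h'.symm
  surj x := ⟨x, rfl⟩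

/-- The discrete space `{0,1}`: `p` is a name of `p(0)`. -/
def boolRep : Representation Bool where
  names p b := p 0 = b
  unique _ _ _ h h' := h.symm.trans h'
  surj b := ⟨fun _ => b, rfl⟩

/-- Sierpinski space: `0^ω` is the only name of `⊥`, all other sequences are names of `⊤`. -/
def sierpinskiRep : Representation Prop where
  names p s := s ↔ ∃ n, p n = true
  unique _ _ _ h h' := propext (h.trans h'.symm)
  surj s := by
    classical
    exact ⟨fun _ => decide s, by simp⟩

/-- The only name of `n` is `0^n 1^ω`. -/
def natRep : Representation ℕ where
  names p n := ∀ k, p k = true ↔ n ≤ k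
  unique p m n hm hn := le_antisymm ((hm n).1 ((hn n).2 le_rfl)) ((hn m).1 ((hm m).2 le_rfl))
  surj n := ⟨fun k => decide (n ≤ k), by simp⟩

/-- An effectively coded countable set as a discrete represented space. -/
def discreteRep (ι : Type) [Encodable ι] : Representation ι where
  names p i := natRep.names p (Encodable.encode i)
  unique p _ _ hi hj := Encodable.encode_injective (natRep.unique p _ _ hi hj)
  surj i := natRep.surj (Encodable.encode i)

/-- The product of two represented spaces. -/
def prodRep {X Y : Type} (δX : Representation X) (δY : Representation Y) :
    Representation (X × Y) where
  names p a := δX.names (evenPart p) a.1 ∧ δY.names (oddPart p) a.2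
  unique p a b ha hb :=
    Prod.ext (δX.unique _ _ _ ha.1 hb.1) (δY.unique _ _ _ ha.2 hb.2)
  surj a := by
    obtain ⟨p, hp⟩ := δX.surj a.1
    obtain ⟨q, hq⟩ := δY.surj a.2
    exact ⟨pairing p q, by simpa using hp, by simpa using hq⟩

/-- The coproduct `X^* = ∐ₙ X^n`: a name consists of a name of the length of the tuple together
with names of all its entries, the `i`-th one at the positions `⟨i, k⟩`. -/
def listRep {X : Type} (δ : Representation X) : Representation (List X) where
  names p u := natRep.names (evenPart p) u.length ∧
    ∀ (i : ℕ) (h : i < u.length), δ.names (fun k => oddPart p (Nat.pair i k)) u[i]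
  unique p u v hu hv :=
    List.ext_getElem (natRep.unique _ _ _ hu.1 hv.1)
      fun i h h' => δ.unique _ _ _ (hu.2 i h) (hv.2 i h')
  surj u := by
    obtain ⟨p, hp⟩ := natRep.surj u.length
    choose q hq using δ.surj
    refine ⟨pairing p fun n => if h : n.unpair.1 < u.length then
      q (u[n.unpair.1]) n.unpair.2 else false, by simpa using hp, fun i h => ?_⟩
    simpa [h] using hq u[i]

/-- A standard enumeration of the rational numbers. -/
def nuQ (n : ℕ) : ℚ :=
  ((n.unpair.1 : ℚ) - (n.unpair.2.unpair.1 : ℚ)) / ((n.unpair.2.unpair.2 : ℚ) + 1)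

theorem nuQ_surjective : Function.Surjective nuQ := by
  intro q
  refine ⟨Nat.pair q.num.toNat (Nat.pair (-q.num).toNat (q.den - 1)), ?_⟩
  have h1 : ((q.den - 1 : ℕ) : ℚ) + 1 = q.den := by
    have := q.den_pos
    exact_mod_cast (by omega : q.den - 1 + 1 = q.den)
  have h2 : ((q.num.toNat : ℚ) - ((-q.num).toNat : ℚ)) = (q.num : ℚ) := by
    have := Int.toNat_sub_toNat_neg q.num
    exact_mod_cast this
  simp only [nuQ, Nat.unpair_pair, h1, h2]
  exact Rat.num_div_den q

/-- The position of the `i`-th `1` in `0^{s 0} 1 0^{s 1} 1 …`. -/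
def onePos (s : ℕ → ℕ) (i : ℕ) : ℕ := (∑ j ∈ Finset.range (i + 1), s j) + i

theorem onePos_strictMono (s : ℕ → ℕ) : StrictMono (onePos s) := by
  refine strictMono_nat_of_lt_succ fun i => ?_
  simp only [onePos, Finset.sum_range_succ _ (i + 1)]
  omega

/-- `p = 0^{s 0} 1 0^{s 1} 1 …`. -/
def IsBlockCode (p : Cantor) (s : ℕ → ℕ) : Prop :=
  ∀ n, p n = true ↔ ∃ i, n = onePos s i

theorem IsBlockCode.unique {p : Cantor} {s t : ℕ → ℕ} (hs : IsBlockCode p s)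
    (ht : IsBlockCode p t) : s = t := by
  have hr : Set.range (onePos s) = Set.range (onePos t) := by
    ext n
    have := (hs n).symm.trans (ht n)
    simpa [Set.mem_range, eq_comm] using this
  have hp : onePos s = onePos t :=
    (StrictMono.range_inj (onePos_strictMono s) (onePos_strictMono t)).1 hr
  funext i
  cases i with
  | zero => simpa [onePos] using congrFun hp 0
  | succ i =>
    have h1 := congrFun hp i
    have h2 := congrFun hp (i + 1)
    simp only [onePos, Finset.sum_range_succ _ (i + 1)] at h1 h2
    omega

/-- The standard representation `ρ` of the real numbers: `0^{n₀} 1 0^{n₁} 1 …` is a name of `x`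
iff `|x - ν_ℚ(nᵢ)| < 2^{-i}` for all `i`. -/
def realRep : Representation ℝ where
  names p x := ∃ s : ℕ → ℕ, IsBlockCode p s ∧ ∀ i, |x - (nuQ (s i) : ℝ)| < (1 / 2 : ℝ) ^ i
  unique := by
    rintro p x y ⟨s, hs, hx⟩ ⟨t, ht, hy⟩
    obtain rfl := hs.unique ht
    by_contra hne
    have hpos : 0 < |x - y| / 2 := by
      have := abs_pos.2 (sub_ne_zero.2 hne)
      linarith
    obtain ⟨i, hi⟩ := exists_pow_lt_of_lt_one hpos (by norm_num : (1 / 2 : ℝ) < 1)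
    have h1 := hx i
    have h2 := hy i
    have h3 : |x - y| ≤ |x - (nuQ (s i) : ℝ)| + |y - (nuQ (s i) : ℝ)| := by
      rw [abs_sub_comm y]
      exact abs_sub_le _ _ _
    linarith
  surj x := by
    classical
    have h : ∀ i : ℕ, ∃ n, |x - (nuQ n : ℝ)| < (1 / 2 : ℝ) ^ i := by
      intro i
      obtain ⟨q, hq⟩ := exists_rat_near x (by positivity : (0 : ℝ) < (1 / 2) ^ i)
      obtain ⟨n, rfl⟩ := nuQ_surjective q
      exact ⟨n, hq⟩
    choose s hs using h
    exact ⟨fun n => decide (∃ i, n = onePos s i), s, fun n => by simp, hs⟩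

/-- `0 1^{n+1} 0` is a subword of `p`. -/
def HasBlock (p : Cantor) (n : ℕ) : Prop :=
  ∃ k, p k = false ∧ (∀ j ≤ n, p (k + 1 + j) = true) ∧ p (k + n + 2) = false

/-- The space `𝒜(ℕ)` of closed subsets of `ℕ` with negative information: `n` belongs to the set
named by `p` iff `0 1^{n+1} 0` is not a subword of `p`. -/
def closedNatRep : Representation (Set ℕ) where
  names p A := ∀ n, n ∈ A ↔ ¬ HasBlock p n
  unique p A B hA hB := Set.ext fun n => (hA n).trans (hB n).symm
  surj A := by
    classical
    -- in the `(m+1)`-th square block, write `1^{m+1}` surrounded by zeros iff `m ∉ A`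
    let p : Cantor := fun n => decide (n.sqrt - 1 ∉ A ∧ n.sqrt * n.sqrt < n ∧
      n ≤ n.sqrt * n.sqrt + n.sqrt)
    have hp : ∀ n, p n = true ↔ n.sqrt - 1 ∉ A ∧ n.sqrt * n.sqrt < n ∧
      n ≤ n.sqrt * n.sqrt + n.sqrt := fun n => by simp [p]
    have hf : ∀ n, p n = false ↔ ¬ (n.sqrt - 1 ∉ A ∧ n.sqrt * n.sqrt < n ∧
      n ≤ n.sqrt * n.sqrt + n.sqrt) := fun n => by
        rw [← hp]; simp
    have hsq : ∀ r off : ℕ, off ≤ r + r → (r * r + off).sqrt = r := fun r off h => by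
      rw [Nat.sqrt_add_eq]; exact h
    refine ⟨p, fun n => ?_⟩
    rw [iff_not_comm]
    constructor
    · rintro ⟨k, hk, hone, hz⟩
      -- all positions of the run of ones lie in one square block
      have h0 := (hp _).1 (hone 0 (Nat.zero_le _))
      set r := (k + 1 + 0).sqrt with hr
      have hrun : ∀ j ≤ n, k + 1 + j ≤ r * r + r := by
        intro j
        induction j with
        | zero => intro _; exact h0.2.2
        | succ j ih =>
          intro hj
          have h1 := ih (by omega)
          obtain ⟨d, hd⟩ := Nat.exists_eq_add_of_lt h0.2.1
          have h2 := (hp _).1 (hone (j + 1) hj)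
          have h3 : (k + 1 + (j + 1)).sqrt = r := by
            rw [show k + 1 + (j + 1) = r * r + (d + 1 + (j + 1)) by omega]
            apply hsq
            rcases Nat.eq_zero_or_pos r with h | h
            · simp [h] at h0 h1
            · omega
          rw [h3] at h2
          exact h2.2.2
      have hkr : k = r * r := by
        by_contra hne
        apply (hf k).1 hk
        have hlt : r * r < k := by omega
        obtain ⟨d, hd⟩ := Nat.exists_eq_add_of_lt hlt
        have h3 : k.sqrt = r := by
          rw [show k = r * r + (d + 1) by omega]
          exact hsq _ _ (by omega)
        rw [h3]
        exact ⟨h0.1, hlt, by omega⟩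
      have hn := hrun n le_rfl
      have hnr : n + 1 = r := by
        by_contra hne
        apply (hf _).1 hz
        have h3 : (k + n + 2).sqrt = r := by
          rw [show k + n + 2 = r * r + (n + 2) by omega]
          exact hsq _ _ (by omega)
        rw [h3]
        exact ⟨h0.1, by omega, by omega⟩
      have := h0.1
      rwa [← hnr, Nat.add_sub_cancel] at this
    · intro hA
      refine ⟨(n + 1) * (n + 1), ?_, fun j hj => ?_, ?_⟩
      · rw [hf, show (n + 1) * (n + 1) = (n + 1) * (n + 1) + 0 by omega, hsq _ 0 (by omega)]
        omega
      · rw [hp, add_assoc, hsq _ _ (by omega)]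
        exact ⟨by simpa using hA, by omega, by omega⟩
      · rw [hf, add_assoc, hsq _ _ (by omega)]
        omega

/-! ### Realizers, problems and Weihrauch reducibility -/

/-- `F ⊢ f`, where the multi-valued partial function `f` is given as a set-valued map whose domain
consists of the points with non-empty value. -/
def Realizes {X Y : Type} (δX : Representation X) (δY : Representation Y)
    (F : Cantor →. Cantor) (f : X → Set Y) : Prop :=
  ∀ p x, δX.names p x → (f x).Nonempty → ∃ q ∈ F p, ∃ y ∈ f x, δY.names q y

/-- A multi-valued partial function between represented spaces is computable iff it has a
computable realizer. -/
def ComputableMap {X Y : Type} (δX : Representation X) (δY : Representation Y)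
    (f : X → Set Y) : Prop :=
  ∃ F, TypeTwoComputable F ∧ Realizes δX δY F f

/-- A multi-valued partial function between represented spaces. -/
structure Problem where
  In : Type
  Out : Type
  inRep : Representation In
  outRep : Representation Out
  map : In → Set Out

/-- The partial function `K ⟨id, G H⟩`. -/
def sandwich (K G H : Cantor →. Cantor) : Cantor →. Cantor := fun p =>
  (H p).bind fun q => (G q).bind fun r => K (pairing p r)

/-- Weihrauch reducibility `f ≤_W g`. -/
def WeihrauchLE (f g : Problem) : Prop :=
  ∃ K H : Cantor →. Cantor, TypeTwoComputable K ∧ TypeTwoComputable H ∧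
    ∀ G, Realizes g.inRep g.outRep G g.map →
      Realizes f.inRep f.outRep (sandwich K G H) f.map

/-- Continuous Weihrauch reducibility `f ≤_W^c g`. -/
def ContWeihrauchLE (f g : Problem) : Prop :=
  ∃ K H : Cantor →. Cantor, PartialContinuous K ∧ PartialContinuous H ∧
    ∀ G, Realizes g.inRep g.outRep G g.map →
      Realizes f.inRep f.outRep (sandwich K G H) f.map

/-- Weihrauch equivalence `f ≡_W g`. -/
def WeihrauchEquiv (f g : Problem) : Prop := WeihrauchLE f g ∧ WeihrauchLE g f

/-- Continuous Weihrauch equivalence `f ≡_W^c g`. -/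
def ContWeihrauchEquiv (f g : Problem) : Prop := ContWeihrauchLE f g ∧ ContWeihrauchLE g f

open Classical in
/-- The characteristic function `χ_ℚ : ℝ → {0,1}`. -/
noncomputable def chiRat : Problem where
  In := ℝ
  Out := Bool
  inRep := realRep
  outRep := boolRep
  map x := {decide (∃ q : ℚ, (q : ℝ) = x)}

open Classical in
/-- `isInfinite : {0,1}^ℕ → {0,1}`. -/
noncomputable def isInfinite : Problem where
  In := Cantor
  Out := Bool
  inRep := cantorRep
  outRep := boolRep
  map p := {decide {n : ℕ | p n = true}.Infinite}

/-- Closed choice on the natural numbers, `C_ℕ :⊆ 𝒜(ℕ) ⇉ ℕ`, `A ↦ A` (defined for `A ≠ ∅`). -/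
def closedChoiceNat : Problem where
  In := Set ℕ
  Out := ℕ
  inRep := closedNatRep
  outRep := natRep
  map A := A

/-! ### Generalized register machines over an algebraic structure -/

/-- An algebraic structure on `A` with partial operations indexed by `ι` and relations (tests)
indexed by `τ`; `blank` is the fixed initial content of the registers that hold no input. -/
structure AlgStructure (A ι τ : Type) where
  blank : A
  arity : ι → ℕ
  op : (i : ι) → (Fin (arity i) → A) →. A
  testArity : τ → ℕ
  rel : (t : τ) → (Fin (testArity t) → A) → Prop

/-- Commands of a register machine. Lines are numbered from `0`. -/
inductive Instr (ι τ : Type) where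
  /-- `I_n := I_n + 1` -/
  | inc (n : ℕ)
  /-- `I_n := I_n - 1` (truncated at `0`) -/
  | dec (n : ℕ)
  /-- if `I_n = 0`, go to line `l` -/
  | jumpZero (n l : ℕ)
  /-- `R_{I_0} := R_{I_1}` -/
  | copy
  /-- `R_0 := f_i(R_1, …, R_{k_i})` -/
  | apply (i : ι)
  /-- if `T_t(R_1, …, R_{l_t})`, go to line `l` -/
  | test (t : τ) (l : ℕ)
  /-- stop, with output `R_0, …, R_{I_0}` -/
  | halt

/-- Commands as elements of a sum type; used only for the Gödel numbering. -/
def Instr.equivSum (ι τ : Type) :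
    Instr ι τ ≃ ℕ ⊕ ℕ ⊕ (ℕ × ℕ) ⊕ Unit ⊕ ι ⊕ (τ × ℕ) ⊕ Unit where
  toFun
    | .inc n => .inl n
    | .dec n => .inr (.inl n)
    | .jumpZero n l => .inr (.inr (.inl (n, l)))
    | .copy => .inr (.inr (.inr (.inl ())))
    | .apply i => .inr (.inr (.inr (.inr (.inl i))))
    | .test t l => .inr (.inr (.inr (.inr (.inr (.inl (t, l))))))
    | .halt => .inr (.inr (.inr (.inr (.inr (.inr ())))))
  invFun
    | .inl n => .inc n
    | .inr (.inl n) => .dec n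
    | .inr (.inr (.inl (n, l))) => .jumpZero n l
    | .inr (.inr (.inr (.inl ()))) => .copy
    | .inr (.inr (.inr (.inr (.inl i)))) => .apply i
    | .inr (.inr (.inr (.inr (.inr (.inl (t, l)))))) => .test t l
    | .inr (.inr (.inr (.inr (.inr (.inr ()))))) => .halt
  left_inv := by rintro (_ | _ | _ | _ | _ | _ | _) <;> rfl
  right_inv := by rintro (_ | _ | ⟨_, _⟩ | ⟨⟩ | _ | ⟨_, _⟩ | ⟨⟩) <;> rfl

instance Instr.instPrimcodable {ι τ : Type} [Primcodable ι] [Primcodable τ] :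
    Primcodable (Instr ι τ) :=
  Primcodable.ofEquiv _ (Instr.equivSum ι τ)

/-- A configuration: the current line, the index registers `I_n` and the registers `R_n`. -/
structure Config (A : Type) where
  line : ℕ
  idx : ℕ → ℕ
  reg : ℕ → A

namespace AlgStructure

variable {A ι τ : Type} (𝔄 : AlgStructure A ι τ)

/-- Initially `I_0` is the length of the input, the other `I_n` are `0`, the input is in
`R_1, …, R_n` and all other registers contain `blank`. -/
def init (u : List A) : Config A where
  line := 0
  idx := fun n => if n = 0 then u.length else 0
  reg := fun
    | 0 => 𝔄.blank
    | n + 1 => u.getD n 𝔄.blank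

/-- One step of the program `P`. There is no step from a halting configuration, from a line
outside the program, or when an operation is applied outside its domain. -/
def Step (P : List (Instr ι τ)) (c c' : Config A) : Prop :=
  match P[c.line]? with
  | some (.inc n) => c' = ⟨c.line + 1, Function.update c.idx n (c.idx n + 1), c.reg⟩
  | some (.dec n) => c' = ⟨c.line + 1, Function.update c.idx n (c.idx n - 1), c.reg⟩
  | some (.jumpZero n l) => c' = ⟨if c.idx n = 0 then l else c.line + 1, c.idx, c.reg⟩
  | some .copy =>
      c' = ⟨c.line + 1, c.idx, Function.update c.reg (c.idx 0) (c.reg (c.idx 1))⟩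
  | some (.apply i) =>
      ∃ y ∈ 𝔄.op i (fun j => c.reg (j + 1)), c' = ⟨c.line + 1, c.idx, Function.update c.reg 0 y⟩
  | some (.test t l) =>
      (𝔄.rel t (fun j => c.reg (j + 1)) ∧ c' = ⟨l, c.idx, c.reg⟩) ∨
      (¬ 𝔄.rel t (fun j => c.reg (j + 1)) ∧ c' = ⟨c.line + 1, c.idx, c.reg⟩)
  | some .halt => False
  | none => False

/-- On input `u`, the program `P` halts with output `v`. -/
def Outputs (P : List (Instr ι τ)) (u v : List A) : Prop :=
  ∃ c, Relation.ReflTransGen (𝔄.Step P) (𝔄.init u) c ∧ P[c.line]? = some .halt ∧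
    v = (List.range (c.idx 0 + 1)).map c.reg

/-- The program `P` halts on input `u`. -/
def Halts (P : List (Instr ι τ)) (u : List A) : Prop := ∃ v, 𝔄.Outputs P u v

/-- `n` is the Gödel number of a program that halts on input `u`. -/
def HaltingProblem [Primcodable ι] [Primcodable τ] (n : ℕ) (u : List A) : Prop :=
  ∃ P : List (Instr ι τ), Encodable.decode n = some P ∧ 𝔄.Halts P u

/-- `y` is the value of the `i`-th operation at the tuple `u` (of length `arity i`). -/
def OpValue (i : ι) (u : List A) (y : A) : Prop :=
  ∃ v : Fin (𝔄.arity i) → A, u = List.ofFn v ∧ y ∈ 𝔄.op i v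

/-- The `t`-th relation holds at the tuple `u` (of length `testArity t`). -/
def RelHolds (t : τ) (u : List A) : Prop :=
  ∃ v : Fin (𝔄.testArity t) → A, u = List.ofFn v ∧ 𝔄.rel t v

end AlgStructure

namespace AlgStructure

variable {ι τ : Type} (𝔄 : AlgStructure ℝ ι τ)

/-- Addition is one of the operations. -/
def HasAdd : Prop := ∃ i, 𝔄.arity i = 2 ∧ ∀ a b, 𝔄.OpValue i [a, b] (a + b)

/-- The `t`-th relation is equality. -/
def IsEqTest (t : τ) : Prop := 𝔄.testArity t = 2 ∧ ∀ a b, 𝔄.RelHolds t [a, b] ↔ a = b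

/-- The `t`-th relation is the strict order. -/
def IsLtTest (t : τ) : Prop := 𝔄.testArity t = 2 ∧ ∀ a b, 𝔄.RelHolds t [a, b] ↔ a < b

/-- All tests are among `=` and `<`. -/
def TestsEqOrLt : Prop := ∀ t, 𝔄.IsEqTest t ∨ 𝔄.IsLtTest t

/-- Equality is one of the tests. -/
def HasEq : Prop := ∃ t, 𝔄.IsEqTest t

/-- The operations are computable, uniformly in their index (for a finite index set: each of them
is computable), and the blank symbol is a computable real. -/
def OpsComputable [Primcodable ι] : Prop :=
  (∃ p : Cantor, Computable p ∧ realRep.names p 𝔄.blank) ∧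
  Computable 𝔄.arity ∧
  ComputableMap (prodRep (discreteRep ι) (listRep realRep)) realRep
    (fun a => {y | 𝔄.OpValue a.1 a.2 y})

/-- The domains of the operations are effectively `F_σ`: uniformly in `i`, the domain of `f_i` is
`⋃ₘ {u | ¬ U i u m}`, where `(i, u, m) ↦ U i u m` is computable into Sierpinski space, that is,
the `m`-th closed set has a semidecidable complement. Automatic for total operations. -/
def DomainsEffectiveFSigma [Primcodable ι] : Prop :=
  ∃ U : ι → List ℝ → ℕ → Prop,
    ComputableMap (prodRep (prodRep (discreteRep ι) (listRep realRep)) natRep) sierpinskiRep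
      (fun a => {U a.1.1 a.1.2 a.2}) ∧
    ∀ (i : ι) (v : Fin (𝔄.arity i) → ℝ), v ∈ (𝔄.op i).Dom ↔ ∃ m, ¬ U i (List.ofFn v) m

/-- Each operation is continuous on its domain. -/
def OpsContinuous : Prop := ∀ i, PartialContinuous (𝔄.op i)

/-- The domain of each operation is an `F_σ` set. Automatic for total operations. -/
def DomainsFSigma : Prop :=
  ∀ i, ∃ C : ℕ → Set (Fin (𝔄.arity i) → ℝ), (∀ m, IsClosed (C m)) ∧ (𝔄.op i).Dom = ⋃ m, C m

open Classical in
/-- The characteristic function `χ_ℍ : ℕ × ℝ^* → {0,1}` of the halting problem. -/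
noncomputable def chiHalting [Primcodable ι] [Primcodable τ] : Problem where
  In := ℕ × List ℝ
  Out := Bool
  inRep := prodRep natRep (listRep realRep)
  outRep := boolRep
  map a := {decide (𝔄.HaltingProblem a.1 a.2)}

open Classical in
/-- The program `P` over `𝔄` decides `S ⊆ ℕ × ℝ^*`: it halts on every input `(n, u)`, with
output `1` if `(n, u) ∈ S` and with output `0` otherwise. -/
def Decides (P : List (Instr ι τ)) (S : ℕ → List ℝ → Prop) : Prop :=
  ∀ (n : ℕ) (u : List ℝ), 𝔄.Outputs P ((n : ℝ) :: u) [if S n u then 1 else 0]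

end AlgStructure

end BSSWeihrauch

open BSSWeihrauch

/-! Rationality and halting are both `F_σ` conditions on names, while having infinitely many ones is
complete for the complements of such conditions. The proof makes this effective, uses `isInfinite`
as the hub of all reductions, and obtains the negative results from Baire category.

Upper bounds. Suppose that `A x` holds iff some number `m`, a guess, is never refuted by a finite
prefix of a name of `x`. A counter that leaves its current guess whenever a prefix refutes it moves
infinitely often iff every guess is refuted, so `A` reduces to the negation of `isInfinite`
(`infinite_refutationMoves_iff`, `ReducesVia.of_refutation`). For rationality a guess is a code of a
rational number. For halting a guess fixes the program, the input length and, step by step, the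
outcome of each test (with a precision that witnesses a strict inequality) or the closed piece of
the domain that contains the arguments of an operation. Such a guess fixes the control flow
completely; only the real registers are approximated, and a wrong guess is eventually exposed
(`Simulates.halts_iff`, `haltingProblem_iff_not_refuted`). The computable and the continuous case
differ only in how operations and domains are approximated: by their realizers
(`exists_computable_opData`) or by their behaviour on cylinders (`exists_sound_opData`).

Lower bounds. As in the irrationality proof for `e`, the sum of `p(n) / (n + 2)!` is rational iff
`p` has finitely many ones (`rational_seriesSum_iff`), and a name of it is computed from `p` bit by
bit. A single program with addition and equality halts on `1 - x, 1, -1, -x, 1`, where `0 ≤ x < 1`,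
iff `x` is rational (`halts_rationalitySearch_iff`). Hence `isInfinite` reduces to both other
problems.

Negative results. Sequences with infinitely many ones and sequences with finitely many are both
dense, so no continuous function separates them on a non-empty open set
(`not_continuousOn_isInfinite`). A reduction to closed choice, or a deciding program with continuous
operations, would by Baire category yield such a function on some open set. -/

namespace Computable

/-! ### Computability of maps over ranges and of folds -/

variable {α β σ : Type*} [Primcodable α] [Primcodable β] [Primcodable σ]

theorem list_map_range {f : α → ℕ → σ} {n : α → ℕ} (hf : Computable₂ f) (hn : Computable n) :
    Computable fun a => (List.range (n a)).map (f a) := by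
  have h : Computable₂ fun (a : α) (x : ℕ × List σ) => x.2 ++ [f a x.1] :=
    (list_concat.comp (snd.comp snd) (hf.comp fst (fst.comp snd))).to₂
  refine (nat_rec hn (const ([] : List σ)) h).of_eq fun a => ?_
  induction n a with
  | zero => rfl
  | succ k ih => simp only [ih, List.range_succ, List.map_append, List.map_cons, List.map_nil]

theorem list_foldl {l : α → List β} {s : α → σ} {h : α → σ × β → σ} (hl : Computable l)
    (hs : Computable s) (hh : Computable₂ h) :
    Computable fun a => (l a).foldl (fun s b => h a (s, b)) (s a) := by
  have h1 : Computable₂ fun (a : α) (x : ℕ × σ) =>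
      ((l a)[x.1]?.elim x.2 fun b => h a (x.2, b)) := by
    have h2 : Computable fun y : α × ℕ × σ => (l y.1)[y.2.1]? :=
      list_getElem?.comp (hl.comp fst) (fst.comp snd)
    have h3 : Computable₂ fun (y : α × ℕ × σ) (b : β) => h y.1 (y.2.2, b) :=
      (hh.comp (fst.comp fst) ((snd.comp (snd.comp fst)).pair snd)).to₂
    refine Computable.of_eq (option_casesOn h2 (snd.comp snd) h3) fun y => ?_
    cases h : (l y.1)[y.2.1]? <;> simp [h]
  refine (nat_rec (list_length.comp hl) hs h1).of_eq fun a => ?_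
  -- The fold is a recursion on the number of entries consumed, so the invariant speaks of `take k`.
  suffices H : ∀ k ≤ (l a).length, Nat.rec (s a)
      (fun k x => (l a)[k]?.elim x fun b => h a (x, b)) k =
      ((l a).take k).foldl (fun s b => h a (s, b)) (s a) by
    simpa using H _ le_rfl
  intro k hk
  induction k with
  | zero => simp
  | succ k ih =>
    rw [List.take_add_one, List.foldl_append, ← ih (by omega)]
    simp [List.getElem?_eq_getElem (show k < (l a).length by omega)]

end Computable

namespace BSSWeihrauch

open Filter Topology

/-! ### Words -/

@[simp] theorem length_initSeg (p : Cantor) (n : ℕ) : (initSeg p n).length = n := by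
  simp [initSeg]

theorem take_initSeg (p : Cantor) {m n : ℕ} (h : m ≤ n) : (initSeg p n).take m = initSeg p m := by
  simp [initSeg, ← List.map_take, List.take_range, h]

theorem initSeg_prefix (p : Cantor) {m n : ℕ} (h : m ≤ n) : initSeg p m <+: initSeg p n := by
  rw [← take_initSeg p h]; exact List.take_prefix _ _

theorem initSeg_eq_iff {p q : Cantor} {n : ℕ} : initSeg p n = initSeg q n ↔ ∀ k < n, p k = q k := by
  simp [initSeg]

theorem getElem?_initSeg (p : Cantor) {n k : ℕ} (h : k < n) : (initSeg p n)[k]? = some (p k) := by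
  simp [initSeg, h]

/-- The first values of a partial sequence, up to the first undefined one. -/
def collect {α : Type*} (f : ℕ → Option α) (n : ℕ) : List α :=
  Nat.rec [] (fun k l => if l.length = k then l ++ (f k).toList else l) n

section collect

variable {α : Type*}

theorem collect_zero (f : ℕ → Option α) : collect f 0 = [] := rfl

theorem collect_succ (f : ℕ → Option α) (n : ℕ) : collect f (n + 1) =
    if (collect f n).length = n then collect f n ++ (f n).toList else collect f n := rfl

theorem collect_eq_map {f : ℕ → Option α} {r : ℕ → α} (h : ∀ n a, f n = some a → a = r n) (n : ℕ) :
    collect f n = (List.range (collect f n).length).map r := by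
  induction n with
  | zero => simp [collect_zero]
  | succ n ih =>
    rw [collect_succ]
    split_ifs with h'
    · cases hf : f n with
      | none => simpa using ih
      | some a =>
        rw [h'] at ih
        simp [h', List.range_succ, ← ih, h n a hf]
    · exact ih

/-- Until the first undefined value every stage appends exactly one entry, so the length equals the
stage; afterwards it never decreases. -/
theorem le_length_collect {f : ℕ → Option α} {N n : ℕ} (h : ∀ k < N, (f k).isSome) (hn : N ≤ n) :
    N ≤ (collect f n).length := by
  induction n with
  | zero => omega
  | succ n ih =>
    rw [collect_succ]
    rcases Nat.lt_or_ge n N with h1 | h1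
    · have h2 : ∀ m ≤ N, (collect f m).length = m := by
        intro m hm
        induction m with
        | zero => simp [collect_zero]
        | succ m ihm =>
          obtain ⟨a, ha⟩ := Option.isSome_iff_exists.1 (h m (by omega))
          rw [collect_succ, if_pos (ihm (by omega)), ha]
          simp [ihm (by omega)]
      obtain ⟨a, ha⟩ := Option.isSome_iff_exists.1 (h n h1)
      rw [if_pos (h2 n (by omega)), ha]
      simp [h2 n (by omega)]
      omega
    · have := ih h1
      split_ifs
      · simp; omega
      · exact this

theorem computable_collect {β σ : Type*} [Primcodable β] [Primcodable σ] {f : β → ℕ → Option σ}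
    {n : β → ℕ} (hf : Computable₂ f) (hn : Computable n) :
    Computable fun b => collect (f b) (n b) := by
  have h : Computable₂ fun (b : β) (x : ℕ × List σ) =>
      bif x.2.length == x.1 then x.2 ++ (f b x.1).toList else x.2 := by
    have e1 : Computable fun y : β × ℕ × List σ => y.2.2 := Computable.snd.comp Computable.snd
    have e2 : Computable fun y : β × ℕ × List σ => y.2.1 := Computable.fst.comp Computable.snd
    exact (Computable.cond (Primrec.beq.to_comp.comp (Computable.list_length.comp e1) e2)
      (Computable.list_append.comp e1 (Primrec.optionToList.to_comp.comp
        (hf.comp Computable.fst e2))) e1).to₂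
  refine (Computable.nat_rec hn (Computable.const ([] : List σ)) h).of_eq fun b => ?_
  induction n b with
  | zero => rfl
  | succ k ih =>
    rw [collect_succ]
    simp only [ih]
    by_cases hk : (collect (f b) k).length = k
    · simp [hk]
    · rw [if_neg hk, beq_false_of_ne hk, cond_false]

end collect

/-- The words `w k` are initial segments of `r` of lengths tending to infinity. -/
def Converges {α : Type*} (w : ℕ → List α) (r : ℕ → α) : Prop :=
  (∀ k, w k = (List.range (w k).length).map r) ∧ Tendsto (fun k => (w k).length) atTop atTop

theorem Converges.eq_initSeg {w : ℕ → List Bool} {r : Cantor} (h : Converges w r) (k : ℕ) :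
    w k = initSeg r (w k).length := h.1 k

theorem Converges.getElem?_eq {α : Type*} {w : ℕ → List α} {r : ℕ → α} (h : Converges w r)
    {k n : ℕ} {a : α} (ha : (w k)[n]? = some a) : a = r n := by
  have hn : n < (w k).length := (List.getElem?_eq_some_iff.1 ha).1
  have h' := h.1 k
  rw [h'] at ha
  simp only [List.getElem?_map, List.getElem?_range hn, Option.map_some, Option.some.injEq] at ha
  exact ha.symm

theorem Converges.eventually_getElem? {α : Type*} {w : ℕ → List α} {r : ℕ → α}
    (h : Converges w r) (n : ℕ) : ∀ᶠ k in atTop, (w k)[n]? = some (r n) := by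
  filter_upwards [h.2.eventually_gt_atTop n] with k hk
  obtain ⟨a, ha⟩ : ∃ a, (w k)[n]? = some a := ⟨_, List.getElem?_eq_getElem hk⟩
  rw [ha, h.getElem?_eq ha]

/-- The approximations `F k` need not grow with `k`. It suffices that known values are correct and
that each single value is eventually known, because finitely many positions are then known
simultaneously. -/
theorem converges_collect {α : Type*} {F : ℕ → ℕ → Option α} {r : ℕ → α}
    (h1 : ∀ k n a, F k n = some a → a = r n) (h2 : ∀ n, ∀ᶠ k in atTop, (F k n).isSome) :
    Converges (fun k => collect (F k) k) r := by
  refine ⟨fun k => collect_eq_map (h1 k) k, tendsto_atTop.2 fun N => ?_⟩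
  have h3 : ∀ᶠ k in atTop, ∀ n ∈ Set.Iio N, (F k n).isSome :=
    (Filter.eventually_all_finite (Set.finite_Iio N)).2 fun n _ => h2 n
  filter_upwards [h3, eventually_ge_atTop N] with k hk hN
  exact le_length_collect hk hN

theorem converges_initSeg (p : Cantor) : Converges (initSeg p) p :=
  ⟨fun k => by simp [initSeg], by simp only [length_initSeg]; exact tendsto_id⟩

/-- A monotone word function cannot write anything wrong along `p`: its output on a prefix and any
prefix of `q` are both contained in its output on a longer prefix, hence comparable. -/
theorem Converges.of_wordFunction {φ : List Bool → List Bool}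
    (hmono : ∀ v w, v <+: w → φ v <+: φ w) {p q : Cantor}
    (hq : ∀ n, ∃ m, initSeg q n <+: φ (initSeg p m)) {w : ℕ → List Bool} (hw : Converges w p) :
    Converges (fun k => φ (w k)) q := by
  have key : ∀ m, φ (initSeg p m) = initSeg q (φ (initSeg p m)).length := by
    intro m
    obtain ⟨m', hm'⟩ := hq (φ (initSeg p m)).length
    have h1 : φ (initSeg p m) <+: φ (initSeg p (max m m')) :=
      hmono _ _ (initSeg_prefix p (le_max_left _ _))
    have h2 : initSeg q (φ (initSeg p m)).length <+: φ (initSeg p (max m m')) :=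
      hm'.trans (hmono _ _ (initSeg_prefix p (le_max_right _ _)))
    exact List.IsPrefix.eq_of_length (List.prefix_of_prefix_length_le h1 h2 (by simp)) (by simp)
  refine ⟨fun k => ?_, tendsto_atTop.2 fun N => ?_⟩
  · show φ (w k) = initSeg q (φ (w k)).length
    rw [hw.eq_initSeg k]
    exact key _
  · obtain ⟨m, hm⟩ := hq N
    filter_upwards [hw.2.eventually_ge_atTop m] with k hk
    have h1 : initSeg q N <+: φ (w k) := by
      rw [hw.eq_initSeg k]
      exact hm.trans (hmono _ _ (initSeg_prefix p hk))
    simpa using h1.length_le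

/-! ### Causal functions -/

/-- `f` is a total function whose `n`-th output bit is computed from the first `n` input bits. -/
def CausalComputable (f : Cantor → Cantor) : Prop :=
  ∃ g : List Bool → Bool, Computable g ∧ ∀ p n, f p n = g (initSeg p n)

theorem continuous_of_causal {f : Cantor → Cantor} {g : List Bool → Bool}
    (h : ∀ p n, f p n = g (initSeg p n)) : Continuous f := by
  refine continuous_pi fun n => ?_
  have h1 : (fun p => f p n) = (fun v : Fin n → Bool => g (List.ofFn v)) ∘
      fun (p : Cantor) (i : Fin n) => p i := by
    funext p
    rw [h, initSeg]
    simp only [Function.comp]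
    congr 1
    apply List.ext_getElem <;> simp
  rw [h1]
  exact continuous_of_discreteTopology.comp (continuous_pi fun i => continuous_apply _)

theorem CausalComputable.continuous {f : Cantor → Cantor} (h : CausalComputable f) :
    Continuous f := by
  obtain ⟨g, -, hg⟩ := h
  exact continuous_of_causal hg

theorem CausalComputable.comp {f f' : Cantor → Cantor} (h' : CausalComputable f')
    (h : CausalComputable f) : CausalComputable (f' ∘ f) := by
  obtain ⟨g, hg, hgf⟩ := h
  obtain ⟨g', hg', hgf'⟩ := h'
  -- Bit `n` of the outer function needs the first `n` bits of `f p`, and bit `k < n` of these needs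
  -- only the first `k` bits of `p`.
  refine ⟨fun v => g' ((List.range v.length).map fun k => g (v.take k)), hg'.comp
    (Computable.list_map_range (hg.comp ((Primrec.list_take.to_comp).comp Computable.snd
      Computable.fst)).to₂ Computable.list_length), fun p n => ?_⟩
  simp only [Function.comp, hgf', length_initSeg]
  congr 1
  refine List.map_congr_left fun k hk => ?_
  rw [hgf, take_initSeg p (List.mem_range.1 hk).le]

theorem CausalComputable.typeTwoComputable {f : Cantor → Cantor} (h : CausalComputable f) :
    TypeTwoComputable fun p => Part.some (f p) := by
  obtain ⟨g, hg, hgf⟩ := h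
  refine ⟨fun v => (List.range v.length).map fun k => g (v.take k), Computable.list_map_range
    (hg.comp ((Primrec.list_take.to_comp).comp Computable.snd Computable.fst)).to₂
    Computable.list_length, ?_, ?_⟩
  · rintro v w ⟨u, rfl⟩
    have : (List.range v.length).map (fun k => g (v.take k)) =
        ((List.range (v ++ u).length).map fun k => g ((v ++ u).take k)).take v.length := by
      rw [← List.map_take, List.take_range]
      simp only [List.length_append, Nat.le_add_right, min_eq_left]
      refine List.map_congr_left fun k hk => ?_
      rw [List.take_append_of_le_length (List.mem_range.1 hk).le]
    beta_reduce
    rw [this]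
    exact List.take_prefix _ _
  · intro p q hq n
    rw [Part.mem_some_iff] at hq
    subst hq
    refine ⟨n, ?_⟩
    have : initSeg (f p) n = (List.range (initSeg p n).length).map
        fun k => g ((initSeg p n).take k) := by
      rw [length_initSeg, initSeg]
      refine List.map_congr_left fun k hk => ?_
      rw [hgf, take_initSeg p (List.mem_range.1 hk).le]
    rw [this]

theorem partialContinuous_some {f : Cantor → Cantor} (h : Continuous f) :
    PartialContinuous fun p => Part.some (f p) := by
  unfold PartialContinuous
  exact h.comp continuous_subtype_val

/-! ### Reductions between decision problems -/

open Classical in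
/-- The characteristic function of a subset of a represented space. -/
noncomputable def charProblem {X : Type} (δ : Representation X) (A : X → Prop) : Problem where
  In := X
  Out := Bool
  inRep := δ
  outRep := boolRep
  map x := {decide (A x)}

open Classical in
/-- `f` maps names of points of `A` to names of points of `B`, and likewise for the complements;
if `b` holds, then the roles of `B` and its complement are exchanged. -/
def ReducesVia {X Y : Type} (f : Cantor → Cantor) (b : Bool) (δX : Representation X) (A : X → Prop)
    (δY : Representation Y) (B : Y → Prop) : Prop :=
  ∀ p x, δX.names p x → ∃ y, δY.names (f p) y ∧ decide (B y) = xor b (decide (A x))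

section reductions

variable {X Y Z : Type} {δX : Representation X} {δY : Representation Y} {δZ : Representation Z}
  {A : X → Prop} {B : Y → Prop} {C : Z → Prop} {f f' : Cantor → Cantor} {b b' : Bool}

theorem ReducesVia.comp (h' : ReducesVia f' b' δY B δZ C) (h : ReducesVia f b δX A δY B) :
    ReducesVia (f' ∘ f) (xor b' b) δX A δZ C := by
  intro p x hx
  obtain ⟨y, hy, h1⟩ := h p x hx
  obtain ⟨z, hz, h2⟩ := h' _ y hy
  exact ⟨z, hz, by rw [h2, h1, Bool.xor_assoc]⟩

/-- The word function of the post-processor that reads one answer bit. -/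
theorem typeTwoComputable_answer (b : Bool) :
    TypeTwoComputable fun p => Part.some fun _ => xor b (p 1) := by
  refine ⟨fun v => (v[1]?.elim [] fun c => (List.range v.length).map fun _ => xor b c), ?_, ?_, ?_⟩
  · have h1 : Computable fun v : List Bool => v[1]? :=
      Computable.list_getElem?.comp Computable.id (Computable.const 1)
    have h2 : Computable₂ fun (v : List Bool) (c : Bool) =>
        (List.range v.length).map fun _ => xor b c :=
      (Computable.list_map_range (f := fun (y : List Bool × Bool) (_ : ℕ) => xor b y.2)
        ((Primrec.dom_finite (fun c => xor b c)).to_comp.comp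
          (Computable.snd.comp Computable.fst)).to₂
        (Computable.list_length.comp Computable.fst)).to₂
    refine (Computable.option_casesOn h1 (Computable.const []) h2).of_eq fun v => ?_
    cases v[1]? <;> rfl
  · rintro v w ⟨u, rfl⟩
    rcases Nat.lt_or_ge 1 v.length with h | h
    · simp only [List.getElem?_append_left h, List.getElem?_eq_getElem h, Option.elim_some,
        List.length_append, List.map_const', List.length_range, List.replicate_add]
      exact List.prefix_append _ _
    · simp [List.getElem?_eq_none h]
  · intro p q hq n
    rw [Part.mem_some_iff] at hq
    subst hq
    -- Two bits must be read before the answer at position `1` is visible; thereafter as many bits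
    -- are written as have been read.
    refine ⟨n + 2, ?_⟩
    beta_reduce
    rw [getElem?_initSeg p (by omega : 1 < n + 2)]
    simp only [Option.elim_some, length_initSeg]
    exact initSeg_prefix (fun _ => xor b (p 1)) (by omega)

theorem partialContinuous_answer (b : Bool) :
    PartialContinuous fun p : Cantor => Part.some (fun _ => xor b (p 1) : Cantor) :=
  partialContinuous_some (continuous_pi fun _ =>
    (continuous_of_discreteTopology (f := fun c => xor b c)).comp (continuous_apply 1))

/-- The answer bit `r 0` of the oracle sits at position `1` of `pairing p r`, and a second `xor`
with `b` undoes the exchange of `B` with its complement. The same two maps serve for the computable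
and the continuous reducibility. -/
theorem ReducesVia.realizes (h : ReducesVia f b δX A δY B) (G : Cantor →. Cantor)
    (hG : Realizes δY boolRep G (charProblem δY B).map) :
    Realizes δX boolRep (sandwich (fun p => Part.some fun _ => xor b (p 1)) G
      fun p => Part.some (f p)) (charProblem δX A).map := by
  classical
  intro p x hx _
  obtain ⟨y, hy, hBA⟩ := h p x hx
  obtain ⟨r, hr, c, hc, hrc⟩ := hG _ y hy (Set.singleton_nonempty _)
  have hc' : r 0 = xor b (decide (A x)) := by
    rw [← hBA]
    have : r 0 = c := hrc
    rw [this]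
    exact Set.mem_singleton_iff.1 hc
  refine ⟨fun _ => xor b (r 0), ?_, decide (A x), rfl, ?_⟩
  · simp only [sandwich, Part.bind_some, Part.mem_bind_iff]
    exact ⟨r, hr, by simp [pairing]⟩
  · show xor b (r 0) = decide (A x)
    rw [hc', ← Bool.xor_assoc, Bool.xor_self, Bool.false_xor]

theorem ReducesVia.weihrauchLE (h : ReducesVia f b δX A δY B) (hf : CausalComputable f) :
    WeihrauchLE (charProblem δX A) (charProblem δY B) :=
  ⟨_, _, typeTwoComputable_answer b, hf.typeTwoComputable, h.realizes⟩

theorem ReducesVia.contWeihrauchLE (h : ReducesVia f b δX A δY B) (hf : Continuous f) :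
    ContWeihrauchLE (charProblem δX A) (charProblem δY B) :=
  ⟨_, _, partialContinuous_answer b, partialContinuous_some hf, h.realizes⟩

end reductions

theorem chiRat_eq : chiRat = charProblem realRep fun x => ∃ q : ℚ, (q : ℝ) = x := rfl

theorem isInfinite_eq :
    isInfinite = charProblem cantorRep fun p => {n : ℕ | p n = true}.Infinite := rfl

theorem AlgStructure.chiHalting_eq {ι τ : Type} [Primcodable ι] [Primcodable τ]
    (𝔄 : AlgStructure ℝ ι τ) : 𝔄.chiHalting =
      charProblem (prodRep natRep (listRep realRep)) fun a => 𝔄.HaltingProblem a.1 a.2 := rfl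

/-! ### Completeness of `isInfinite` among the `F_σ` sets -/

/-- A counter that moves from `m` to `m + 1` when a test word refuting `m` is found. -/
def refutationCount (W : ℕ → List Bool → Bool) (v : List Bool) (k : ℕ) : ℕ :=
  Nat.rec 0 (fun k m => if W m (v.take k.unpair.2) then m + 1 else m) k

/-- The sequence of moves of the counter `refutationCount`. -/
def refutationMoves (W : ℕ → List Bool → Bool) (p : Cantor) : Cantor := fun n =>
  W (refutationCount W (initSeg p n) n) ((initSeg p n).take n.unpair.2)

theorem refutationMoves_causal (W : ℕ → List Bool → Bool) (p : Cantor) (n : ℕ) :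
    refutationMoves W p n = (fun v : List Bool => W (refutationCount W v v.length)
      (v.take v.length.unpair.2)) (initSeg p n) := by
  simp [refutationMoves]

theorem continuous_refutationMoves (W : ℕ → List Bool → Bool) : Continuous (refutationMoves W) :=
  continuous_of_causal (g := fun v => W (refutationCount W v v.length)
    (v.take v.length.unpair.2)) (refutationMoves_causal W)

theorem causalComputable_refutationMoves {W : ℕ → List Bool → Bool} (hW : Computable₂ W) :
    CausalComputable (refutationMoves W) := by
  refine ⟨fun v => W (refutationCount W v v.length) (v.take v.length.unpair.2), ?_,
    refutationMoves_causal W⟩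
  have htake : Computable₂ fun (v : List Bool) (k : ℕ) => v.take k.unpair.2 :=
    (Primrec.list_take.to_comp.comp (Computable.snd.comp
      (Computable.unpair.comp Computable.snd)) Computable.fst).to₂
  have h1 : Computable₂ fun (v : List Bool) (x : ℕ × ℕ) =>
      bif W x.2 (v.take x.1.unpair.2) then x.2 + 1 else x.2 := by
    have e2 : Computable fun y : List Bool × ℕ × ℕ => y.2.2 := Computable.snd.comp Computable.snd
    exact (Computable.cond (hW.comp e2 (htake.comp Computable.fst
      (Computable.fst.comp Computable.snd))) (Computable.succ.comp e2) e2).to₂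
  have h2 : Computable fun v : List Bool => refutationCount W v v.length := by
    refine (Computable.nat_rec Computable.list_length (Computable.const 0) h1).of_eq fun v => ?_
    induction v.length with
    | zero => rfl
    | succ k ih =>
      simp only [refutationCount] at ih ⊢
      rw [ih]
      cases W (refutationCount W v k) (v.take k.unpair.2) <;> simp_all
  exact hW.comp h2 (htake.comp Computable.id Computable.list_length)

/-- If `m` is never refuted, the counter cannot pass `m`, and it counts the moves, so there are
finitely many. If the moves stop, the final value of the counter is a guess that is never refuted,
since step `k` inspects the prefix of length `k.unpair.2` and so every prefix is inspected
infinitely often. No monotonicity of `W` in the word is needed. -/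
theorem infinite_refutationMoves_iff (W : ℕ → List Bool → Bool) (p : Cantor) :
    {n | refutationMoves W p n = true}.Infinite ↔ ∀ m, ∃ k, W m (initSeg p k) = true := by
  -- the counter along `p`
  let c : ℕ → ℕ := fun k => refutationCount W (initSeg p k) k
  have hcount : ∀ N k, k ≤ N → refutationCount W (initSeg p N) k = c k := by
    intro N k hk
    induction k generalizing N with
    | zero => rfl
    | succ k ih =>
      have hu : k.unpair.2 ≤ k := Nat.unpair_right_le k
      have h1 : ∀ M, k + 1 ≤ M → refutationCount W (initSeg p M) (k + 1) =
          if W (c k) (initSeg p k.unpair.2) then c k + 1 else c k := by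
        intro M hM
        rw [← ih M (by omega), ← take_initSeg p (show k.unpair.2 ≤ M by omega)]
        rfl
      rw [h1 N hk]
      exact (h1 (k + 1) le_rfl).symm
  have hmove : ∀ k, refutationMoves W p k = W (c k) (initSeg p k.unpair.2) := by
    intro k
    rw [refutationMoves, take_initSeg p (Nat.unpair_right_le k)]
  have hc : ∀ k, c (k + 1) = if refutationMoves W p k = true then c k + 1 else c k := by
    intro k
    rw [hmove, ← hcount (k + 1) k (by omega), ← take_initSeg p
      (show k.unpair.2 ≤ k + 1 from (Nat.unpair_right_le k).trans (by omega))]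
    rfl
  have hmono : Monotone c := monotone_nat_of_le_succ fun k => by
    rw [hc]; split_ifs <;> omega
  constructor
  · intro hinf m
    by_contra hm
    push Not at hm
    have hle : ∀ k, c k ≤ m := by
      intro k
      induction k with
      | zero => exact Nat.zero_le _
      | succ k ih =>
        rw [hc]
        split_ifs with h
        · rcases ih.lt_or_eq with h' | h'
          · omega
          · rw [hmove, h'] at h
            exact absurd h (hm _)
        · exact ih
    -- the number of moves is bounded by the counter
    have hcard : ∀ N, ((Finset.range N).filter fun k => refutationMoves W p k = true).card =
        c N := by
      intro N
      induction N with
      | zero => rfl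
      | succ N ih =>
        rw [Finset.range_add_one, Finset.filter_insert, hc]
        split_ifs with h
        · rw [Finset.card_insert_of_notMem (by simp), ih]
        · exact ih
    -- `m + 1` moves would carry the counter past `m`.
    obtain ⟨t, ht, htc⟩ := hinf.exists_subset_card_eq (m + 1)
    obtain ⟨N, hN⟩ := t.exists_nat_subset_range
    have h1 : t ⊆ (Finset.range N).filter fun k => refutationMoves W p k = true := fun k hk =>
      Finset.mem_filter.2 ⟨hN hk, ht hk⟩
    have h2 := Finset.card_le_card h1
    rw [hcard, htc] at h2
    have := hle N
    omega
  · intro hall hfin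
    obtain ⟨N, hN⟩ := hfin.bddAbove
    have hconst : ∀ k, N + 1 ≤ k → c k = c (N + 1) := by
      intro k hk
      induction k, hk using Nat.le_induction with
      | base => rfl
      | succ k hk ih =>
        rw [hc, if_neg, ih]
        intro h
        have := hN h
        omega
    obtain ⟨j, hj⟩ := hall (c (N + 1))
    -- This step comes after the last move and inspects the refuting prefix of length `j`, which
    -- forces another move.
    have h1 : N + 1 ≤ Nat.pair (N + 1) j := Nat.left_le_pair _ _
    have h2 : refutationMoves W p (Nat.pair (N + 1) j) = true := by
      rw [hmove, hconst _ h1, Nat.unpair_pair, hj]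
    have := hN h2
    omega

/-- The common form of both upper bounds: an `F_σ` description of `A` on names gives a reduction,
with the roles of a set and its complement exchanged. -/
theorem ReducesVia.of_refutation {X : Type} {δ : Representation X} {A : X → Prop}
    {W : ℕ → List Bool → Bool}
    (h : ∀ p x, δ.names p x → (A x ↔ ∃ m, ∀ k, W m (initSeg p k) = false)) :
    ReducesVia (refutationMoves W) true δ A cantorRep
      fun p => {n : ℕ | p n = true}.Infinite := by
  classical
  intro p x hx
  refine ⟨_, rfl, ?_⟩
  rw [Bool.true_xor, ← decide_not, decide_eq_decide]
  refine (infinite_refutationMoves_iff W p).trans ?_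
  rw [h p x hx]
  simp

end BSSWeihrauch

namespace BSSWeihrauch

open Filter Topology

/-! ### Block codes and names of real numbers -/

/-- One step of the parser for block codes: the length of the current block and the list of the
lengths of the completed blocks. -/
def parseStep (s : ℕ × List ℕ) (b : Bool) : ℕ × List ℕ :=
  bif b then (0, s.2 ++ [s.1]) else (s.1 + 1, s.2)

/-- The lengths of the completed blocks of `w`. -/
def blocks (w : List Bool) : List ℕ := (w.foldl parseStep (0, [])).2

theorem initSeg_succ (p : Cantor) (n : ℕ) : initSeg p (n + 1) = initSeg p n ++ [p n] := by
  simp [initSeg, List.range_succ]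

/-- Invariant of the parser: `j` blocks are complete, and the current one is a part of block `j`.
The length equation then decides whether the next bit is the `1` that closes this block. -/
theorem IsBlockCode.parse {p : Cantor} {s : ℕ → ℕ} (h : IsBlockCode p s) (L : ℕ) :
    ∃ j, ((initSeg p L).foldl parseStep (0, [])).2 = (List.range j).map s ∧
      ((initSeg p L).foldl parseStep (0, [])).1 ≤ s j ∧
      L = (∑ i ∈ Finset.range j, s i) + j + ((initSeg p L).foldl parseStep (0, [])).1 := by
  induction L with
  | zero => exact ⟨0, by simp [initSeg], by simp [initSeg], by simp [initSeg]⟩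
  | succ L ih =>
    obtain ⟨j, h1, h2, h3⟩ := ih
    rw [initSeg_succ, List.foldl_append, List.foldl_cons, List.foldl_nil]
    set st := (initSeg p L).foldl parseStep (0, []) with hst
    have hj : onePos s j = (∑ i ∈ Finset.range j, s i) + s j + j := by
      rw [onePos, Finset.sum_range_succ]
    rcases h2.lt_or_eq with h4 | h4
    · have hp : p L = false := by
        rw [← Bool.not_eq_true, h]
        rintro ⟨i, hi⟩
        rcases Nat.lt_or_ge i j with hij | hij
        · obtain ⟨j', rfl⟩ : ∃ j', j = j' + 1 := ⟨j - 1, by omega⟩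
          have := (onePos_strictMono s).monotone (show i ≤ j' by omega)
          have h5 : onePos s j' = (∑ i ∈ Finset.range (j' + 1), s i) + j' := rfl
          omega
        · have := (onePos_strictMono s).monotone hij
          omega
      refine ⟨j, ?_, ?_, ?_⟩ <;> simp only [parseStep, hp, cond_false]
      · exact h1
      · omega
      · omega
    · have hp : p L = true := (h L).2 ⟨j, by omega⟩
      refine ⟨j + 1, ?_, ?_, ?_⟩ <;> simp only [parseStep, hp, cond_true]
      · rw [h1, h4, List.range_succ, List.map_append]; rfl
      · exact Nat.zero_le _
      · rw [Finset.sum_range_succ]; omega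

theorem IsBlockCode.converges_blocks {p : Cantor} {s : ℕ → ℕ} (h : IsBlockCode p s)
    {w : ℕ → List Bool} (hw : Converges w p) : Converges (fun k => blocks (w k)) s := by
  have key : ∀ k, ∃ j, blocks (w k) = (List.range j).map s ∧ (w k).length ≤ onePos s j := by
    intro k
    obtain ⟨j, h1, h2, h3⟩ := h.parse (w k).length
    rw [← hw.eq_initSeg k] at h1 h2 h3
    refine ⟨j, h1, ?_⟩
    rw [onePos, Finset.sum_range_succ]
    omega
  choose j hj hle using key
  have hlen : ∀ k, (blocks (w k)).length = j k := fun k => by rw [hj]; simp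
  refine ⟨fun k => by rw [hlen]; exact hj k, tendsto_atTop.2 fun N => ?_⟩
  filter_upwards [hw.2.eventually_gt_atTop (onePos s N)] with k hk
  rw [hlen]
  exact ((onePos_strictMono s).lt_iff_lt.1 (hk.trans_le (hle k))).le

/-- The word `0^{l 0} 1 0^{l 1} 1 …`. -/
def blockWord (l : List ℕ) : List Bool :=
  l.flatMap fun c => (List.range c).map (fun _ => false) ++ [true]

open Classical in
/-- The sequence `0^{s 0} 1 0^{s 1} 1 …`. -/
noncomputable def blockSeq (s : ℕ → ℕ) : Cantor := fun n => decide (∃ i, n = onePos s i)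

theorem isBlockCode_blockSeq (s : ℕ → ℕ) : IsBlockCode (blockSeq s) s := fun n => by
  simp [blockSeq]

theorem blockWord_map_range (s : ℕ → ℕ) (j : ℕ) : blockWord ((List.range j).map s) =
    initSeg (blockSeq s) ((∑ i ∈ Finset.range j, s i) + j) := by
  induction j with
  | zero => simp [blockWord, initSeg]
  | succ j ih =>
    have hj : onePos s j = (∑ i ∈ Finset.range j, s i) + j + s j := by
      rw [onePos, Finset.sum_range_succ]; omega
    rw [List.range_succ, List.map_append, blockWord, List.flatMap_append, ← blockWord, ih,
      Finset.sum_range_succ, show (∑ i ∈ Finset.range j, s i) + s j + (j + 1) =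
        (∑ i ∈ Finset.range j, s i) + j + s j + 1 by omega, initSeg_succ]
    simp only [List.map_cons, List.map_nil, List.flatMap_cons, List.flatMap_nil, List.append_nil]
    rw [← List.append_assoc]
    have hlast : blockSeq s ((∑ i ∈ Finset.range j, s i) + j + s j) = true :=
      (isBlockCode_blockSeq s _).2 ⟨j, hj.symm⟩
    rw [hlast]
    congr 1
    -- It remains to see that the `s j` positions before the closing `1` carry zeros, as they lie
    -- strictly between consecutive values of `onePos s`.
    have hM : ∀ M, initSeg (blockSeq s) (M + s j) = initSeg (blockSeq s) M ++
        (List.range (s j)).map fun k => blockSeq s (M + k) := fun M => by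
      rw [initSeg, initSeg, List.range_add, List.map_append, List.map_map]; rfl
    rw [hM]
    congr 1
    refine List.map_congr_left fun k hk => ?_
    rw [List.mem_range] at hk
    symm
    rw [← Bool.not_eq_true]
    intro hb
    obtain ⟨i, hi⟩ := (isBlockCode_blockSeq s _).1 hb
    rcases Nat.lt_or_ge i j with hij | hij
    · obtain ⟨j', rfl⟩ : ∃ j', j = j' + 1 := ⟨j - 1, by omega⟩
      have := (onePos_strictMono s).monotone (show i ≤ j' by omega)
      have h5 : onePos s j' = (∑ i ∈ Finset.range (j' + 1), s i) + j' := rfl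
      omega
    · have := (onePos_strictMono s).monotone hij
      omega

theorem Converges.blockWord {l : ℕ → List ℕ} {s : ℕ → ℕ} (h : Converges l s) :
    Converges (fun k => blockWord (l k)) (blockSeq s) := by
  have key : ∀ k, BSSWeihrauch.blockWord (l k) = initSeg (blockSeq s)
      ((∑ i ∈ Finset.range (l k).length, s i) + (l k).length) := fun k => by
    rw [← blockWord_map_range, ← h.1 k]
  refine ⟨fun k => ?_, tendsto_atTop_mono (fun k => ?_) h.2⟩
  · have hl := congrArg List.length (key k)
    rw [length_initSeg] at hl
    exact (key k).trans (congrArg _ hl.symm)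
  · have hl := congrArg List.length (key k)
    rw [length_initSeg] at hl
    beta_reduce
    omega

/-- Every block has at least one bit, so the first `n + 1` blocks already cover position `n`. This
makes names written as block sequences causal. -/
theorem blockSeq_eq_getD (s : ℕ → ℕ) (n : ℕ) :
    blockSeq s n = (blockWord ((List.range (n + 1)).map s)).getD n false := by
  rw [blockWord_map_range, List.getD_eq_getElem?_getD, getElem?_initSeg _ (by omega)]
  rfl

theorem primrec_blocks : Primrec blocks := by
  have h : Primrec₂ fun (_ : List Bool) (x : (ℕ × List ℕ) × Bool) => parseStep x.1 x.2 := by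
    have e1 : Primrec fun y : List Bool × (ℕ × List ℕ) × Bool => y.2.1 :=
      Primrec.fst.comp Primrec.snd
    exact (Primrec.cond (Primrec.snd.comp Primrec.snd)
      ((Primrec.const 0).pair (Primrec.list_concat.comp (Primrec.snd.comp e1)
        (Primrec.fst.comp e1)))
      ((Primrec.succ.comp (Primrec.fst.comp e1)).pair (Primrec.snd.comp e1))).to₂
  exact Primrec.snd.comp (Primrec.list_foldl Primrec.id (Primrec.const (0, [])) h)

theorem primrec_blockWord : Primrec blockWord := by
  have h : Primrec₂ fun (_ : List ℕ) (c : ℕ) => (List.range c).map (fun _ => false) ++ [true] :=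
    (Primrec.list_append.comp (Primrec.list_map (Primrec.list_range.comp Primrec.snd)
      ((Primrec.const false).to₂)) (Primrec.const [true])).to₂
  exact Primrec.list_flatMap Primrec.id h

/-- `ν_ℚ(a) + 2 · 2^{-i} ≤ ν_ℚ(b)`, in terms of natural numbers. -/
def farBelow (a b i : ℕ) : Bool :=
  decide (2 ^ i * (a.unpair.1 * (b.unpair.2.unpair.2 + 1) +
      b.unpair.2.unpair.1 * (a.unpair.2.unpair.2 + 1)) +
    2 * ((a.unpair.2.unpair.2 + 1) * (b.unpair.2.unpair.2 + 1)) ≤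
    2 ^ i * (b.unpair.1 * (a.unpair.2.unpair.2 + 1) +
      a.unpair.2.unpair.1 * (b.unpair.2.unpair.2 + 1)))

theorem farBelow_iff {a b i : ℕ} :
    farBelow a b i = true ↔ (nuQ a : ℝ) + 2 * (1 / 2) ^ i ≤ nuQ b := by
  have h2 : (0 : ℝ) < 2 ^ i := by positivity
  have ha : (0 : ℝ) < (a.unpair.2.unpair.2 : ℝ) + 1 := by positivity
  have hb : (0 : ℝ) < (b.unpair.2.unpair.2 : ℝ) + 1 := by positivity
  rw [farBelow, decide_eq_true_iff, ← Nat.cast_le (α := ℝ)]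
  simp only [nuQ]
  push_cast
  rw [one_div, inv_pow, div_add' _ _ _ ha.ne', div_le_div_iff₀ ha hb]
  generalize (a.unpair.2.unpair.2 : ℝ) = c at *
  generalize (b.unpair.2.unpair.2 : ℝ) = d at *
  generalize (2 : ℝ) ^ i = t at *
  rw [← mul_le_mul_iff_right₀ h2 (a := t) (b := (_ : ℝ) * _)]
  have h3 : t * t⁻¹ = 1 := mul_inv_cancel₀ h2.ne'
  have h4 : ∀ u v : ℝ, t * ((u - v + 2 * t⁻¹ * (c + 1)) * (d + 1)) =
      t * (u * (d + 1)) - t * (v * (d + 1)) + t * t⁻¹ * (2 * ((c + 1) * (d + 1))) := by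
    intros; ring
  rw [h4, h3]
  constructor <;> intro h <;> linarith

theorem primrec_two_pow : Primrec fun i : ℕ => 2 ^ i :=
  (Primrec.nat_rec₁ 1 (f := fun _ m => m + m)
    (Primrec.nat_add.comp Primrec.snd Primrec.snd).to₂).of_eq fun i => by
    induction i with
    | zero => rfl
    | succ i ih => rw [pow_succ, ← ih]; exact (mul_two _).symm

theorem primrec_farBelow : Primrec fun x : ℕ × ℕ × ℕ => farBelow x.1 x.2.1 x.2.2 := by
  have a : Primrec fun x : ℕ × ℕ × ℕ => x.1 := Primrec.fst
  have b : Primrec fun x : ℕ × ℕ × ℕ => x.2.1 := Primrec.fst.comp Primrec.snd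
  have i : Primrec fun x : ℕ × ℕ × ℕ => 2 ^ x.2.2 :=
    primrec_two_pow.comp (Primrec.snd.comp Primrec.snd)
  have p1 : Primrec fun n : ℕ => n.unpair.1 := Primrec.fst.comp Primrec.unpair
  have p2 : Primrec fun n : ℕ => n.unpair.2.unpair.1 :=
    p1.comp (Primrec.snd.comp Primrec.unpair)
  have p3 : Primrec fun n : ℕ => n.unpair.2.unpair.2 + 1 :=
    Primrec.succ.comp (Primrec.snd.comp (Primrec.unpair.comp (Primrec.snd.comp Primrec.unpair)))
  have add {f g : ℕ × ℕ × ℕ → ℕ} (hf : Primrec f) (hg : Primrec g) :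
    Primrec fun x => f x + g x := Primrec.nat_add.comp hf hg
  have mul {f g : ℕ × ℕ × ℕ → ℕ} (hf : Primrec f) (hg : Primrec g) :
    Primrec fun x => f x * g x := Primrec.nat_mul.comp hf hg
  exact Primrec.nat_le.decide.comp
    (add (mul i (add (mul (p1.comp a) (p3.comp b)) (mul (p2.comp b) (p3.comp a))))
      (mul (Primrec.const 2) (mul (p3.comp a) (p3.comp b))))
    (mul i (add (mul (p1.comp b) (p3.comp a)) (mul (p2.comp a) (p3.comp b))))

theorem exists_two_pow_lt {ε : ℝ} (hε : 0 < ε) : ∃ i : ℕ, (1 / 2 : ℝ) ^ i < ε :=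
  exists_pow_lt_of_lt_one hε (by norm_num)

/-! ### A decision procedure for rationality with a question to `isInfinite` -/

/-- The word `w` shows that `ν_ℚ(m)` is not the real number named. -/
def refutesRat (m : ℕ) (w : List Bool) : Bool :=
  (blocks w)[w.length.unpair.1]?.elim false fun c =>
    farBelow c m w.length.unpair.1 || farBelow m c w.length.unpair.1

theorem computable_refutesRat : Computable₂ refutesRat := by
  have hi : Primrec fun y : ℕ × List Bool => y.2.length.unpair.1 :=
    Primrec.fst.comp (Primrec.unpair.comp (Primrec.list_length.comp Primrec.snd))
  have h1 : Primrec fun y : ℕ × List Bool => (blocks y.2)[y.2.length.unpair.1]? :=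
    Primrec.list_getElem?.comp (primrec_blocks.comp Primrec.snd) hi
  have hi' : Primrec fun z : (ℕ × List Bool) × ℕ => z.1.2.length.unpair.1 :=
    hi.comp Primrec.fst
  have hm : Primrec fun z : (ℕ × List Bool) × ℕ => z.1.1 := Primrec.fst.comp Primrec.fst
  have h2 : Primrec₂ fun (y : ℕ × List Bool) (c : ℕ) =>
      farBelow c y.1 y.2.length.unpair.1 || farBelow y.1 c y.2.length.unpair.1 :=
    (Primrec.or.comp (primrec_farBelow.comp (Primrec.snd.pair (hm.pair hi')))
      (primrec_farBelow.comp (hm.pair (Primrec.snd.pair hi')))).to₂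
  refine (Primrec.option_casesOn h1 (Primrec.const false) h2).to_comp.of_eq fun y => ?_
  simp only [refutesRat]
  cases (blocks y.2)[y.2.length.unpair.1]? <;> rfl

/-- Equality with a fixed rational is a closed condition, and rationality is the countable union of
these. The length of the inspected word also codes the precision `i`, so that each precision is
tried on arbitrarily long prefixes. -/
theorem rational_iff_not_refuted {p : Cantor} {x : ℝ} (hp : realRep.names p x) :
    (∃ q : ℚ, (q : ℝ) = x) ↔ ∃ m, ∀ k, refutesRat m (initSeg p k) = false := by
  obtain ⟨s, hs, hx⟩ := hp
  have hconv := hs.converges_blocks (converges_initSeg p)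
  have key : ∀ m, (nuQ m : ℝ) = x ↔ ∀ k, refutesRat m (initSeg p k) = false := by
    intro m
    constructor
    · rintro rfl k
      rw [refutesRat, length_initSeg]
      cases hc : (blocks (initSeg p k))[k.unpair.1]? with
      | none => rfl
      | some c =>
        obtain rfl := hconv.getElem?_eq hc
        have h1 := abs_lt.1 (hx k.unpair.1)
        have h2 : (0 : ℝ) < (1 / 2) ^ k.unpair.1 := by positivity
        rw [Option.elim_some, Bool.or_eq_false_iff]
        constructor <;> rw [← Bool.not_eq_true, farBelow_iff] <;> intro h3 <;> linarith
    · intro h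
      by_contra hne
      -- Of the distance, which exceeds `3 · 2^{-i}`, one `2^{-i}` is lost to the error of the
      -- `i`-th approximation, and the margin `2 · 2^{-i}` demanded by `farBelow` remains.
      obtain ⟨i, hi⟩ := exists_two_pow_lt (div_pos (abs_pos.2 (sub_ne_zero.2 hne)) three_pos)
      obtain ⟨K, hK⟩ := (hconv.eventually_getElem? i).exists_forall_of_atTop
      have h1 := h (Nat.pair i K)
      rw [refutesRat, length_initSeg, Nat.unpair_pair, hK _ (Nat.right_le_pair _ _),
        Option.elim_some, Bool.or_eq_false_iff] at h1
      have h2 := abs_lt.1 (hx i)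
      rw [lt_div_iff₀ three_pos] at hi
      rcases lt_or_gt_of_ne hne with h3 | h3
      · rw [abs_of_neg (by linarith)] at hi
        have := farBelow_iff.2 (show (nuQ m : ℝ) + 2 * (1 / 2) ^ i ≤ nuQ (s i) by linarith)
        rw [this] at h1
        exact absurd h1.2 (by simp)
      · rw [abs_of_pos (by linarith)] at hi
        have := farBelow_iff.2 (show (nuQ (s i) : ℝ) + 2 * (1 / 2) ^ i ≤ nuQ m by linarith)
        rw [this] at h1
        exact absurd h1.1 (by simp)
  constructor
  · rintro ⟨q, rfl⟩
    obtain ⟨m, rfl⟩ := nuQ_surjective q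
    exact ⟨m, (key m).1 rfl⟩
  · rintro ⟨m, hm⟩
    exact ⟨_, (key m).2 hm⟩

theorem reducesVia_rational_infinite : ReducesVia (refutationMoves refutesRat) true realRep
    (fun x => ∃ q : ℚ, (q : ℝ) = x) cantorRep fun p => {n : ℕ | p n = true}.Infinite :=
  ReducesVia.of_refutation fun _ _ hp => rational_iff_not_refuted hp

/-! ### Factorial series -/

/-- One step in the computation of a partial sum of `∑ p(n) / (n + 2)!`: number of summands,
numerator and denominator. -/
def sumStep (t : ℕ × ℕ × ℕ) (b : Bool) : ℕ × ℕ × ℕ :=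
  (t.1 + 1, t.2.1 * (t.1 + 2) + (bif b then 1 else 0), t.2.2 * (t.1 + 2))

/-- The partial sum given by the word `v`. -/
def sumState (v : List Bool) : ℕ × ℕ × ℕ := v.foldl sumStep (0, 0, 1)

theorem sumState_initSeg_succ (p : Cantor) (n : ℕ) :
    sumState (initSeg p (n + 1)) = sumStep (sumState (initSeg p n)) (p n) := by
  rw [initSeg_succ, sumState, List.foldl_append]; rfl

/-- The numerator of the `n`-th partial sum of `∑ p(n) / (n + 2)!`. -/
def sumNum (p : Cantor) (n : ℕ) : ℕ := (sumState (initSeg p n)).2.1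

theorem sumState_fst (p : Cantor) (n : ℕ) : (sumState (initSeg p n)).1 = n := by
  induction n with
  | zero => rfl
  | succ n ih => rw [sumState_initSeg_succ]; simp [sumStep, ih]

theorem sumState_den (p : Cantor) (n : ℕ) : (sumState (initSeg p n)).2.2 = (n + 1).factorial := by
  induction n with
  | zero => rfl
  | succ n ih =>
    rw [sumState_initSeg_succ, Nat.factorial_succ (n + 1)]
    simp only [sumStep, ih, sumState_fst]
    ring

theorem sumNum_zero (p : Cantor) : sumNum p 0 = 0 := rfl

theorem sumNum_succ (p : Cantor) (n : ℕ) :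
    sumNum p (n + 1) = sumNum p n * (n + 2) + (bif p n then 1 else 0) := by
  rw [sumNum, sumState_initSeg_succ]
  simp only [sumStep, sumState_fst, sumNum]

/-- The `n`-th partial sum of `∑ p(n) / (n + 2)!`. -/
noncomputable def partialSum (p : Cantor) (n : ℕ) : ℝ := sumNum p n / (n + 1).factorial

theorem partialSum_succ (p : Cantor) (n : ℕ) : partialSum p (n + 1) =
    partialSum p n + (bif p n then 1 else 0) / (n + 2).factorial := by
  have h : ((n + 2).factorial : ℝ) = (n + 2) * (n + 1).factorial := by
    rw [Nat.factorial_succ (n + 1)]; push_cast; ring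
  have h1 : ((n + 1).factorial : ℝ) ≠ 0 := by positivity
  have h2 : (n + 2 : ℝ) ≠ 0 := by positivity
  rw [partialSum, partialSum, sumNum_succ, show n + 1 + 1 = n + 2 from rfl, h]
  cases p n <;> push_cast <;> field_simp <;> simp

theorem partialSum_mono (p : Cantor) : Monotone (partialSum p) :=
  monotone_nat_of_le_succ fun n => by
    rw [partialSum_succ]
    have : (0 : ℝ) ≤ (bif p n then 1 else 0) / (n + 2).factorial := by
      cases p n <;> simp
    linarith

/-- An upper bound for the sum of the series. -/
noncomputable def upperSum (p : Cantor) (n : ℕ) : ℝ := partialSum p n + 1 / (n + 1).factorial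

/-- Since `1 / (n + 1)!` is `(n + 2) / (n + 2)!`, one share pays for the next summand, one for the
next tail bound, and `n` shares are left over. -/
theorem upperSum_succ_le (p : Cantor) (n : ℕ) :
    upperSum p (n + 1) + n / (n + 2).factorial ≤ upperSum p n := by
  rw [upperSum, upperSum, partialSum_succ, show n + 1 + 1 = n + 2 from rfl]
  have h : ((n + 2).factorial : ℝ) = (n + 2) * (n + 1).factorial := by
    rw [Nat.factorial_succ (n + 1)]; push_cast; ring
  have h1 : (0 : ℝ) < (n + 2).factorial := by positivity
  have h3 : (1 : ℝ) / (n + 1).factorial = (n + 2) / (n + 2).factorial := by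
    rw [h]
    have : (n + 2 : ℝ) ≠ 0 := by positivity
    have : ((n + 1).factorial : ℝ) ≠ 0 := by positivity
    field_simp
  rw [h3]
  have h2 : ((bif p n then 1 else 0 : ℝ)) / (n + 2).factorial ≤ 1 / (n + 2).factorial := by
    cases p n
    · simp
    · simp
  have h4 : (n + 2 : ℝ) / (n + 2).factorial = n / (n + 2).factorial + 1 / (n + 2).factorial +
    1 / (n + 2).factorial := by ring
  linarith

theorem upperSum_anti (p : Cantor) : Antitone (upperSum p) :=
  antitone_nat_of_succ_le fun n => by
    have h1 := upperSum_succ_le p n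
    have h2 : (0 : ℝ) ≤ n / (n + 2).factorial := by positivity
    linarith

theorem partialSum_le_upperSum (p : Cantor) (m n : ℕ) : partialSum p m ≤ upperSum p n := by
  have h1 := partialSum_mono p (le_max_left m n)
  have h2 := upperSum_anti p (le_max_right m n)
  have h3 : (0 : ℝ) ≤ 1 / ((max m n) + 1).factorial := by positivity
  have h4 : upperSum p (max m n) = partialSum p (max m n) + 1 / ((max m n) + 1).factorial := rfl
  linarith

/-- The real number `∑ p(n) / (n + 2)!`. -/
noncomputable def seriesSum (p : Cantor) : ℝ := ⨆ n, partialSum p n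

theorem partialSum_le_seriesSum (p : Cantor) (n : ℕ) : partialSum p n ≤ seriesSum p :=
  le_ciSup (f := partialSum p) ⟨upperSum p 0, by
    rintro _ ⟨m, rfl⟩; exact partialSum_le_upperSum p m 0⟩ n

theorem seriesSum_lt_upperSum (p : Cantor) (n : ℕ) : seriesSum p < upperSum p n := by
  -- The leftover `n / (n + 2)!` vanishes for `n = 0`; strictness is therefore taken from the step
  -- between `n + 1` and `n + 2`.
  have h1 : seriesSum p ≤ upperSum p (n + 2) := ciSup_le fun m => partialSum_le_upperSum p m _
  have h2 := upperSum_succ_le p (n + 1)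
  have h3 := upperSum_anti p (show n ≤ n + 1 by omega)
  have h4 : (0 : ℝ) < ((n + 1 : ℕ) : ℝ) / (n + 1 + 2).factorial := by positivity
  have h5 : n + 1 + 1 = n + 2 := rfl
  rw [h5] at h2
  linarith

theorem seriesSum_nonneg (p : Cantor) : 0 ≤ seriesSum p := by
  have := partialSum_le_seriesSum p 0
  simpa [partialSum, sumNum_zero] using this

theorem seriesSum_lt_one (p : Cantor) : seriesSum p < 1 := by
  have := seriesSum_lt_upperSum p 0
  simpa [upperSum, partialSum, sumNum_zero] using this

theorem two_pow_le_factorial_succ (n : ℕ) : 2 ^ n ≤ (n + 1).factorial := by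
  induction n with
  | zero => simp
  | succ n ih =>
    rw [Nat.factorial_succ, pow_succ, mul_comm]
    exact Nat.mul_le_mul (by omega) ih

theorem abs_seriesSum_sub_lt (p : Cantor) (n : ℕ) :
    |seriesSum p - partialSum p n| < (1 / 2) ^ n := by
  have h1 := partialSum_le_seriesSum p n
  have h2 := seriesSum_lt_upperSum p n
  have h3 : (1 : ℝ) / (n + 1).factorial ≤ (1 / 2) ^ n := by
    rw [one_div_pow]
    apply one_div_le_one_div_of_le (by positivity)
    exact_mod_cast two_pow_le_factorial_succ n
  rw [abs_lt]
  rw [upperSum] at h2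
  constructor <;> linarith [show (0 : ℝ) < (1 / 2) ^ n by positivity]

/-- If `x` is rational with denominator `K`, then `(K + 1)! x` is an integer in the half-open unit
interval starting at the integer `sumNum p K`. Hence `x` equals its `K`-th partial sum and no later
summand occurs. The converse is the finiteness of the sum. -/
theorem rational_seriesSum_iff (p : Cantor) :
    (∃ q : ℚ, (q : ℝ) = seriesSum p) ↔ ¬ {n : ℕ | p n = true}.Infinite := by
  rw [Set.not_infinite]
  constructor
  · rintro ⟨q, hq⟩
    set K := q.den with hK
    -- the scaled remainder is an integer in `[0, 1)`
    have hfac : (0 : ℝ) < (K + 1).factorial := by positivity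
    obtain ⟨d, hd⟩ : q.den ∣ (K + 1).factorial :=
      Nat.dvd_factorial q.den_pos (by omega)
    have hint : seriesSum p * (K + 1).factorial = ((q.num * d : ℤ) : ℝ) := by
      rw [← hq, hd]
      push_cast
      have h1 : (q : ℝ) * q.den = q.num := by exact_mod_cast Rat.mul_den_eq_num q
      rw [← mul_assoc, h1]
    have h1 := partialSum_le_seriesSum p K
    have h2 := seriesSum_lt_upperSum p K
    rw [upperSum, partialSum, ← add_div, lt_div_iff₀ hfac, hint] at h2
    rw [partialSum, div_le_iff₀ hfac, hint] at h1
    have h3 : (q.num * d : ℤ) = sumNum p K := by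
      have h1' : ((sumNum p K : ℤ)) ≤ q.num * d := by exact_mod_cast h1
      have h2' : (q.num * d : ℤ) < sumNum p K + 1 := by exact_mod_cast h2
      omega
    have h4 : seriesSum p = partialSum p K := by
      rw [partialSum, eq_div_iff hfac.ne', hint, h3]
      simp
    refine (Set.finite_Iio K).subset fun n hn => ?_
    by_contra hKn
    have h5 := partialSum_le_seriesSum p (n + 1)
    have h6 := partialSum_mono p (show K ≤ n by simpa using hKn)
    have hn' : p n = true := hn
    rw [partialSum_succ, hn', h4, cond_true] at h5
    have h7 : (0 : ℝ) < 1 / (n + 2).factorial := by positivity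
    linarith
  · intro hfin
    obtain ⟨N, hN⟩ := hfin.bddAbove
    have hconst : ∀ n, N + 1 ≤ n → partialSum p n = partialSum p (N + 1) := by
      intro n hn
      induction n, hn using Nat.le_induction with
      | base => rfl
      | succ n hn ih =>
        have hpn : p n = false := by
          rw [← Bool.not_eq_true]
          intro h
          have := hN h
          omega
        rw [partialSum_succ, hpn, ih]
        simp
    have hx : seriesSum p = partialSum p (N + 1) := by
      refine le_antisymm (ciSup_le fun n => ?_) (partialSum_le_seriesSum p _)
      rw [← hconst (max n (N + 1)) (le_max_right _ _)]
      exact partialSum_mono p (le_max_left _ _)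
    refine ⟨sumNum p (N + 1) / (N + 1 + 1).factorial, ?_⟩
    rw [hx, partialSum]
    push_cast
    rfl

/-! ### Names of affine images of a factorial series -/

/-- A code of the rational number `(c₁ - c₃) + (c₂ - c₄) S`, where `S` is the partial sum given
by `v`. -/
def affineCode (c : ℕ × ℕ × ℕ × ℕ) (v : List Bool) : ℕ :=
  Nat.pair (c.1 * (sumState v).2.2 + c.2.1 * (sumState v).2.1)
    (Nat.pair (c.2.2.1 * (sumState v).2.2 + c.2.2.2 * (sumState v).2.1) ((sumState v).2.2 - 1))

/-- The `|v|`-th bit of the name of `(c₁ - c₃) + (c₂ - c₄) x_p`, where `v` is a prefix of `p`. -/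
def affineBit (c : ℕ × ℕ × ℕ × ℕ) (v : List Bool) : Bool :=
  (blockWord ((List.range (v.length + 1)).map fun i => affineCode c (v.take i))).getD
    v.length false

/-- The value `(c₁ - c₃) + (c₂ - c₄) x`. -/
def affineValue (c : ℕ × ℕ × ℕ × ℕ) (x : ℝ) : ℝ :=
  ((c.1 : ℝ) - c.2.2.1) + ((c.2.1 : ℝ) - c.2.2.2) * x

theorem nuQ_affineCode (c : ℕ × ℕ × ℕ × ℕ) (p : Cantor) (n : ℕ) :
    (nuQ (affineCode c (initSeg p n)) : ℝ) = affineValue c (partialSum p n) := by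
  have h1 : (((n + 1).factorial - 1 : ℕ) : ℚ) + 1 = (n + 1).factorial := by
    have := Nat.factorial_pos (n + 1)
    exact_mod_cast (by omega : (n + 1).factorial - 1 + 1 = (n + 1).factorial)
  have h2 : ((n + 1).factorial : ℝ) ≠ 0 := by positivity
  simp only [nuQ, affineCode, Nat.unpair_pair, sumState_den, h1, affineValue, partialSum, sumNum]
  push_cast
  field_simp
  ring

/-- The `i`-th partial sum depends on `i` bits only and has error below `2^{-i}`; a slope of modulus
at most `1` preserves this bound. -/
theorem names_affineBit (c : ℕ × ℕ × ℕ × ℕ) (hc : |(c.2.1 : ℝ) - c.2.2.2| ≤ 1) (p : Cantor) :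
    realRep.names (fun n => affineBit c (initSeg p n)) (affineValue c (seriesSum p)) := by
  refine ⟨fun i => affineCode c (initSeg p i), ?_, fun i => ?_⟩
  · have : (fun n => affineBit c (initSeg p n)) = blockSeq fun i => affineCode c (initSeg p i) := by
      funext n
      rw [blockSeq_eq_getD, affineBit, length_initSeg]
      congr 2
      refine List.map_congr_left fun i hi => ?_
      rw [take_initSeg p (by have := List.mem_range.1 hi; omega)]
    rw [this]
    exact isBlockCode_blockSeq _
  · rw [nuQ_affineCode]
    have h : affineValue c (seriesSum p) - affineValue c (partialSum p i) =
        ((c.2.1 : ℝ) - c.2.2.2) * (seriesSum p - partialSum p i) := by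
      simp only [affineValue]; ring
    rw [h, abs_mul]
    have h1 := abs_seriesSum_sub_lt p i
    have h2 := abs_nonneg (seriesSum p - partialSum p i)
    nlinarith

theorem primrec_sumState : Primrec sumState := by
  have h : Primrec₂ fun (_ : List Bool) (x : (ℕ × ℕ × ℕ) × Bool) => sumStep x.1 x.2 := by
    have e1 : Primrec fun y : List Bool × (ℕ × ℕ × ℕ) × Bool => y.2.1 :=
      Primrec.fst.comp Primrec.snd
    have k : Primrec fun y : List Bool × (ℕ × ℕ × ℕ) × Bool => y.2.1.1 + 2 :=
      Primrec.nat_add.comp (Primrec.fst.comp e1) (Primrec.const 2)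
    exact ((Primrec.succ.comp (Primrec.fst.comp e1)).pair
      ((Primrec.nat_add.comp (Primrec.nat_mul.comp (Primrec.fst.comp (Primrec.snd.comp e1)) k)
        (Primrec.cond (Primrec.snd.comp Primrec.snd) (Primrec.const 1) (Primrec.const 0))).pair
      (Primrec.nat_mul.comp (Primrec.snd.comp (Primrec.snd.comp e1)) k))).to₂
  exact Primrec.list_foldl Primrec.id (Primrec.const (0, 0, 1)) h

theorem primrec_affineCode : Primrec₂ affineCode := by
  have st : Primrec fun y : (ℕ × ℕ × ℕ × ℕ) × List Bool => (sumState y.2).2 :=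
    Primrec.snd.comp (primrec_sumState.comp Primrec.snd)
  have num := Primrec.fst.comp st
  have den := Primrec.snd.comp st
  have c2 : Primrec fun y : (ℕ × ℕ × ℕ × ℕ) × List Bool => y.1.2 :=
    Primrec.snd.comp Primrec.fst
  have c3 := Primrec.snd.comp c2
  exact Primrec₂.natPair.comp
    (Primrec.nat_add.comp (Primrec.nat_mul.comp (Primrec.fst.comp Primrec.fst) den)
      (Primrec.nat_mul.comp (Primrec.fst.comp c2) num))
    (Primrec₂.natPair.comp
      (Primrec.nat_add.comp (Primrec.nat_mul.comp (Primrec.fst.comp c3) den)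
        (Primrec.nat_mul.comp (Primrec.snd.comp c3) num))
      (Primrec.nat_sub.comp den (Primrec.const 1)))

theorem primrec_affineBit : Primrec₂ affineBit := by
  have hl : Primrec fun y : (ℕ × ℕ × ℕ × ℕ) × List Bool => y.2.length :=
    Primrec.list_length.comp Primrec.snd
  have h1 : Primrec₂ fun (y : (ℕ × ℕ × ℕ × ℕ) × List Bool) (i : ℕ) =>
      affineCode y.1 (y.2.take i) :=
    (primrec_affineCode.comp (Primrec.fst.comp Primrec.fst)
      (Primrec.list_take.comp Primrec.snd (Primrec.snd.comp Primrec.fst))).to₂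
  exact (Primrec.list_getD false).comp (primrec_blockWord.comp (Primrec.list_map
    (Primrec.list_range.comp (Primrec.succ.comp hl)) h1)) hl

/-- The name of the sum of the factorial series. -/
def seriesName (p : Cantor) : Cantor := fun n => affineBit (0, 1, 0, 0) (initSeg p n)

theorem causalComputable_seriesName : CausalComputable seriesName :=
  ⟨affineBit (0, 1, 0, 0), (primrec_affineBit.comp (Primrec.const _) Primrec.id).to_comp,
    fun _ _ => rfl⟩

/-- Infinitely many ones correspond to irrationality, hence the negated answer. -/
theorem reducesVia_infinite_rational : ReducesVia seriesName true cantorRep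
    (fun p => {n : ℕ | p n = true}.Infinite) realRep fun x => ∃ q : ℚ, (q : ℝ) = x := by
  classical
  rintro _ p rfl
  refine ⟨seriesSum p, ?_, ?_⟩
  · have := names_affineBit (0, 1, 0, 0) (by simp) p
    rwa [show affineValue (0, 1, 0, 0) (seriesSum p) = seriesSum p by simp [affineValue]] at this
  · rw [Bool.true_xor, ← decide_not, decide_eq_decide]
    exact rational_seriesSum_iff p

end BSSWeihrauch

namespace BSSWeihrauch

open Relation

/-! ### Register machines -/

namespace AlgStructure

section machine

variable {A ι τ : Type} {𝔄 : AlgStructure A ι τ} {P : List (Instr ι τ)}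

theorem Step.det {c c₁ c₂ : Config A} (h₁ : 𝔄.Step P c c₁) (h₂ : 𝔄.Step P c c₂) : c₁ = c₂ := by
  unfold Step at h₁ h₂
  split at h₁ <;> simp_all only
  · obtain ⟨y, hy, rfl⟩ := h₁
    obtain ⟨z, hz, rfl⟩ := h₂
    rw [Part.mem_unique hy hz]
  · rcases h₁ with ⟨h, rfl⟩ | ⟨h, rfl⟩ <;> rcases h₂ with ⟨h', rfl⟩ | ⟨h', rfl⟩ <;>
      first | rfl | contradiction

theorem not_step_of_halt {c c' : Config A} (h : P[c.line]? = some .halt) : ¬ 𝔄.Step P c c' := by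
  simp [Step, h]

theorem halts_iff {u : List A} : 𝔄.Halts P u ↔
    ∃ c, ReflTransGen (𝔄.Step P) (𝔄.init u) c ∧ P[c.line]? = some .halt :=
  ⟨fun ⟨_, c, h1, h2, _⟩ => ⟨c, h1, h2⟩, fun ⟨c, h1, h2⟩ => ⟨_, c, h1, h2, rfl⟩⟩

/-- Steps are deterministic, so a run from `S` can only follow the path to the next configuration in
`S`. Thus a configuration of `S` always lies strictly ahead, and no reachable configuration is
stuck. This proves non-termination without following the individual steps of a loop. -/
theorem exists_step_of_progress {S : Config A → Prop}
    (hS : ∀ c, S c → ∃ c', TransGen (𝔄.Step P) c c' ∧ S c') {c h : Config A} (hc : S c)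
    (hh : ReflTransGen (𝔄.Step P) c h) : ∃ c', 𝔄.Step P h c' := by
  suffices H : ∃ c', S c' ∧ TransGen (𝔄.Step P) h c' by
    obtain ⟨c', -, h'⟩ := H
    obtain ⟨d, hd, -⟩ := TransGen.head'_iff.1 h'
    exact ⟨d, hd⟩
  induction hh with
  | refl => obtain ⟨c', h1, h2⟩ := hS c hc; exact ⟨c', h2, h1⟩
  | tail _ hstep ih =>
    obtain ⟨c', h1, h2⟩ := ih
    obtain ⟨d, hd, hd'⟩ := TransGen.head'_iff.1 h2
    obtain rfl := hd.det hstep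
    obtain ⟨c'', h3, h4⟩ := hS c' h1
    exact ⟨c'', h4, TransGen.trans_right hd' h3⟩

end machine

section operations

variable {ι τ : Type} {𝔄 : AlgStructure ℝ ι τ}

theorem ofFn_reg {k : ℕ} (hk : k = 2) (r : ℕ → ℝ) :
    List.ofFn (fun j : Fin k => r (j + 1)) = [r 1, r 2] := by
  subst hk; simp

theorem relHolds_reg_iff {t : τ} (r : ℕ → ℝ) (h : 𝔄.testArity t = 2) :
    𝔄.rel t (fun j => r (j + 1)) ↔ 𝔄.RelHolds t [r 1, r 2] := by
  rw [← ofFn_reg h r]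
  exact ⟨fun h' => ⟨_, rfl, h'⟩, fun ⟨v, hv, h'⟩ => by rwa [List.ofFn_injective hv]⟩

theorem IsEqTest.rel_iff {t : τ} (h : 𝔄.IsEqTest t) (r : ℕ → ℝ) :
    𝔄.rel t (fun j => r (j + 1)) ↔ r 1 = r 2 := by
  rw [relHolds_reg_iff r h.1, h.2]

theorem IsLtTest.rel_iff {t : τ} (h : 𝔄.IsLtTest t) (r : ℕ → ℝ) :
    𝔄.rel t (fun j => r (j + 1)) ↔ r 1 < r 2 := by
  rw [relHolds_reg_iff r h.1, h.2]

theorem mem_op_add {i : ι} (h : 𝔄.arity i = 2) (hi : ∀ a b, 𝔄.OpValue i [a, b] (a + b))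
    (r : ℕ → ℝ) : r 1 + r 2 ∈ 𝔄.op i fun j => r (j + 1) := by
  obtain ⟨v, hv, hy⟩ := hi (r 1) (r 2)
  rw [← ofFn_reg h r] at hv
  rwa [List.ofFn_injective hv]

end operations

end AlgStructure

/-! ### A program that halts exactly on rational inputs -/

/-- On input `1 - x, 1, -1, -x, 1` with `0 ≤ x < 1`, this program searches for natural numbers
`j ≤ N` with `(N + 1) x = j`. -/
def rationalitySearch {ι τ : Type} (i : ι) (t : τ) : List (Instr ι τ) :=
  [.dec 0, .dec 0, .dec 0, .dec 0,
    -- line 4: test, and add `1` to `R_1`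
    .test t 54, .jumpZero 2 11, .dec 2, .inc 3, .apply i, .copy, .jumpZero 4 4,
    -- line 11: `R_2 := -1`
    .inc 0, .inc 1, .inc 1, .inc 1, .copy, .dec 0, .dec 1, .dec 1, .dec 1,
    -- line 20: undo the additions
    .jumpZero 3 26, .dec 3, .inc 2, .apply i, .copy, .jumpZero 4 20,
    -- line 26: `R_2 := -x`
    .inc 0, .inc 1, .inc 1, .inc 1, .inc 1, .copy, .dec 0, .dec 1, .dec 1, .dec 1, .dec 1,
    -- line 37: next denominator
    .apply i, .copy, .inc 2,
    -- line 40: `R_2 := 1`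
    .inc 0, .inc 1, .inc 1, .inc 1, .inc 1, .inc 1, .copy, .dec 0, .dec 1, .dec 1, .dec 1, .dec 1,
    .dec 1, .jumpZero 4 4, .halt]

/-- The relevant part of a configuration during the search. -/
structure SearchState (x : ℝ) (l a b : ℕ) (r s : ℝ) (c : Config ℝ) : Prop where
  line : c.line = l
  idx0 : c.idx 0 = 1
  idx1 : c.idx 1 = 0
  idx2 : c.idx 2 = a
  idx3 : c.idx 3 = b
  idx4 : c.idx 4 = 0
  reg1 : c.reg 1 = r
  reg2 : c.reg 2 = s
  reg3 : c.reg 3 = -1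
  reg4 : c.reg 4 = -x
  reg5 : c.reg 5 = 1

namespace SearchState

open AlgStructure

variable {ι τ : Type} {𝔄 : AlgStructure ℝ ι τ} {P : List (Instr ι τ)} {i : ι} {t : τ} {x : ℝ}
  {l a b : ℕ} {r s : ℝ} {c : Config ℝ}

theorem step_inc2 (h : SearchState x l a b r s c) (hP : P[l]? = some (.inc 2)) :
    ∃ c', TransGen (𝔄.Step P) c c' ∧ SearchState x (l + 1) (a + 1) b r s c' := by
  obtain ⟨rfl, h0, h1, h2, h3, h4, r1, r2, r3, r4, r5⟩ := h
  refine ⟨⟨c.line + 1, Function.update c.idx 2 (c.idx 2 + 1), c.reg⟩, .single ?_, ?_⟩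
  · simp [Step, hP]
  · constructor <;> simp [Function.update, *]

theorem step_inc3 (h : SearchState x l a b r s c) (hP : P[l]? = some (.inc 3)) :
    ∃ c', TransGen (𝔄.Step P) c c' ∧ SearchState x (l + 1) a (b + 1) r s c' := by
  obtain ⟨rfl, h0, h1, h2, h3, h4, r1, r2, r3, r4, r5⟩ := h
  refine ⟨⟨c.line + 1, Function.update c.idx 3 (c.idx 3 + 1), c.reg⟩, .single ?_, ?_⟩
  · simp [Step, hP]
  · constructor <;> simp [Function.update, *]

theorem step_dec2 (h : SearchState x l (a + 1) b r s c) (hP : P[l]? = some (.dec 2)) :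
    ∃ c', TransGen (𝔄.Step P) c c' ∧ SearchState x (l + 1) a b r s c' := by
  obtain ⟨rfl, h0, h1, h2, h3, h4, r1, r2, r3, r4, r5⟩ := h
  refine ⟨⟨c.line + 1, Function.update c.idx 2 (c.idx 2 - 1), c.reg⟩, .single ?_, ?_⟩
  · simp [Step, hP]
  · constructor <;> simp [Function.update, *]

theorem step_dec3 (h : SearchState x l a (b + 1) r s c) (hP : P[l]? = some (.dec 3)) :
    ∃ c', TransGen (𝔄.Step P) c c' ∧ SearchState x (l + 1) a b r s c' := by
  obtain ⟨rfl, h0, h1, h2, h3, h4, r1, r2, r3, r4, r5⟩ := h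
  refine ⟨⟨c.line + 1, Function.update c.idx 3 (c.idx 3 - 1), c.reg⟩, .single ?_, ?_⟩
  · simp [Step, hP]
  · constructor <;> simp [Function.update, *]

theorem step_jump {n m : ℕ} (h : SearchState x l a b r s c) (hP : P[l]? = some (.jumpZero n m)) :
    ∃ c', TransGen (𝔄.Step P) c c' ∧
      SearchState x (if c.idx n = 0 then m else l + 1) a b r s c' := by
  obtain ⟨rfl, h0, h1, h2, h3, h4, r1, r2, r3, r4, r5⟩ := h
  refine ⟨⟨if c.idx n = 0 then m else c.line + 1, c.idx, c.reg⟩, .single ?_, ?_⟩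
  · simp [Step, hP]
  · constructor <;> simp [*]

/-- `I_4` stays `0` throughout, so `jumpZero 4` acts as an unconditional jump. -/
theorem step_goto {m : ℕ} (h : SearchState x l a b r s c) (hP : P[l]? = some (.jumpZero 4 m)) :
    ∃ c', TransGen (𝔄.Step P) c c' ∧ SearchState x m a b r s c' := by
  have := h.step_jump (𝔄 := 𝔄) hP
  rwa [if_pos h.idx4] at this

theorem step_test (ht : 𝔄.IsEqTest t) {m : ℕ} (h : SearchState x l a b r s c)
    (hP : P[l]? = some (.test t m)) (hne : r ≠ s) :
    ∃ c', TransGen (𝔄.Step P) c c' ∧ SearchState x (l + 1) a b r s c' := by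
  obtain ⟨rfl, h0, h1, h2, h3, h4, r1, r2, r3, r4, r5⟩ := h
  refine ⟨⟨c.line + 1, c.idx, c.reg⟩, .single ?_, ?_⟩
  · simp [Step, hP, ht.rel_iff, r1, r2, hne]
  · constructor <;> simp [*]

/-- With `I_0 = 1` and `I_1 = 0`, `copy` moves the sum from `R_0` back to `R_1`. -/
theorem step_add_copy (hi : 𝔄.arity i = 2) (hadd : ∀ a b, 𝔄.OpValue i [a, b] (a + b))
    (h : SearchState x l a b r s c) (hP : P[l]? = some (.apply i)) (hP' : P[l + 1]? = some .copy) :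
    ∃ c', TransGen (𝔄.Step P) c c' ∧ SearchState x (l + 2) a b (r + s) s c' := by
  obtain ⟨rfl, h0, h1, h2, h3, h4, r1, r2, r3, r4, r5⟩ := h
  refine ⟨⟨c.line + 2, c.idx, Function.update (Function.update c.reg 0 (c.reg 1 + c.reg 2)) 1
    (c.reg 1 + c.reg 2)⟩, .tail (.single (b := ⟨c.line + 1, c.idx,
      Function.update c.reg 0 (c.reg 1 + c.reg 2)⟩) ?_) ?_, ?_⟩
  · simp only [Step, hP]
    exact ⟨_, mem_op_add hi hadd c.reg, rfl⟩
  · simp [Step, hP', h0, h1]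
  · constructor <;> simp [Function.update, *]

theorem incs (n k : ℕ) {l : ℕ} (idx : ℕ → ℕ) (reg : ℕ → ℝ)
    (hP : ∀ j < k, P[l + j]? = some (.inc n)) : ReflTransGen (𝔄.Step P) ⟨l, idx, reg⟩
      ⟨l + k, Function.update idx n (idx n + k), reg⟩ := by
  induction k with
  | zero => simpa using ReflTransGen.refl
  | succ k ih =>
    refine (ih fun j hj => hP j (by omega)).tail ?_
    simp [Step, hP k (by omega), add_assoc]

theorem decs (n k : ℕ) {l : ℕ} (idx : ℕ → ℕ) (reg : ℕ → ℝ)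
    (hP : ∀ j < k, P[l + j]? = some (.dec n)) : ReflTransGen (𝔄.Step P) ⟨l, idx, reg⟩
      ⟨l + k, Function.update idx n (idx n - k), reg⟩ := by
  induction k with
  | zero => simpa using ReflTransGen.refl
  | succ k ih =>
    refine (ih fun j hj => hP j (by omega)).tail ?_
    simp [Step, hP k (by omega), add_assoc, Nat.sub_sub]

/-- Loads `R_k` into `R_2`: `I_0` is raised from `1` to `2` and `I_1` from `0` to `k`, and both are
restored after the copy. -/
theorem load (k : ℕ) (h : SearchState x l a b r s c) (h1 : P[l]? = some (.inc 0))
    (h2 : ∀ j < k, P[l + 1 + j]? = some (.inc 1)) (h3 : P[l + 1 + k]? = some .copy)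
    (h4 : P[l + 1 + k + 1]? = some (.dec 0))
    (h5 : ∀ j < k, P[l + 1 + k + 1 + 1 + j]? = some (.dec 1)) :
    ∃ c', TransGen (𝔄.Step P) c c' ∧
      SearchState x (l + 1 + k + 1 + 1 + k) a b r (c.reg k) c' := by
  obtain ⟨rfl, i0, i1, i2, i3, i4, r1, r2, r3, r4, r5⟩ := h
  let idx1 := Function.update c.idx 0 (c.idx 0 + 1)
  let idx2 := Function.update idx1 1 (idx1 1 + k)
  let reg1 := Function.update c.reg (idx2 0) (c.reg (idx2 1))
  let idx3 := Function.update idx2 0 (idx2 0 - 1)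
  have s1 : 𝔄.Step P c ⟨c.line + 1, idx1, c.reg⟩ := by simp [Step, h1, idx1]
  have s2 := incs (𝔄 := 𝔄) 1 k idx1 c.reg h2
  have s3 : 𝔄.Step P ⟨c.line + 1 + k, idx2, c.reg⟩ ⟨c.line + 1 + k + 1, idx2, reg1⟩ := by
    simp [Step, h3, reg1]
  have s4 : 𝔄.Step P ⟨c.line + 1 + k + 1, idx2, reg1⟩ ⟨c.line + 1 + k + 1 + 1, idx3, reg1⟩ := by
    simp [Step, h4, idx3]
  have s5 := decs (𝔄 := 𝔄) 1 k idx3 reg1 h5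
  refine ⟨_, ((((TransGen.single s1).trans_left s2).tail s3).tail s4).trans_left s5, ?_⟩
  constructor <;> simp [Function.update, idx3, reg1, idx2, idx1, *]

section program

variable (hi : 𝔄.arity i = 2) (hadd : ∀ a b, 𝔄.OpValue i [a, b] (a + b)) (ht : 𝔄.IsEqTest t)

theorem start {u : List ℝ} (hu : u = [1 - x, 1, -1, -x, 1]) : ∃ c,
    ReflTransGen (𝔄.Step (rationalitySearch i t)) (𝔄.init u) c ∧
      SearchState x 4 0 0 (1 - x) 1 c := by
  subst hu
  -- `I_0` starts at the input length `5` and must be brought to `1`.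
  refine ⟨_, decs (l := 0) 0 4 _ _ fun j hj => by interval_cases j <;> rfl, ?_⟩
  constructor <;> simp

include hi hadd in
-- There is no subtraction: the `b` additions of `1` are undone by adding the input `-1`, while the
-- count is moved from `I_3` back to `I_2`.
theorem unwind : ∀ (b a : ℕ) (r : ℝ) (c : Config ℝ), SearchState x 20 a b r (-1) c →
    ∃ c', TransGen (𝔄.Step (rationalitySearch i t)) c c' ∧
      SearchState x 26 (a + b) 0 (r - b) (-1) c' := by
  intro b
  induction b with
  | zero =>
    intro a r c h
    have := h.step_jump (𝔄 := 𝔄) (P := rationalitySearch i t) (n := 3) (m := 26) rfl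
    rw [if_pos h.idx3] at this
    simpa using this
  | succ b ih =>
    intro a r c h
    obtain ⟨c1, t1, h1⟩ := h.step_jump (𝔄 := 𝔄) (P := rationalitySearch i t) (n := 3) (m := 26) rfl
    rw [if_neg (by rw [h.idx3]; omega)] at h1
    obtain ⟨c2, t2, h2⟩ := h1.step_dec3 (𝔄 := 𝔄) (P := rationalitySearch i t) rfl
    obtain ⟨c3, t3, h3⟩ := h2.step_inc2 (𝔄 := 𝔄) (P := rationalitySearch i t) rfl
    obtain ⟨c4, t4, h4⟩ := h3.step_add_copy hi hadd (P := rationalitySearch i t) rfl rfl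
    obtain ⟨c5, t5, h5⟩ := h4.step_goto (𝔄 := 𝔄) (P := rationalitySearch i t) (m := 20) rfl
    obtain ⟨c6, t6, h6⟩ := ih _ _ _ h5
    refine ⟨c6, ((((t1.trans t2).trans t3).trans t4).trans t5).trans t6, ?_⟩
    have e1 : a + (b + 1) = a + 1 + b := by omega
    have e2 : r - (b + 1 : ℕ) = r + -1 - b := by push_cast; ring
    rwa [e1, e2]

include hi hadd ht in
-- The next numerator for the same denominator. `R_2 = 1` is both the value compared with `R_1` and
-- the increment.
theorem inner (h : SearchState x 4 (a + 1) b r 1 c) (hr : r ≠ 1) :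
    ∃ c', TransGen (𝔄.Step (rationalitySearch i t)) c c' ∧
      SearchState x 4 a (b + 1) (r + 1) 1 c' := by
  obtain ⟨c1, t1, h1⟩ := h.step_test ht (P := rationalitySearch i t) (m := 54) rfl hr
  obtain ⟨c2, t2, h2⟩ := h1.step_jump (𝔄 := 𝔄) (P := rationalitySearch i t) (n := 2) (m := 11) rfl
  rw [if_neg (by rw [h1.idx2]; omega)] at h2
  obtain ⟨c3, t3, h3⟩ := h2.step_dec2 (𝔄 := 𝔄) (P := rationalitySearch i t) rfl
  obtain ⟨c4, t4, h4⟩ := h3.step_inc3 (𝔄 := 𝔄) (P := rationalitySearch i t) rfl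
  obtain ⟨c5, t5, h5⟩ := h4.step_add_copy hi hadd (P := rationalitySearch i t) rfl rfl
  obtain ⟨c6, t6, h6⟩ := h5.step_goto (𝔄 := 𝔄) (P := rationalitySearch i t) (m := 4) rfl
  exact ⟨c6, ((((t1.trans t2).trans t3).trans t4).trans t5).trans t6, h6⟩

include hi hadd ht in
-- The numerators for the present denominator are exhausted. Undoing the additions and adding `-x`
-- passes to the next denominator, with the numerator reset to `0`.
theorem outer (h : SearchState x 4 0 b r 1 c) (hr : r ≠ 1) :
    ∃ c', TransGen (𝔄.Step (rationalitySearch i t)) c c' ∧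
      SearchState x 4 (b + 1) 0 (r - b - x) 1 c' := by
  obtain ⟨c1, t1, h1⟩ := h.step_test ht (P := rationalitySearch i t) (m := 54) rfl hr
  obtain ⟨c2, t2, h2⟩ := h1.step_jump (𝔄 := 𝔄) (P := rationalitySearch i t) (n := 2) (m := 11) rfl
  rw [if_pos h1.idx2] at h2
  obtain ⟨c3, t3, h3⟩ := h2.load (𝔄 := 𝔄) (P := rationalitySearch i t) 3 rfl
    (fun j hj => by interval_cases j <;> rfl) rfl rfl (fun j hj => by interval_cases j <;> rfl)
  rw [h2.reg3] at h3
  obtain ⟨c4, t4, h4⟩ := unwind hi hadd (t := t) _ _ _ _ h3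
  obtain ⟨c5, t5, h5⟩ := h4.load (𝔄 := 𝔄) (P := rationalitySearch i t) 4 rfl
    (fun j hj => by interval_cases j <;> rfl) rfl rfl (fun j hj => by interval_cases j <;> rfl)
  rw [h4.reg4] at h5
  obtain ⟨c6, t6, h6⟩ := h5.step_add_copy hi hadd (P := rationalitySearch i t) rfl rfl
  obtain ⟨c7, t7, h7⟩ := h6.step_inc2 (𝔄 := 𝔄) (P := rationalitySearch i t) rfl
  obtain ⟨c8, t8, h8⟩ := h7.load (𝔄 := 𝔄) (P := rationalitySearch i t) 5 rfl
    (fun j hj => by interval_cases j <;> rfl) rfl rfl (fun j hj => by interval_cases j <;> rfl)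
  rw [h7.reg5] at h8
  obtain ⟨c9, t9, h9⟩ := h8.step_goto (𝔄 := 𝔄) (P := rationalitySearch i t) (m := 4) rfl
  refine ⟨c9, (((((((t1.trans t2).trans t3).trans t4).trans t5).trans t6).trans t7).trans t8).trans
    t9, ?_⟩
  rwa [show b + 1 = 0 + b + 1 by omega, show r - b - x = r - b + -x by ring]

include ht in
theorem halt (h : SearchState x 4 a b 1 1 c) : ∃ c',
    ReflTransGen (𝔄.Step (rationalitySearch i t)) c c' ∧
      (rationalitySearch i t)[c'.line]? = some .halt := by
  refine ⟨⟨54, c.idx, c.reg⟩, .single ?_, rfl⟩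
  have hP : (rationalitySearch i t)[c.line]? = some (.test t 54) := by rw [h.line]; rfl
  simp only [Step, hP]
  exact .inl ⟨(ht.rel_iff c.reg).2 (by rw [h.reg1, h.reg2]), by simp⟩

end program

end SearchState

namespace AlgStructure

variable {ι τ : Type} {𝔄 : AlgStructure ℝ ι τ} {i : ι} {t : τ}

/-- At line `4` the register `R_1` holds `1 - (N + 1) x + j`, with `I_2 = N - j` and `I_3 = j`, so
the test against `1` asks whether `x = j / (N + 1)`. As `0 ≤ x < 1`, numerators `j ≤ N` suffice. For
irrational `x` every visit to line `4` leads to another; for rational `x` a run that did not halt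
would visit every pair, including the one that makes it halt. -/
theorem halts_rationalitySearch_iff (hi : 𝔄.arity i = 2)
    (hadd : ∀ a b, 𝔄.OpValue i [a, b] (a + b)) (ht : 𝔄.IsEqTest t) {x : ℝ} (h0 : 0 ≤ x)
    (h1 : x < 1) : 𝔄.Halts (rationalitySearch i t) [1 - x, 1, -1, -x, 1] ↔
      ∃ q : ℚ, (q : ℝ) = x := by
  rw [halts_iff]
  obtain ⟨c₀, hc₀, hs₀⟩ := SearchState.start (𝔄 := 𝔄) (i := i) (t := t) (x := x) rfl
  -- the value of `R_1` after `j` additions for the denominator `N + 1`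
  let val : ℕ → ℕ → ℝ := fun N j => 1 - (N + 1) * x + j
  have hval : ∀ N j, val N j = 1 ↔ (N + 1) * x = j := fun N j => by
    simp only [val]; constructor <;> intro h <;> linarith
  have e1 : ∀ N j, val N j + 1 = val N (j + 1) := fun N j => by simp only [val]; push_cast; ring
  have e2 : ∀ N j, val N j - j - x = val (N + 1) 0 := fun N j => by
    simp only [val]; push_cast; ring
  have e0 : 1 - x = val 0 0 := by simp [val]
  constructor
  · rintro ⟨c, hc, hP⟩
    by_contra hirr
    have hne : ∀ N j, val N j ≠ 1 := by
      intro N j h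
      rw [hval] at h
      refine hirr ⟨j / (N + 1), ?_⟩
      push_cast
      rw [← h]
      field_simp
    have hprog : ∀ c, (∃ a b N, SearchState x 4 a b (val N b) 1 c) →
        ∃ c', TransGen (𝔄.Step (rationalitySearch i t)) c c' ∧
          ∃ a b N, SearchState x 4 a b (val N b) 1 c' := by
      rintro c ⟨a, b, N, h⟩
      cases a with
      | zero =>
        obtain ⟨c', t', h'⟩ := h.outer hi hadd ht (hne N b)
        exact ⟨c', t', _, _, N + 1, by rwa [e2] at h'⟩
      | succ a =>
        obtain ⟨c', t', h'⟩ := h.inner hi hadd ht (hne N b)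
        exact ⟨c', t', _, _, N, by rwa [e1] at h'⟩
    -- the initial configuration leads to the halting configuration through `c₀`
    have hreach : ReflTransGen (𝔄.Step (rationalitySearch i t)) c₀ c := by
      rcases ReflTransGen.total_of_right_unique (fun _ _ _ h h' => h.det h') hc₀ hc with h | h
      · exact h
      · rcases ReflTransGen.cases_head h with rfl | ⟨d, hd, -⟩
        · exact .refl
        · exact absurd hd (not_step_of_halt hP)
    obtain ⟨d, hd⟩ := exists_step_of_progress hprog ⟨0, 0, 0, e0 ▸ hs₀⟩ hreach
    exact not_step_of_halt hP hd
  · rintro ⟨q, hq⟩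
    by_contra hno
    have hlast : ∀ a b N c, ReflTransGen (𝔄.Step (rationalitySearch i t)) (𝔄.init
        [1 - x, 1, -1, -x, 1]) c → SearchState x 4 a b (val N b) 1 c → val N b ≠ 1 := by
      intro a b N c hc hs h
      rw [h] at hs
      obtain ⟨c', t', h'⟩ := hs.halt (𝔄 := 𝔄) (i := i) ht
      exact hno ⟨c', hc.trans t', h'⟩
    have hinner : ∀ N, (∃ c, ReflTransGen (𝔄.Step (rationalitySearch i t)) (𝔄.init
        [1 - x, 1, -1, -x, 1]) c ∧ SearchState x 4 N 0 (val N 0) 1 c) → ∀ b a, a + b = N →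
        ∃ c, ReflTransGen (𝔄.Step (rationalitySearch i t)) (𝔄.init
          [1 - x, 1, -1, -x, 1]) c ∧ SearchState x 4 a b (val N b) 1 c := by
      intro N hN b
      induction b with
      | zero => rintro a rfl; exact hN
      | succ b ih =>
        intro a ha
        obtain ⟨c, hc, hs⟩ := ih (a + 1) (by omega)
        obtain ⟨c', t', h'⟩ := hs.inner hi hadd ht (hlast _ _ _ _ hc hs)
        exact ⟨c', hc.trans t'.to_reflTransGen, by rwa [e1] at h'⟩
    have houter : ∀ N, ∃ c, ReflTransGen (𝔄.Step (rationalitySearch i t)) (𝔄.init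
        [1 - x, 1, -1, -x, 1]) c ∧ SearchState x 4 N 0 (val N 0) 1 c := by
      intro N
      induction N with
      | zero => exact ⟨c₀, hc₀, e0 ▸ hs₀⟩
      | succ N ih =>
        obtain ⟨c, hc, hs⟩ := hinner N ih N 0 (by omega)
        obtain ⟨c', t', h'⟩ := hs.outer hi hadd ht (hlast _ _ _ _ hc hs)
        exact ⟨c', hc.trans t'.to_reflTransGen, by rwa [e2] at h'⟩
    have hq0 : 0 ≤ q := by rw [← hq] at h0; exact_mod_cast h0
    have hq1 : q < 1 := by rw [← hq] at h1; exact_mod_cast h1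
    have hlt : q.num.toNat < q.den := by
      have := Rat.num_lt_denom_iff.2 hq1
      have := q.den_pos
      omega
    obtain ⟨N, hN⟩ : ∃ N, q.den = N + 1 := ⟨q.den - 1, by have := q.den_pos; omega⟩
    -- The pair given by `q` in lowest terms: denominator `N + 1` and numerator at most `N`.
    obtain ⟨c, hc, hs⟩ := hinner N (houter N) q.num.toNat (N - q.num.toNat) (by omega)
    refine hlast _ _ _ _ hc hs ((hval _ _).2 ?_)
    have h2 : (q.num.toNat : ℚ) = q.num := by
      have := Rat.num_nonneg.2 hq0
      exact_mod_cast Int.toNat_of_nonneg this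
    have h3 : ((N : ℚ) + 1) * q = q.num.toNat := by
      rw [h2, ← Rat.mul_den_eq_num q, hN]; push_cast; ring
    rw [← hq]
    exact_mod_cast h3

end AlgStructure

/-! ### `isInfinite` is reducible to the halting problem -/

/-- The affine functions of `x` that make up the input `1 - x, 1, -1, -x, 1`. -/
def searchCoeffs : List (ℕ × ℕ × ℕ × ℕ) :=
  [(1, 0, 0, 1), (1, 0, 0, 0), (0, 0, 1, 0), (0, 0, 0, 1), (1, 0, 0, 0)]

/-- The input of the program `rationalitySearch`. -/
def searchInput (x : ℝ) : List ℝ := searchCoeffs.map fun c => affineValue c x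

theorem searchInput_eq (x : ℝ) : searchInput x = [1 - x, 1, -1, -x, 1] := by
  simp [searchInput, searchCoeffs, affineValue, sub_eq_add_neg]

/-- The `|v|`-th bit of the name of `(g, searchInput x_p)`, where `v` is a prefix of `p`. -/
def searchBit (g : ℕ) (v : List Bool) : Bool :=
  bif v.length % 2 == 0 then decide (g ≤ v.length / 2)
  else bif v.length / 2 % 2 == 0 then decide (5 ≤ v.length / 2 / 2)
  else affineBit (searchCoeffs.getD (v.length / 2 / 2).unpair.1 (0, 0, 0, 0))
    (v.take (v.length / 2 / 2).unpair.2)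

/-- The name of `(g, searchInput x_p)`. -/
def searchName (g : ℕ) (p : Cantor) : Cantor := fun n => searchBit g (initSeg p n)

theorem causalComputable_searchName (g : ℕ) : CausalComputable (searchName g) := by
  refine ⟨searchBit g, Primrec.to_comp ?_, fun _ _ => rfl⟩
  have two : Primrec fun _ : List Bool => 2 := Primrec.const 2
  have h0 : Primrec fun v : List Bool => v.length := Primrec.list_length
  have h1 : Primrec fun v : List Bool => v.length / 2 := Primrec.nat_div.comp h0 two
  have h2 : Primrec fun v : List Bool => v.length / 2 / 2 := Primrec.nat_div.comp h1 two
  have z : Primrec fun _ : List Bool => 0 := Primrec.const 0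
  exact Primrec.cond (Primrec.beq.comp (Primrec.nat_mod.comp h0 two) z)
    (Primrec.nat_le.decide.comp (Primrec.const g) h1)
    (Primrec.cond (Primrec.beq.comp (Primrec.nat_mod.comp h1 two) z)
      (Primrec.nat_le.decide.comp (Primrec.const 5) h2)
      (primrec_affineBit.comp ((Primrec.list_getD _).comp (Primrec.const searchCoeffs)
        (Primrec.fst.comp (Primrec.unpair.comp h2)))
        (Primrec.list_take.comp (Primrec.snd.comp (Primrec.unpair.comp h2)) Primrec.id)))

theorem names_searchName (g : ℕ) (p : Cantor) : (prodRep natRep (listRep realRep)).names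
    (searchName g p) (g, searchInput (seriesSum p)) := by
  refine ⟨fun k => ?_, fun k => ?_, fun i hi => ?_⟩
  · have h1 : 2 * k % 2 = 0 := by omega
    have h2 : 2 * k / 2 = k := by omega
    simp [evenPart, searchName, searchBit, h1, h2]
  · have h1 : (2 * (2 * k) + 1) % 2 = 1 := by omega
    have h2 : (2 * (2 * k) + 1) / 2 = 2 * k := by omega
    have h3 : 2 * k % 2 = 0 := by omega
    have h4 : 2 * k / 2 = k := by omega
    simp [evenPart, oddPart, searchName, searchBit, h1, h2, h3, h4, searchInput, searchCoeffs]
  · have hi' : i < searchCoeffs.length := by simpa [searchInput] using hi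
    have hsc : |((searchCoeffs[i].2.1 : ℕ) : ℝ) - searchCoeffs[i].2.2.2| ≤ 1 := by
      have : i < 5 := hi'
      interval_cases i <;> norm_num [searchCoeffs]
    have := names_affineBit searchCoeffs[i] hsc p
    have hval : (searchInput (seriesSum p))[i] = affineValue searchCoeffs[i] (seriesSum p) := by
      simp [searchInput]
    show realRep.names _ ((searchInput (seriesSum p))[i])
    rw [hval]
    convert this using 1
    funext k
    have h1 : (2 * (2 * Nat.pair i k + 1) + 1) % 2 = 1 := by omega
    have h2 : (2 * (2 * Nat.pair i k + 1) + 1) / 2 = 2 * Nat.pair i k + 1 := by omega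
    have h3 : (2 * Nat.pair i k + 1) % 2 = 1 := by omega
    have h4 : (2 * Nat.pair i k + 1) / 2 = Nat.pair i k := by omega
    -- Bit `k` of an entry is placed at a position not before `k`, so enough of `p` has been read to
    -- compute it.
    have h5 : k ≤ 2 * (2 * Nat.pair i k + 1) + 1 := by
      have := Nat.right_le_pair i k
      omega
    simp only [oddPart, searchName, searchBit, length_initSeg, h1, h2, h3, h4, Nat.unpair_pair,
      take_initSeg p h5, List.getD_eq_getElem?_getD, List.getElem?_eq_getElem hi']
    rfl

/-- One fixed program suffices; `p` enters only through the real inputs. This number `g` also serves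
both undecidability results. -/
theorem AlgStructure.exists_reducesVia_halting {ι τ : Type} [Primcodable ι] [Primcodable τ]
    (𝔄 : AlgStructure ℝ ι τ) (hadd : 𝔄.HasAdd) (heq : 𝔄.HasEq) :
    ∃ g : ℕ, ∀ p, 𝔄.HaltingProblem g (searchInput (seriesSum p)) ↔
      ¬ {n : ℕ | p n = true}.Infinite := by
  obtain ⟨i, hi, hadd⟩ := hadd
  obtain ⟨t, ht⟩ := heq
  refine ⟨Encodable.encode (rationalitySearch i t), fun p => ?_⟩
  rw [← rational_seriesSum_iff, ← halts_rationalitySearch_iff hi hadd ht (seriesSum_nonneg p)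
    (seriesSum_lt_one p), ← searchInput_eq]
  simp [HaltingProblem, Encodable.encodek]

theorem AlgStructure.reducesVia_infinite_halting {ι τ : Type} [Primcodable ι] [Primcodable τ]
    {𝔄 : AlgStructure ℝ ι τ} {g : ℕ} (hg : ∀ p, 𝔄.HaltingProblem g (searchInput (seriesSum p)) ↔
      ¬ {n : ℕ | p n = true}.Infinite) :
    ReducesVia (searchName g) true cantorRep (fun p => {n : ℕ | p n = true}.Infinite)
      (prodRep natRep (listRep realRep)) fun a => 𝔄.HaltingProblem a.1 a.2 := by
  classical
  rintro _ p rfl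
  refine ⟨_, names_searchName g p, ?_⟩
  rw [Bool.true_xor, ← decide_not, decide_eq_decide]
  exact hg p

end BSSWeihrauch

namespace BSSWeihrauch

open Filter Topology Relation

/-! ### Topology of Cantor space -/

theorem eventually_initSeg_eq (p : Cantor) (n : ℕ) : ∀ᶠ q in 𝓝 p, initSeg q n = initSeg p n := by
  have h : ∀ᶠ q : Cantor in 𝓝 p, ∀ k ∈ Set.Iio n, q k = p k :=
    (Filter.eventually_all_finite (Set.finite_Iio n)).2 fun k _ =>
      (continuous_apply k).continuousAt.eventually (eventually_of_mem
        ((isOpen_discrete {p k}).mem_nhds rfl) fun _ h => h)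
  filter_upwards [h] with q hq
  exact initSeg_eq_iff.2 hq

theorem exists_cylinder_subset {U : Set Cantor} (hU : IsOpen U) {p : Cantor} (hp : p ∈ U) :
    ∃ n, ∀ q, initSeg q n = initSeg p n → q ∈ U := by
  by_contra h
  push Not at h
  choose q hq hqU using h
  have hlim : Tendsto q atTop (𝓝 p) := by
    rw [tendsto_pi_nhds]
    intro k
    refine tendsto_const_nhds.congr' ?_
    filter_upwards [eventually_gt_atTop k] with n hn
    exact (initSeg_eq_iff.1 (hq n) k hn).symm
  obtain ⟨n, hn⟩ := (hlim.eventually (hU.mem_nhds hp)).exists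
  exact hqU n hn

/-- A cylinder fixes finitely many bits and leaves the tail free; for `c = true` and `c = false`
this shows that both classes of sequences are dense. -/
theorem exists_mem_eventually_eq {U : Set Cantor} (hU : IsOpen U) (hne : U.Nonempty) (c : Bool) :
    ∃ p ∈ U, ∃ N, ∀ k, N ≤ k → p k = c := by
  obtain ⟨p, hp⟩ := hne
  obtain ⟨n, hn⟩ := exists_cylinder_subset hU hp
  refine ⟨fun k => if k < n then p k else c, hn _ (initSeg_eq_iff.2 fun k hk => by simp [hk]), n,
    fun k hk => by simp [Nat.not_lt.2 hk]⟩

open Classical in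
/-- The set of sequences with infinitely many ones has no continuous characteristic function on
any non-empty open set. -/
theorem not_continuousOn_isInfinite {Y : Type*} [TopologicalSpace Y] [T1Space Y]
    {U : Set Cantor} (hU : IsOpen U) (hne : U.Nonempty) {k : Cantor → Y} (hk : ContinuousOn k U)
    {a b : Y} (hab : a ≠ b)
    (h : ∀ p ∈ U, k p = if {n : ℕ | p n = true}.Infinite then a else b) : False := by
  obtain ⟨p, hp, N, hN⟩ := exists_mem_eventually_eq hU hne true
  have hinf : {n : ℕ | p n = true}.Infinite :=
    (Set.Ici_infinite N).mono fun k hk => hN k hk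
  -- Near a point with value `a` the value `b` is avoided, yet an eventually zero sequence lies
  -- there.
  have hV := hk.isOpen_inter_preimage hU (isOpen_compl_singleton (x := b))
  obtain ⟨q, hq, M, hM⟩ := exists_mem_eventually_eq hV
    ⟨p, hp, by rw [Set.mem_preimage, h p hp, if_pos hinf]; exact hab⟩ false
  have hfin : ¬ {n : ℕ | q n = true}.Infinite := by
    rw [Set.not_infinite]
    refine (Set.finite_Iio M).subset fun k hk => ?_
    by_contra hkM
    have := hM k (by simpa using hkM)
    have hk' : q k = true := hk
    rw [this] at hk'
    exact absurd hk' (by simp)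
  exact hq.2 (by rw [h q hq.1, if_neg hfin]; rfl)

theorem isOpen_hasBlock (n : ℕ) : IsOpen {q : Cantor | HasBlock q n} := by
  have h (m : ℕ) (c : Bool) : IsOpen {q : Cantor | q m = c} :=
    (isOpen_discrete ({c} : Set Bool)).preimage (continuous_apply (A := fun _ : ℕ => Bool) m)
  have : {q : Cantor | HasBlock q n} = ⋃ k, ({q : Cantor | q k = false} ∩
      ((⋂ j ∈ Set.Iic n, {q : Cantor | q (k + 1 + j) = true}) ∩
        {q : Cantor | q (k + n + 2) = false})) := by
    ext q; simp [HasBlock]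
  rw [this]
  exact isOpen_iUnion fun k => (h _ _).inter
    (((Set.finite_Iic n).isOpen_biInter fun j _ => h _ _).inter (h _ _))

theorem continuous_pairing_left (r : Cantor) : Continuous fun p => pairing p r := by
  refine continuous_pi fun n => ?_
  by_cases h : n % 2 = 0 <;> simp only [pairing, h, if_true, if_false]
  · exact continuous_apply _
  · exact continuous_const

/-! ### Undecidability for topological reasons -/

/-- For each `N` the inputs for which `N` is a correct answer to the question asked form a closed
set, and these sets cover Cantor space. By Baire one of them has interior points; there a realizer
may answer `N` constantly, so the post-processor alone would decide `isInfinite` continuously. -/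
theorem ReducesVia.not_contWeihrauchLE_closedChoiceNat {Y : Type} {δY : Representation Y}
    {B : Y → Prop} {f : Cantor → Cantor} {b : Bool} (hf : Continuous f)
    (h : ReducesVia f b cantorRep (fun p => {n : ℕ | p n = true}.Infinite) δY B) :
    ¬ ContWeihrauchLE (charProblem δY B) closedChoiceNat := by
  classical
  rintro ⟨K, H, hK, hH, hKH⟩
  choose name hname using natRep.surj
  -- a realizer that prefers the answer `N`
  let G : ℕ → Cantor →. Cantor := fun N q =>
    if ¬ HasBlock q N then Part.some (name N)
    else ⟨∃ n, ¬ HasBlock q n, fun hn => name hn.choose⟩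
  have hG : ∀ N, Realizes closedNatRep natRep (G N) closedChoiceNat.map := by
    rintro N q A hA ⟨n, hn⟩
    by_cases hN : ¬ HasBlock q N
    · exact ⟨name N, by simp [G, hN], N, (hA N).2 hN, hname N⟩
    · have hn' : ∃ n, ¬ HasBlock q n := ⟨n, (hA n).1 hn⟩
      refine ⟨name hn'.choose, ?_, hn'.choose, (hA _).2 hn'.choose_spec, hname _⟩
      simp only [G, if_neg hN]
      exact ⟨hn', rfl⟩
  have key : ∀ N p, ∃ q, q ∈ sandwich K (G N) H (f p) ∧
      q 0 = xor b (decide {n : ℕ | p n = true}.Infinite) := by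
    intro N p
    obtain ⟨y, hy, hBy⟩ := h p p rfl
    obtain ⟨q, hq, c, hc, hqc⟩ := hKH (G N) (hG N) _ y hy (Set.singleton_nonempty _)
    refine ⟨q, hq, ?_⟩
    rw [← hBy]
    have hq0 : q 0 = c := hqc
    rw [hq0]
    exact Set.mem_singleton_iff.1 hc
  have hdom : ∀ p, (H (f p)).Dom := fun p => by
    obtain ⟨q, hq, -⟩ := key 0 p
    obtain ⟨r, hr, -⟩ := Part.mem_bind_iff.1 hq
    exact hr.1
  let D : Cantor → Cantor := fun p => H.fn (f p) (hdom p)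
  have hDmem : ∀ p, D p ∈ H (f p) := fun p => ⟨hdom p, rfl⟩
  have hD : Continuous D :=
    Continuous.comp (g := fun x : H.Dom => H.fn x.1 x.2) hH (hf.subtype_mk hdom)
  have hclosed : ∀ N, IsClosed {p | ¬ HasBlock (D p) N} := fun N =>
    ((isOpen_hasBlock N).preimage hD).isClosed_compl
  have hcover : ⋃ N, {p | ¬ HasBlock (D p) N} = Set.univ := by
    -- The composite with `G 0` is defined at `f p`, so `G 0` is defined at the question `D p`,
    -- which means that some answer is admissible.
    refine Set.eq_univ_of_forall fun p => Set.mem_iUnion.2 ?_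
    obtain ⟨q, hq, -⟩ := key 0 p
    obtain ⟨r, hr, hq⟩ := Part.mem_bind_iff.1 hq
    obtain ⟨s, hs, -⟩ := Part.mem_bind_iff.1 hq
    obtain rfl := Part.mem_unique hr (hDmem p)
    by_cases h0 : ¬ HasBlock (D p) 0
    · exact ⟨0, h0⟩
    · simp only [G, if_neg h0] at hs
      exact hs.1
  obtain ⟨N, hN⟩ := nonempty_interior_of_iUnion_of_closed hclosed hcover
  set U := interior {p | ¬ HasBlock (D p) N} with hUdef
  have hval : ∀ p ∈ U, ∃ q, q ∈ K (pairing (f p) (name N)) ∧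
      q 0 = xor b (decide {n : ℕ | p n = true}.Infinite) := by
    intro p hp
    have hp' : ¬ HasBlock (D p) N := interior_subset hp
    obtain ⟨q, hq, hq0⟩ := key N p
    obtain ⟨r, hr, hq⟩ := Part.mem_bind_iff.1 hq
    obtain rfl := Part.mem_unique hr (hDmem p)
    obtain ⟨s, hs, hq⟩ := Part.mem_bind_iff.1 hq
    simp only [G, if_pos hp', Part.mem_some_iff] at hs
    subst hs
    exact ⟨q, hq, hq0⟩
  have hKdom : ∀ p ∈ U, (K (pairing (f p) (name N))).Dom := fun p hp => by
    obtain ⟨q, hq, -⟩ := hval p hp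
    exact hq.1
  let k : Cantor → Bool := fun p =>
    if hp : p ∈ U then K.fn (pairing (f p) (name N)) (hKdom p hp) 0 else false
  have hk : ContinuousOn k U := by
    rw [continuousOn_iff_continuous_domRestrict]
    have h1 : Continuous fun p : U => K.fn (pairing (f p) (name N)) (hKdom p p.2) :=
      Continuous.comp (g := fun x : K.Dom => K.fn x.1 x.2) hK
        (((continuous_pairing_left (name N)).comp (hf.comp continuous_subtype_val)).subtype_mk
          fun p => hKdom p p.2)
    refine ((continuous_apply 0).comp h1).congr fun p => ?_
    simp [k]
  refine not_continuousOn_isInfinite isOpen_interior hN hk (a := xor b true) (b := xor b false)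
    (by simp) fun p hp => ?_
  obtain ⟨q, hq, hq0⟩ := hval p hp
  have h1 : K.fn (pairing (f p) (name N)) (hKdom p hp) = q := Part.mem_unique ⟨_, rfl⟩ hq
  have hp' : p ∈ U := hp
  simp only [k, dif_pos hp', h1, hq0]
  split_ifs with h2 <;> simp [h2]

/-- Sequences with a common prefix of length `n` share the `n`-th partial sum, from which both sums
differ by less than `2^{-n}`. -/
theorem continuous_seriesSum : Continuous seriesSum := by
  rw [Metric.continuous_iff']
  intro p ε hε
  obtain ⟨n, hn⟩ := exists_two_pow_lt (half_pos hε)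
  filter_upwards [eventually_initSeg_eq p n] with q hq
  have h1 := abs_lt.1 (abs_seriesSum_sub_lt p n)
  have h2 := abs_lt.1 (abs_seriesSum_sub_lt q n)
  have h3 : partialSum q n = partialSum p n := by simp only [partialSum, sumNum, hq]
  rw [h3] at h2
  rw [Real.dist_eq, abs_lt]
  constructor <;> linarith

namespace AlgStructure

/-! ### Runs as iterates of a total successor map -/

section run

variable {A ι τ : Type} {𝔄 : AlgStructure A ι τ} {P : List (Instr ι τ)}

open Classical in
/-- The successor configuration; configurations without successor are repeated. -/
noncomputable def next (𝔄 : AlgStructure A ι τ) (P : List (Instr ι τ)) (c : Config A) : Config A :=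
  if h : ∃ c', 𝔄.Step P c c' then h.choose else c

theorem next_eq {c c' : Config A} (h : 𝔄.Step P c c') : 𝔄.next P c = c' := by
  have h' : ∃ c', 𝔄.Step P c c' := ⟨c', h⟩
  rw [next, dif_pos h']
  exact h'.choose_spec.det h

theorem next_eq_self {c : Config A} (h : ¬ ∃ c', 𝔄.Step P c c') : 𝔄.next P c = c := by
  rw [next, dif_neg h]

theorem exists_iterate_next {c c' : Config A} (h : ReflTransGen (𝔄.Step P) c c') :
    ∃ n, (𝔄.next P)^[n] c = c' := by
  induction h with
  | refl => exact ⟨0, rfl⟩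
  | tail _ hs ih =>
    obtain ⟨n, rfl⟩ := ih
    exact ⟨n + 1, by rw [Function.iterate_succ_apply', next_eq hs]⟩

theorem iterate_next_of_stuck {c : Config A} {m n : ℕ}
    (h : ¬ ∃ c', 𝔄.Step P ((𝔄.next P)^[m] c) c') (hmn : m ≤ n) :
    (𝔄.next P)^[n] c = (𝔄.next P)^[m] c := by
  induction n, hmn using Nat.le_induction with
  | base => rfl
  | succ n _ ih => rw [Function.iterate_succ_apply', ih, next_eq_self h]

end run

variable {ι τ : Type} {𝔅 : AlgStructure ℝ ι τ} {P : List (Instr ι τ)}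

/-- On the set `U` of parameters, the configurations `c q` have the same line and the same index
registers, and their real registers depend continuously on the parameter. -/
def UniformOn (c : Cantor → Config ℝ) (U : Set Cantor) : Prop :=
  ∃ (l : ℕ) (I : ℕ → ℕ), (∀ q ∈ U, (c q).line = l ∧ (c q).idx = I) ∧
    ∀ j, ContinuousOn (fun q => (c q).reg j) U

theorem UniformOn.mono {c : Cantor → Config ℝ} {U V : Set Cantor} (h : UniformOn c U)
    (hVU : V ⊆ U) : UniformOn c V := by
  obtain ⟨l, I, h1, h2⟩ := h
  exact ⟨l, I, fun q hq => h1 q (hVU hq), fun j => (h2 j).mono hVU⟩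

theorem UniformOn.of_step {c : Cantor → Config ℝ} {V : Set Cantor} {l : ℕ} {I : ℕ → ℕ}
    {r : Cantor → ℕ → ℝ} (hs : ∀ q ∈ V, 𝔅.Step P (c q) ⟨l, I, r q⟩)
    (hr : ∀ j, ContinuousOn (fun q => r q j) V) : UniformOn (fun q => 𝔅.next P (c q)) V := by
  refine ⟨l, I, fun q hq => by simp [next_eq (hs q hq)], fun j => (hr j).congr fun q hq => ?_⟩
  simp [next_eq (hs q hq)]

theorem continuousOn_update {r : Cantor → ℕ → ℝ} {y : Cantor → ℝ} {V : Set Cantor}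
    (hr : ∀ j, ContinuousOn (fun q => r q j) V) (hy : ContinuousOn y V) (m j : ℕ) :
    ContinuousOn (fun q => Function.update (r q) m (y q) j) V := by
  by_cases h : j = m
  · subst h; simpa using hy
  · simpa [Function.update_of_ne h] using hr j

/-- Both tests are governed by an open relation, `≠` or `<`. Either it holds at a point of `U`, and
then on a neighbourhood, or it fails on all of `U`. -/
theorem exists_open_rel_const (hT : 𝔅.TestsEqOrLt) (t : τ) {r : Cantor → ℕ → ℝ} {U : Set Cantor}
    (hU : IsOpen U) (hne : U.Nonempty) (hr : ∀ j, ContinuousOn (fun q => r q j) U) :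
    ∃ V ⊆ U, IsOpen V ∧ V.Nonempty ∧ ((∀ q ∈ V, 𝔅.rel t fun j => r q (j + 1)) ∨
      ∀ q ∈ V, ¬ 𝔅.rel t fun j => r q (j + 1)) := by
  have aux : ∀ (R : ℝ × ℝ → Prop), IsOpen {z | R z} →
      ∃ V ⊆ U, IsOpen V ∧ V.Nonempty ∧ ((∀ q ∈ V, R (r q 1, r q 2)) ∨
        ∀ q ∈ V, ¬ R (r q 1, r q 2)) := by
    intro R hR
    by_cases hex : ∃ q ∈ U, R (r q 1, r q 2)
    · obtain ⟨q, hq, hRq⟩ := hex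
      exact ⟨U ∩ (fun q => (r q 1, r q 2)) ⁻¹' {z | R z}, Set.inter_subset_left,
        ((hr 1).prodMk (hr 2)).isOpen_inter_preimage hU hR, ⟨q, hq, hRq⟩, .inl fun q hq => hq.2⟩
    · push Not at hex
      exact ⟨U, subset_rfl, hU, hne, .inr hex⟩
  rcases hT t with ht | ht
  · obtain ⟨V, h1, h2, h3, h4⟩ := aux (fun z => z.1 ≠ z.2)
      (isOpen_ne_fun continuous_fst continuous_snd)
    refine ⟨V, h1, h2, h3, ?_⟩
    simp only [ht.rel_iff]
    rcases h4 with h4 | h4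
    · exact .inr h4
    · exact .inl fun q hq => not_not.1 (h4 q hq)
  · obtain ⟨V, h1, h2, h3, h4⟩ := aux (fun z => z.1 < z.2)
      (isOpen_lt continuous_fst continuous_snd)
    refine ⟨V, h1, h2, h3, ?_⟩
    simpa only [ht.rel_iff] using h4

/-- Only a test can split the parameters, and then a smaller open set is chosen. An operation needs
no shrinking: since no run is stuck, its arguments lie in its domain for all parameters in `U`, so
continuity on the domain is enough. -/
theorem UniformOn.exists_next (hT : 𝔅.TestsEqOrLt) (hO : 𝔅.OpsContinuous) {c : Cantor → Config ℝ}
    {U : Set Cantor} (h : UniformOn c U) (hU : IsOpen U) (hne : U.Nonempty)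
    (hstuck : ∀ q, P[(c q).line]? = some .halt ∨ ∃ c', 𝔅.Step P (c q) c') :
    ∃ V ⊆ U, IsOpen V ∧ V.Nonempty ∧ UniformOn (fun q => 𝔅.next P (c q)) V := by
  obtain ⟨l, I, hlI, hreg⟩ := h
  have hc : ∀ q ∈ U, c q = ⟨l, I, (c q).reg⟩ := fun q hq => by
    rw [← (hlI q hq).1, ← (hlI q hq).2]
  have hline : ∀ q ∈ U, (c q).line = l := fun q hq => (hlI q hq).1
  have hidx : ∀ q ∈ U, (c q).idx = I := fun q hq => (hlI q hq).2
  cases hP : P[l]? with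
  | none =>
    exfalso
    obtain ⟨q, hq⟩ := hne
    have := hstuck q
    simp [Step, hline q hq, hP] at this
  | some ins =>
    cases ins with
    | halt =>
      refine ⟨U, subset_rfl, hU, hne, l, I, fun q hq => ?_, fun j => (hreg j).congr fun q hq => ?_⟩ <;>
      · have : ¬ ∃ c', 𝔅.Step P (c q) c' := fun ⟨c', h'⟩ =>
          not_step_of_halt (by rw [hline q hq]; exact hP) h'
        simp [next_eq_self this, hlI q hq]
    | inc n =>
      refine ⟨U, subset_rfl, hU, hne, .of_step (l := l + 1)
        (I := Function.update I n (I n + 1)) (r := fun q => (c q).reg) (fun q hq => ?_) hreg⟩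
      simp [Step, hline q hq, hidx q hq, hP]
    | dec n =>
      refine ⟨U, subset_rfl, hU, hne, .of_step (l := l + 1)
        (I := Function.update I n (I n - 1)) (r := fun q => (c q).reg) (fun q hq => ?_) hreg⟩
      simp [Step, hline q hq, hidx q hq, hP]
    | jumpZero n m =>
      refine ⟨U, subset_rfl, hU, hne, .of_step (l := if I n = 0 then m else l + 1)
        (I := I) (r := fun q => (c q).reg) (fun q hq => ?_) hreg⟩
      simp [Step, hline q hq, hidx q hq, hP]
    | copy =>
      refine ⟨U, subset_rfl, hU, hne, .of_step (l := l + 1) (I := I)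
        (r := fun q => Function.update (c q).reg (I 0) ((c q).reg (I 1))) (fun q hq => ?_)
        (continuousOn_update hreg (hreg _) _)⟩
      simp [Step, hline q hq, hidx q hq, hP]
    | apply i =>
      have hdom : ∀ q ∈ U, (𝔅.op i fun j => (c q).reg (j + 1)).Dom := by
        intro q hq
        rcases hstuck q with h' | ⟨c', h'⟩
        · rw [hline q hq, hP] at h'; cases h'
        · simp only [Step, hline q hq, hP] at h'
          obtain ⟨y, hy, -⟩ := h'
          exact hy.1
      classical
      let y : Cantor → ℝ := fun q =>
        if hq : q ∈ U then (𝔅.op i).fn (fun j => (c q).reg (j + 1)) (hdom q hq) else 0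
      have hy : ContinuousOn y U := by
        rw [continuousOn_iff_continuous_domRestrict]
        have harg : Continuous fun (q : U) (j : Fin (𝔅.arity i)) => (c q).reg (j + 1) :=
          continuous_pi fun j => continuousOn_iff_continuous_domRestrict.1 (hreg _)
        have h1 : Continuous fun q : U =>
            (𝔅.op i).fn (fun j => (c q).reg (j + 1)) (hdom q q.2) :=
          Continuous.comp (g := fun x : (𝔅.op i).Dom => (𝔅.op i).fn x.1 x.2) (hO i)
            (harg.subtype_mk fun q => hdom q q.2)
        refine h1.congr fun q => ?_
        simp [y]
      refine ⟨U, subset_rfl, hU, hne, .of_step (l := l + 1) (I := I)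
        (r := fun q => Function.update (c q).reg 0 (y q)) (fun q hq => ?_)
        (continuousOn_update hreg hy _)⟩
      simp only [Step, hline q hq, hidx q hq, hP]
      refine ⟨y q, ?_, rfl⟩
      simp only [y, dif_pos hq]
      exact ⟨hdom q hq, rfl⟩
    | test t m =>
      obtain ⟨V, hVU, hV, hVne, hrel | hrel⟩ := exists_open_rel_const hT t hU hne hreg
      · refine ⟨V, hVU, hV, hVne, .of_step (l := m) (I := I) (r := fun q => (c q).reg)
          (fun q hq => ?_) fun j => (hreg j).mono hVU⟩
        simp only [Step, hline q (hVU hq), hidx q (hVU hq), hP]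
        exact .inl ⟨hrel q hq, by simp⟩
      · refine ⟨V, hVU, hV, hVne, .of_step (l := l + 1) (I := I) (r := fun q => (c q).reg)
          (fun q hq => ?_) fun j => (hreg j).mono hVU⟩
        simp only [Step, hline q (hVU hq), hidx q (hVU hq), hP]
        exact .inr ⟨hrel q hq, by simp⟩

theorem uniformOn_init (g : ℝ) :
    UniformOn (fun p => 𝔅.init (g :: searchInput (seriesSum p))) Set.univ := by
  -- `6` counts the program number and the five reals.
  refine ⟨0, fun n => if n = 0 then 6 else 0, fun q _ => ⟨rfl, ?_⟩,
    fun j => Continuous.continuousOn ?_⟩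
  · simp [init, searchInput_eq]
  · have := continuous_seriesSum
    simp only [searchInput_eq, init]
    rcases j with _ | _ | _ | _ | _ | _ | _ | j <;> simp <;> fun_prop

/-- For each `t` the parameters near which the first `t` steps are uniform form a dense open set, so
by Baire some `p` lies in all of them. At its halting time a whole neighbourhood of `p` halts at the
same line, with `R_0` continuous in the parameter and equal to the answer. -/
theorem not_decides (hT : 𝔅.TestsEqOrLt) (hO : 𝔅.OpsContinuous) {S : ℕ → List ℝ → Prop} {g : ℕ}
    (hg : ∀ p, S g (searchInput (seriesSum p)) ↔ ¬ {n : ℕ | p n = true}.Infinite) :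
    ¬ 𝔅.Decides P S := by
  classical
  intro hdec
  let c : ℕ → Cantor → Config ℝ := fun t p =>
    (𝔅.next P)^[t] (𝔅.init ((g : ℝ) :: searchInput (seriesSum p)))
  have hcs : ∀ t, c (t + 1) = fun p => 𝔅.next P (c t p) := fun t => by
    funext p; exact Function.iterate_succ_apply' _ _ _
  have hout : ∀ p, ∃ T, P[(c T p).line]? = some .halt ∧
      (c T p).reg 0 = if {n : ℕ | p n = true}.Infinite then (0 : ℝ) else 1 := by
    intro p
    obtain ⟨d, hd, hhalt, hv⟩ := hdec g (searchInput (seriesSum p))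
    obtain ⟨T, rfl⟩ := exists_iterate_next hd
    refine ⟨T, hhalt, ?_⟩
    have h1 := congrArg List.head? hv
    simp only [List.range_succ_eq_map, List.map_cons, List.head?_cons, Option.some.injEq, hg,
      ite_not] at h1
    exact h1.symm
  have hhalt_stuck : ∀ {T p}, P[(c T p).line]? = some .halt →
      ¬ ∃ c', 𝔅.Step P (c T p) c' := fun h ⟨_, h'⟩ => not_step_of_halt h h'
  -- A stuck configuration would persist forever under `next`, and would thus coincide with the
  -- halting one.
  have hstuck : ∀ t p, P[(c t p).line]? = some .halt ∨ ∃ c', 𝔅.Step P (c t p) c' := by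
    intro t p
    by_contra hno
    push Not at hno
    obtain ⟨T, hT, -⟩ := hout p
    have h1 : c (max t T) p = c t p :=
      iterate_next_of_stuck (fun ⟨c', h'⟩ => hno.2 c' h') (le_max_left _ _)
    have h2 : c (max t T) p = c T p :=
      iterate_next_of_stuck (hhalt_stuck hT) (le_max_right _ _)
    rw [h2] at h1
    exact hno.1 (h1 ▸ hT)
  let D : ℕ → Set Cantor := fun t => {p | ∃ U, IsOpen U ∧ p ∈ U ∧ UniformOn (c t) U}
  have hDopen : ∀ t, IsOpen (D t) := fun t => isOpen_iff_forall_mem_open.2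
    fun p ⟨U, hU, hpU, h⟩ => ⟨U, fun q hq => ⟨U, hU, hq, h⟩, hU, hpU⟩
  have hDdense : ∀ t, Dense (D t) := by
    intro t
    induction t with
    | zero => exact dense_univ.mono fun p _ => ⟨Set.univ, isOpen_univ, trivial, uniformOn_init _⟩
    | succ t ih =>
      rw [dense_iff_inter_open]
      intro W hW hWne
      obtain ⟨p, hpW, U, hU, hpU, hun⟩ := dense_iff_inter_open.1 ih W hW hWne
      obtain ⟨V, hVU, hV, ⟨q, hq⟩, hun'⟩ := (hun.mono Set.inter_subset_right).exists_next
        (U := W ∩ U) hT hO (hW.inter hU) ⟨p, hpW, hpU⟩ (hstuck t)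
      exact ⟨q, (hVU hq).1, V, hV, hq, by rwa [hcs]⟩
  obtain ⟨p, hp⟩ := (dense_iInter_of_isOpen_nat hDopen hDdense).nonempty
  obtain ⟨T, hT', -⟩ := hout p
  obtain ⟨U, hU, hpU, l, I, hlI, hreg⟩ := Set.mem_iInter.1 hp T
  refine not_continuousOn_isInfinite hU ⟨p, hpU⟩ (hreg 0) (a := 0) (b := 1) zero_ne_one
    fun q hq => ?_
  have hTq : P[(c T q).line]? = some .halt := by
    rw [(hlI q hq).1, ← (hlI p hpU).1]; exact hT'
  obtain ⟨T', hT1, hT2⟩ := hout q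
  have h1 : c (max T T') q = c T q := iterate_next_of_stuck (hhalt_stuck hTq) (le_max_left _ _)
  have h2 : c (max T T') q = c T' q := iterate_next_of_stuck (hhalt_stuck hT1) (le_max_right _ _)
  show (c T q).reg 0 = _
  rw [← h1, h2]
  exact hT2

end AlgStructure

end BSSWeihrauch

namespace BSSWeihrauch

open Filter Topology Relation

/-! ### Approximate simulation of register machines -/

/-- The words `w k` converge to a name of `x`. -/
def Represents (w : ℕ → List Bool) (x : ℝ) : Prop := ∃ r, realRep.names r x ∧ Converges w r

/-- Word functions that approximate the operations and the domains of a structure and the blank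
symbol. The natural number before the list of words is the stage of the approximation. -/
structure OpData (ι : Type) where
  opWord : ι → ℕ → List (List Bool) → List Bool
  domTest : ι → ℕ → ℕ → List (List Bool) → Bool
  blankWord : ℕ → List Bool

/-- Correctness of the approximations. -/
structure OpData.Sound {ι τ : Type} (E : OpData ι) (𝔄 : AlgStructure ℝ ι τ) : Prop where
  blank : Represents E.blankWord 𝔄.blank
  op : ∀ i v y, y ∈ 𝔄.op i v → ∀ ws : ℕ → Fin (𝔄.arity i) → List Bool,
    (∀ j, Represents (fun k => ws k j) (v j)) →
    Represents (fun k => E.opWord i k (List.ofFn (ws k))) y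
  dom : ∀ i v (ws : ℕ → Fin (𝔄.arity i) → List Bool), (∀ j, Represents (fun k => ws k j) (v j)) →
    ((𝔄.op i v).Dom ↔ ∃ m, ∀ k, E.domTest i m k (List.ofFn (ws k)) = false)

/-- Comparison of two reals at precision `2^{-i}`: can they be told to satisfy `<` (or `≠`, if `lt`
does not hold)? -/
def sepTest (lt : Bool) (w₁ w₂ : List Bool) (i : ℕ) : Option Bool :=
  (blocks w₁)[i]?.bind fun a => (blocks w₂)[i]?.map fun b =>
    farBelow a b i || (!lt && farBelow b a i)

/-- The relation decided in the limit by `sepTest`. -/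
def Separated (lt : Bool) (x y : ℝ) : Prop := if lt then x < y else x ≠ y

theorem sepTest_sound {lt : Bool} {w₁ w₂ : ℕ → List Bool} {x y : ℝ} (h₁ : Represents w₁ x)
    (h₂ : Represents w₂ y) {k i : ℕ} (h : sepTest lt (w₁ k) (w₂ k) i = some true) :
    Separated lt x y := by
  obtain ⟨r₁, ⟨s₁, hs₁, hx⟩, hc₁⟩ := h₁
  obtain ⟨r₂, ⟨s₂, hs₂, hy⟩, hc₂⟩ := h₂
  simp only [sepTest, Option.bind_eq_some_iff, Option.map_eq_some_iff] at h
  obtain ⟨a, ha, b, hb, h⟩ := h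
  obtain rfl := (hs₁.converges_blocks hc₁).getElem?_eq ha
  obtain rfl := (hs₂.converges_blocks hc₂).getElem?_eq hb
  have h1 := abs_lt.1 (hx i)
  have h2 := abs_lt.1 (hy i)
  rw [Bool.or_eq_true, Bool.and_eq_true, farBelow_iff, farBelow_iff] at h
  cases lt
  · rw [Separated, if_neg Bool.false_ne_true]
    rcases h with h | ⟨-, h⟩
    · exact ne_of_lt (by linarith)
    · exact ne_of_gt (by linarith)
  · rw [Separated, if_pos rfl]
    rcases h with h | ⟨h, -⟩
    · linarith
    · simp at h

theorem sepTest_eventually {lt : Bool} {w₁ w₂ : ℕ → List Bool} {x y : ℝ} (h₁ : Represents w₁ x)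
    (h₂ : Represents w₂ y) (i : ℕ) :
    ∀ᶠ k in atTop, (sepTest lt (w₁ k) (w₂ k) i).isSome := by
  obtain ⟨r₁, ⟨s₁, hs₁, hx⟩, hc₁⟩ := h₁
  obtain ⟨r₂, ⟨s₂, hs₂, hy⟩, hc₂⟩ := h₂
  filter_upwards [(hs₁.converges_blocks hc₁).eventually_getElem? i,
    (hs₂.converges_blocks hc₂).eventually_getElem? i] with k h1 h2
  simp [sepTest, h1, h2]

/-- Of a distance above `4 · 2^{-i}`, two errors below `2^{-i}` leave the margin of `farBelow`. Once
defined, the test at precision `i` uses the fixed `i`-th approximations, so its value does not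
change with the stage. -/
theorem sepTest_complete {lt : Bool} {w₁ w₂ : ℕ → List Bool} {x y : ℝ} (h₁ : Represents w₁ x)
    (h₂ : Represents w₂ y) (h : Separated lt x y) :
    ∃ i, ∀ k, sepTest lt (w₁ k) (w₂ k) i ≠ some false := by
  obtain ⟨r₁, ⟨s₁, hs₁, hx⟩, hc₁⟩ := h₁
  obtain ⟨r₂, ⟨s₂, hs₂, hy⟩, hc₂⟩ := h₂
  have hne : x ≠ y := by
    cases lt
    · simpa [Separated] using h
    · simp only [Separated, if_true] at h; exact h.ne
  obtain ⟨i, hi⟩ := exists_two_pow_lt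
    (div_pos (abs_pos.2 (sub_ne_zero.2 hne)) (by norm_num : (0 : ℝ) < 4))
  rw [lt_div_iff₀ (by norm_num)] at hi
  refine ⟨i, fun k hk => ?_⟩
  simp only [sepTest, Option.bind_eq_some_iff, Option.map_eq_some_iff] at hk
  obtain ⟨a, ha, b, hb, hk⟩ := hk
  obtain rfl := (hs₁.converges_blocks hc₁).getElem?_eq ha
  obtain rfl := (hs₂.converges_blocks hc₂).getElem?_eq hb
  have h1 := abs_lt.1 (hx i)
  have h2 := abs_lt.1 (hy i)
  rw [Bool.or_eq_false_iff] at hk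
  rcases lt_or_gt_of_ne hne with hlt | hgt
  · rw [abs_of_neg (by linarith)] at hi
    have := farBelow_iff.2 (show (nuQ (s₁ i) : ℝ) + 2 * (1 / 2) ^ i ≤ nuQ (s₂ i) by linarith)
    rw [this] at hk
    exact absurd hk.1 (by simp)
  · rw [abs_of_pos (by linarith)] at hi
    have := farBelow_iff.2 (show (nuQ (s₂ i) : ℝ) + 2 * (1 / 2) ^ i ≤ nuQ (s₁ i) by linarith)
    cases lt
    · rw [this] at hk
      exact absurd hk.2 (by simp)
    · simp only [Separated, if_true] at h
      exact absurd h hgt.not_gt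

/-- A guess consists of the outcome of a test and of a precision (for an operation, of the index
of a closed part of the domain). The guess for a test is refuted by the words `w₁`, `w₂`. -/
def testViolated (lt : Bool) (g : Bool × ℕ) (k : ℕ) (w₁ w₂ : List Bool) : Bool :=
  bif lt == g.1 then decide (sepTest lt w₁ w₂ g.2 = some false)
  else decide (sepTest lt w₁ w₂ k.unpair.1 = some true)

/-- Here `lt == g.1` says that the guess is "separated". That open condition becomes refutable by
fixing the precision `g.2` at which it must be confirmed. The opposite guess is closed already; it
is checked at every precision because the stage codes the precision as its first component. -/
theorem outcome_of_not_violated {lt : Bool} {w₁ w₂ : ℕ → List Bool} {x y : ℝ}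
    (h₁ : Represents w₁ x) (h₂ : Represents w₂ y) {g : Bool × ℕ}
    (h : ∀ k, testViolated lt g k (w₁ k) (w₂ k) = false) : Separated lt x y ↔ (lt == g.1) = true := by
  cases hc : lt == g.1
  · simp only [testViolated, hc, cond_false, decide_eq_false_iff_not] at h
    refine iff_of_false (fun hsep => ?_) Bool.false_ne_true
    obtain ⟨i, hi⟩ := sepTest_complete h₁ h₂ hsep
    obtain ⟨K, hK⟩ := (sepTest_eventually (lt := lt) h₁ h₂ i).exists_forall_of_atTop
    have h1 := hK _ (Nat.right_le_pair i K)
    have h2 := h (Nat.pair i K)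
    have h3 := hi (Nat.pair i K)
    rw [Nat.unpair_pair] at h2
    obtain ⟨b, hb⟩ := Option.isSome_iff_exists.1 h1
    rw [hb] at h2 h3
    cases b <;> simp_all
  · simp only [testViolated, hc, cond_true, decide_eq_false_iff_not] at h
    refine iff_of_true ?_ rfl
    obtain ⟨k, hk⟩ := (sepTest_eventually (lt := lt) h₁ h₂ g.2).exists
    obtain ⟨b, hb⟩ := Option.isSome_iff_exists.1 hk
    cases b
    · exact absurd hb (h k)
    · exact sepTest_sound h₁ h₂ hb

theorem exists_not_violated {w₁ w₂ : ℕ → List Bool} {x y : ℝ}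
    (h₁ : Represents w₁ x) (h₂ : Represents w₂ y) (lt : Bool) :
    ∃ g, ∀ k, testViolated lt g k (w₁ k) (w₂ k) = false := by
  by_cases hsep : Separated lt x y
  · obtain ⟨i, hi⟩ := sepTest_complete h₁ h₂ hsep
    exact ⟨(lt, i), fun k => by simpa [testViolated] using hi k⟩
  · refine ⟨(!lt, 0), fun k => ?_⟩
    have : sepTest lt (w₁ k) (w₂ k) k.unpair.1 ≠ some true := fun h =>
      hsep (sepTest_sound h₁ h₂ h)
    cases lt <;> simpa [testViolated] using this

/-- The state of a simulation: the line, and the lists of all assignments made to the index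
registers and to the real registers. -/
abbrev SimState : Type := ℕ × List (ℕ × ℕ) × List (ℕ × List Bool)

/-- The part of the name of the `j`-th entry of the tuple that is contained in a prefix `v` of a
name of a pair of a number and a tuple. -/
def entryWord (v : List Bool) (j : ℕ) : List Bool :=
  collect (fun n => v[2 * (2 * Nat.pair j n + 1) + 1]?) v.length

/-- The content of an index register. -/
def SimState.idxVal (len : ℕ) (s : SimState) (a : ℕ) : ℕ :=
  (s.2.1.lookup a).getD (bif a == 0 then len else 0)

section simulation

variable {ι τ : Type} (E : OpData ι) (arity : ι → ℕ) (lt : τ → Bool) (len : ℕ) (v : List Bool)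

/-- The initial content of a real register. -/
def initWord (a : ℕ) : List Bool :=
  bif a == 0 || decide (len < a) then E.blankWord v.length else entryWord v (a - 1)

/-- The content of a real register. -/
def regWord (s : SimState) (a : ℕ) : List Bool := (s.2.2.lookup a).getD (initWord E len v a)

/-- Simulation of an instruction: is the guess refuted, and what is the next state? -/
def simInstr (g : Bool × ℕ) (s : SimState) : Option (Instr ι τ) → Bool × SimState
  | none => (true, s)
  | some (.inc n) => (false, s.1 + 1, (n, s.idxVal len n + 1) :: s.2.1, s.2.2)
  | some (.dec n) => (false, s.1 + 1, (n, s.idxVal len n - 1) :: s.2.1, s.2.2)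
  | some (.jumpZero n l) => (false, bif s.idxVal len n == 0 then l else s.1 + 1, s.2)
  | some .copy =>
      (false, s.1 + 1, s.2.1, (s.idxVal len 0, regWord E len v s (s.idxVal len 1)) :: s.2.2)
  | some (.apply i) =>
      let ws := (List.range (arity i)).map fun j => regWord E len v s (j + 1)
      (E.domTest i g.2 v.length ws, s.1 + 1, s.2.1, (0, E.opWord i v.length ws) :: s.2.2)
  | some (.test t l) =>
      (testViolated (lt t) g v.length (regWord E len v s 1) (regWord E len v s 2),
        bif g.1 then l else s.1 + 1, s.2)
  | some .halt => (true, s)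

/-- Is the instruction a halting instruction? -/
def isHalt : Option (Instr ι τ) → Bool
  | some .halt => true
  | _ => false

/-- Simulation of a step, with a flag that records whether a guess has been refuted. -/
def simStep (P : List (Instr ι τ)) (st : Bool × SimState) (g : Bool × ℕ) : Bool × SimState :=
  let r := simInstr E arity lt len v g st.2 P[st.2.1]?
  (st.1 || r.1, r.2)

/-- The simulation with the list `G` of guesses refutes a guess or does not end in a halting
configuration. -/
def simFails (P : List (Instr ι τ)) (G : List (Bool × ℕ)) (st : Bool × SimState) : Bool :=
  (G.foldl (simStep E arity lt len v P) st).1 ||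
    !isHalt P[(G.foldl (simStep E arity lt len v P) st).2.1]?

/-- The failure flag never resets, so the fold can be unrolled from its first step; this permits
induction on the list of guesses. -/
theorem simFails_cons (P : List (Instr ι τ)) (g : Bool × ℕ) (G : List (Bool × ℕ)) (b : Bool)
    (s : SimState) : simFails E arity lt len v P (g :: G) (b, s) =
      (b || ((simInstr E arity lt len v g s P[s.1]?).1 ||
        simFails E arity lt len v P G (false, (simInstr E arity lt len v g s P[s.1]?).2))) := by
  have key : ∀ (G : List (Bool × ℕ)) (b : Bool) (s : SimState),
      G.foldl (simStep E arity lt len v P) (b, s) =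
        (b || (G.foldl (simStep E arity lt len v P) (false, s)).1,
          (G.foldl (simStep E arity lt len v P) (false, s)).2) := by
    intro G
    induction G with
    | nil => simp
    | cons g G ih =>
      intro b s
      simp only [List.foldl_cons, simStep, Bool.false_or]
      rw [ih, ih (simInstr E arity lt len v g s P[s.1]?).1, Bool.or_assoc]
  rw [simFails, List.foldl_cons, simStep, key, simFails]
  simp only [Bool.or_assoc]

end simulation

/-- The states `S k` of the simulations with the prefixes of `p` approximate the
configuration `c`. -/
structure Simulates {ι : Type} (E : OpData ι) (len : ℕ) (p : Cantor) (S : ℕ → SimState)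
    (c : Config ℝ) : Prop where
  line : ∀ k, (S k).1 = c.line
  idx : ∀ k a, (S k).idxVal len a = c.idx a
  reg : ∀ a, Represents (fun k => regWord E len (initSeg p k) (S k) a) (c.reg a)

/-! ### Soundness and completeness of the guessed simulation -/

namespace Simulates

open AlgStructure

variable {ι τ : Type} {E : OpData ι} {𝔄 : AlgStructure ℝ ι τ} {lt : τ → Bool} {len : ℕ}
  {p : Cantor} {S : ℕ → SimState} {c : Config ℝ} {P : List (Instr ι τ)}

theorem cons_idx (h : Simulates E len p S c) (l n m : ℕ) : Simulates E len p
    (fun k => (l, (n, m) :: (S k).2.1, (S k).2.2)) ⟨l, Function.update c.idx n m, c.reg⟩ := by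
  refine ⟨fun _ => rfl, fun k a => ?_, h.reg⟩
  by_cases ha : a = n
  · subst ha; simp [SimState.idxVal]
  · have := h.idx k a
    simp only [SimState.idxVal] at this ⊢
    simp [List.lookup_cons, beq_false_of_ne ha, Function.update_of_ne ha, this]

theorem cons_reg (h : Simulates E len p S c) (l n : ℕ) {w : ℕ → List Bool} {x : ℝ}
    (hw : Represents w x) : Simulates E len p
    (fun k => (l, (S k).2.1, (n, w k) :: (S k).2.2)) ⟨l, c.idx, Function.update c.reg n x⟩ := by
  refine ⟨fun _ => rfl, h.idx, fun a => ?_⟩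
  by_cases ha : a = n
  · subst ha; simpa [regWord] using hw
  · have := h.reg a
    simp only [regWord] at this ⊢
    simpa [List.lookup_cons, beq_false_of_ne ha, Function.update_of_ne ha] using this

theorem goto (h : Simulates E len p S c) (l : ℕ) :
    Simulates E len p (fun k => (l, (S k).2)) ⟨l, c.idx, c.reg⟩ :=
  ⟨fun _ => rfl, h.idx, h.reg⟩

theorem rel_iff (hlt : ∀ t, if lt t then 𝔄.IsLtTest t else 𝔄.IsEqTest t) (t : τ) (r : ℕ → ℝ) :
    𝔄.rel t (fun j => r (j + 1)) ↔ (Separated (lt t) (r 1) (r 2) ↔ lt t = true) := by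
  have := hlt t
  cases h : lt t
  · rw [h, if_neg Bool.false_ne_true] at this
    rw [this.rel_iff]
    simp [Separated]
  · rw [h, if_pos rfl] at this
    rw [this.rel_iff]
    simp [Separated]

/-- A guess that survives all stages is right about the domain or the test, so the machine has a
step. The guess does not depend on `k`, hence line and index registers stay exact and common to all
prefixes. -/
theorem step_sound (hE : E.Sound 𝔄) (hlt : ∀ t, if lt t then 𝔄.IsLtTest t else 𝔄.IsEqTest t)
    (h : Simulates E len p S c) {g : Bool × ℕ}
    (hg : ∀ k, (simInstr E 𝔄.arity lt len (initSeg p k) g (S k) P[(S k).1]?).1 = false) :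
    ∃ c', 𝔄.Step P c c' ∧ Simulates E len p
      (fun k => (simInstr E 𝔄.arity lt len (initSeg p k) g (S k) P[(S k).1]?).2) c' := by
  simp only [h.line] at hg ⊢
  cases hP : P[c.line]? with
  | none => simp [hP, simInstr] at hg
  | some ins =>
    cases ins with
    | halt => simp [hP, simInstr] at hg
    | inc n =>
      refine ⟨⟨c.line + 1, Function.update c.idx n (c.idx n + 1), c.reg⟩, by simp [Step, hP], ?_⟩
      simpa only [simInstr, h.line, h.idx] using h.cons_idx (c.line + 1) n (c.idx n + 1)
    | dec n =>
      refine ⟨⟨c.line + 1, Function.update c.idx n (c.idx n - 1), c.reg⟩, by simp [Step, hP], ?_⟩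
      simpa only [simInstr, h.line, h.idx] using h.cons_idx (c.line + 1) n (c.idx n - 1)
    | jumpZero n l =>
      refine ⟨⟨if c.idx n = 0 then l else c.line + 1, c.idx, c.reg⟩, by simp [Step, hP], ?_⟩
      have e : (bif c.idx n == 0 then l else c.line + 1) = if c.idx n = 0 then l else c.line + 1 := by
        by_cases h0 : c.idx n = 0
        · simp [h0]
        · simp [beq_false_of_ne h0, h0]
      simpa only [simInstr, h.line, h.idx, e] using h.goto (if c.idx n = 0 then l else c.line + 1)
    | copy =>
      refine ⟨⟨c.line + 1, c.idx, Function.update c.reg (c.idx 0) (c.reg (c.idx 1))⟩,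
        by simp [Step, hP], ?_⟩
      simpa only [simInstr, h.line, h.idx] using h.cons_reg (c.line + 1) (c.idx 0) (h.reg (c.idx 1))
    | apply i =>
      have hws : ∀ k, ((List.range (𝔄.arity i)).map fun j =>
          regWord E len (initSeg p k) (S k) (j + 1)) =
          List.ofFn fun j : Fin (𝔄.arity i) => regWord E len (initSeg p k) (S k) (j + 1) := by
        intro k
        apply List.ext_getElem <;> simp
      simp only [hP, simInstr, hws, length_initSeg] at hg
      have hreg : ∀ j : Fin (𝔄.arity i),
          Represents (fun k => regWord E len (initSeg p k) (S k) (j + 1)) (c.reg (j + 1)) :=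
        fun j => h.reg _
      have hdom := (hE.dom i (fun j => c.reg (j + 1)) _ hreg).2 ⟨g.2, hg⟩
      obtain ⟨y, hy⟩ := Part.dom_iff_mem.1 hdom
      refine ⟨⟨c.line + 1, c.idx, Function.update c.reg 0 y⟩, ?_, ?_⟩
      · simp only [Step, hP]
        exact ⟨_, hy, rfl⟩
      · simpa only [simInstr, h.line, hws, length_initSeg] using
          h.cons_reg (c.line + 1) 0 (hE.op i _ _ hy _ hreg)
    | test t l =>
      simp only [hP, simInstr, length_initSeg] at hg
      have hout := outcome_of_not_violated (h.reg 1) (h.reg 2) hg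
      have hrel : 𝔄.rel t (fun j => c.reg (j + 1)) ↔ g.1 = true := by
        rw [rel_iff hlt, hout]
        cases lt t <;> cases g.1 <;> simp
      refine ⟨⟨bif g.1 then l else c.line + 1, c.idx, c.reg⟩, ?_, ?_⟩
      · simp only [Step, hP, hrel]
        cases g.1 <;> simp
      · simpa only [simInstr, h.line] using h.goto (bif g.1 then l else c.line + 1)

/-- The guess is read off the true step: a closed piece of the domain that contains the arguments,
or the true outcome with a sufficient precision. Other commands need no guess. -/
theorem step_complete (hE : E.Sound 𝔄) (h : Simulates E len p S c) {c' : Config ℝ}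
    (hs : 𝔄.Step P c c') : ∃ g, ∀ k,
      (simInstr E 𝔄.arity lt len (initSeg p k) g (S k) P[(S k).1]?).1 = false := by
  simp only [h.line]
  cases hP : P[c.line]? with
  | none => simp [Step, hP] at hs
  | some ins =>
    cases ins with
    | halt => simp [Step, hP] at hs
    | inc n => exact ⟨(false, 0), fun k => rfl⟩
    | dec n => exact ⟨(false, 0), fun k => rfl⟩
    | jumpZero n l => exact ⟨(false, 0), fun k => rfl⟩
    | copy => exact ⟨(false, 0), fun k => rfl⟩
    | apply i =>
      simp only [Step, hP] at hs
      obtain ⟨y, hy, -⟩ := hs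
      have hws : ∀ k, ((List.range (𝔄.arity i)).map fun j =>
          regWord E len (initSeg p k) (S k) (j + 1)) =
          List.ofFn fun j : Fin (𝔄.arity i) => regWord E len (initSeg p k) (S k) (j + 1) := by
        intro k
        apply List.ext_getElem <;> simp
      obtain ⟨m, hm⟩ := (hE.dom i (fun j => c.reg (j + 1)) _ fun j => h.reg _).1 hy.1
      refine ⟨(false, m), fun k => ?_⟩
      simpa only [simInstr, hws, length_initSeg] using hm k
    | test t l =>
      obtain ⟨g, hg⟩ := exists_not_violated (h.reg 1) (h.reg 2) (lt t)
      refine ⟨g, fun k => ?_⟩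
      simpa only [simInstr, length_initSeg] using hg k

/-- This is the `F_σ` form of halting: an existential quantifier over finite lists of guesses and a
universal one over prefixes. -/
theorem halts_iff (hE : E.Sound 𝔄) (hlt : ∀ t, if lt t then 𝔄.IsLtTest t else 𝔄.IsEqTest t)
    (h : Simulates E len p S c) :
    (∃ c', ReflTransGen (𝔄.Step P) c c' ∧ P[c'.line]? = some .halt) ↔
      ∃ G, ∀ k, simFails E 𝔄.arity lt len (initSeg p k) P G (false, S k) = false := by
  have hnil : ∀ {S : ℕ → SimState} {c : Config ℝ}, Simulates E len p S c →
      ((∀ k, simFails E 𝔄.arity lt len (initSeg p k) P [] (false, S k) = false) ↔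
        P[c.line]? = some .halt) := by
    intro S c h
    simp only [simFails, List.foldl_nil, Bool.false_or, Bool.not_eq_false', h.line, forall_const]
    rcases P[c.line]? with _ | ⟨_ | _ | _ | _ | _ | _ | _⟩ <;> simp [isHalt]
  constructor
  · rintro ⟨c', hc', hP⟩
    induction hc' using ReflTransGen.head_induction_on generalizing S with
    | refl => exact ⟨[], (hnil h).2 hP⟩
    | head hs _ ih =>
      obtain ⟨g, hg⟩ := h.step_complete (lt := lt) hE hs
      obtain ⟨d, hd, hsim⟩ := h.step_sound hE hlt hg
      obtain rfl := hs.det hd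
      obtain ⟨G, hG⟩ := ih hsim
      exact ⟨g :: G, fun k => by rw [simFails_cons, hg, hG]; rfl⟩
  · rintro ⟨G, hG⟩
    induction G generalizing S c with
    | nil => exact ⟨c, .refl, (hnil h).1 hG⟩
    | cons g G ih =>
      simp only [simFails_cons, Bool.false_or, Bool.or_eq_false_iff, forall_and] at hG
      obtain ⟨d, hd, hsim⟩ := h.step_sound hE hlt hG.1
      obtain ⟨c', hc', hP⟩ := ih hsim hG.2
      exact ⟨c', .head hd hc', hP⟩

end Simulates

theorem simulates_init {ι τ : Type} {E : OpData ι} {𝔄 : AlgStructure ℝ ι τ} (hE : E.Sound 𝔄)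
    {p : Cantor} {u : List ℝ}
    (hu : ∀ (i : ℕ) (h : i < u.length),
      realRep.names (fun k => oddPart (oddPart p) (Nat.pair i k)) u[i]) :
    Simulates E u.length p (fun _ => (0, [], [])) (𝔄.init u) := by
  refine ⟨fun _ => rfl, fun k a => ?_, fun a => ?_⟩
  · by_cases ha : a = 0
    · simp [SimState.idxVal, AlgStructure.init, ha]
    · simp [SimState.idxVal, AlgStructure.init, ha, beq_false_of_ne ha]
  · simp only [regWord, List.lookup_nil, Option.getD_none, initWord, length_initSeg]
    rcases a with _ | j
    · simpa [AlgStructure.init] using hE.blank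
    · by_cases hj : j < u.length
      · have e1 : (decide (u.length < j + 1)) = false := by simp; omega
        simp only [Nat.add_eq_zero_iff, one_ne_zero, and_false, ne_eq,
          not_false_eq_true, beq_false_of_ne, e1, Bool.or_self, cond_false, Nat.add_sub_cancel,
          AlgStructure.init, List.getD_eq_getElem?_getD, List.getElem?_eq_getElem hj,
          Option.getD_some]
        refine ⟨_, hu j hj, ?_⟩
        simp only [entryWord, length_initSeg]
        refine converges_collect (fun k n a ha => ?_) fun n => ?_
        · exact (converges_initSeg p).getElem?_eq ha
        · filter_upwards [(converges_initSeg p).eventually_getElem?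
            (2 * (2 * Nat.pair j n + 1) + 1)] with k hk
          rw [hk]; rfl
      · have e1 : (decide (u.length ≤ j)) = true := by simp; omega
        simpa [e1, AlgStructure.init, List.getElem?_eq_none (not_lt.1 hj)] using hE.blank

/-! ### A decision procedure for the halting problem with a question to `isInfinite` -/

/-- The bits of `v` selected by `f` do not form a part of the name of `n`. -/
def natRefuted (f : ℕ → ℕ) (n : ℕ) (v : List Bool) : Bool :=
  decide (v[f v.length.unpair.1]? = some (!decide (n ≤ v.length.unpair.1)))

theorem names_iff_not_natRefuted (f : ℕ → ℕ) (n : ℕ) (p : Cantor) :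
    natRep.names (fun k => p (f k)) n ↔ ∀ k, natRefuted f n (initSeg p k) = false := by
  constructor
  · intro h k
    simp only [natRefuted, length_initSeg, decide_eq_false_iff_not]
    intro h'
    have h1 := (converges_initSeg p).getElem?_eq h'
    have h2 : p (f k.unpair.1) = true ↔ n ≤ k.unpair.1 := h k.unpair.1
    rw [← h1] at h2
    by_cases h3 : n ≤ k.unpair.1 <;> simp [h3] at h2
  · intro h k
    have h1 := h (Nat.pair k (f k + 1))
    have h2 : f k < Nat.pair k (f k + 1) := Nat.right_le_pair k (f k + 1)
    simp only [natRefuted, length_initSeg, Nat.unpair_pair, getElem?_initSeg p h2,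
      decide_eq_false_iff_not, Option.some.injEq] at h1
    by_cases h3 : n ≤ k <;> simpa [h3] using h1

section refutation

variable {ι τ : Type} [Primcodable ι] [Primcodable τ] (E : OpData ι) (arity : ι → ℕ) (lt : τ → Bool)

/-- The word `v` refutes the guess coded by `m` for a halting computation. -/
def refutesHalting (m : ℕ) (v : List Bool) : Bool :=
  ((Encodable.decode m : Option (ℕ × ℕ × List (Bool × ℕ))).bind fun d =>
    (Encodable.decode d.1 : Option (List (Instr ι τ))).map fun P =>
      natRefuted (fun k => 2 * k) d.1 v || (natRefuted (fun k => 2 * (2 * k) + 1) d.2.1 v ||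
        simFails E arity lt d.2.1 v P d.2.2 (false, 0, [], []))).getD true

/-- The program number and the input length are guessed as well, as no fixed prefix of the name
reveals them; wrong values are refuted by single bits. A code that decodes to no guess or no program
counts as refuted. -/
theorem haltingProblem_iff_not_refuted {E : OpData ι} {lt : τ → Bool} {𝔄 : AlgStructure ℝ ι τ}
    (hE : E.Sound 𝔄) (hlt : ∀ t, if lt t then 𝔄.IsLtTest t else 𝔄.IsEqTest t) {p : Cantor}
    {a : ℕ × List ℝ} (hp : (prodRep natRep (listRep realRep)).names p a) :
    𝔄.HaltingProblem a.1 a.2 ↔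
      ∃ m, ∀ k, refutesHalting E 𝔄.arity lt m (initSeg p k) = false := by
  obtain ⟨n, u⟩ := a
  obtain ⟨hn, hlen, hu⟩ := hp
  simp only [AlgStructure.HaltingProblem, AlgStructure.halts_iff]
  have hsim := simulates_init hE hu
  constructor
  · rintro ⟨P, hP, hhalt⟩
    obtain ⟨G, hG⟩ := (hsim.halts_iff hE hlt).1 hhalt
    refine ⟨Encodable.encode (n, u.length, G), fun k => ?_⟩
    have h1 := (names_iff_not_natRefuted (fun k => 2 * k) n p).1 hn k
    have h2 := (names_iff_not_natRefuted (fun k => 2 * (2 * k) + 1) u.length p).1 hlen k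
    simp [refutesHalting, Encodable.encodek, hP, h1, h2, hG k]
  · rintro ⟨m, hm⟩
    cases hd : (Encodable.decode m : Option (ℕ × ℕ × List (Bool × ℕ))) with
    | none => simp [refutesHalting, hd] at hm
    | some d =>
      obtain ⟨n', len, G⟩ := d
      cases hP : (Encodable.decode n' : Option (List (Instr ι τ))) with
      | none => simp [refutesHalting, hd, hP] at hm
      | some P =>
        simp only [refutesHalting, hd, hP, Option.bind_some, Option.map_some, Option.getD_some,
          Bool.or_eq_false_iff, forall_and] at hm
        obtain rfl := natRep.unique _ _ _ hn ((names_iff_not_natRefuted _ n' p).2 hm.1)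
        obtain rfl := natRep.unique _ _ _ hlen ((names_iff_not_natRefuted _ len p).2 hm.2.1)
        exact ⟨P, hP, (hsim.halts_iff hE hlt).2 ⟨G, hm.2.2⟩⟩

theorem reducesVia_halting_infinite {E : OpData ι} {lt : τ → Bool} {𝔄 : AlgStructure ℝ ι τ}
    (hE : E.Sound 𝔄) (hlt : ∀ t, if lt t then 𝔄.IsLtTest t else 𝔄.IsEqTest t) :
    ReducesVia (refutationMoves (refutesHalting E 𝔄.arity lt)) true
      (prodRep natRep (listRep realRep)) (fun a => 𝔄.HaltingProblem a.1 a.2) cantorRep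
      fun p => {n : ℕ | p n = true}.Infinite :=
  ReducesVia.of_refutation fun _ _ hp => haltingProblem_iff_not_refuted hE hlt hp

end refutation

end BSSWeihrauch

namespace BSSWeihrauch

open Filter Topology

/-! ### Computability of the simulation -/

/-- Computability of the approximations. -/
structure OpData.Computable {ι : Type} [Primcodable ι] (E : OpData ι) : Prop where
  opWord : _root_.Computable fun x : ι × ℕ × List (List Bool) => E.opWord x.1 x.2.1 x.2.2
  domTest : _root_.Computable fun x : ι × ℕ × ℕ × List (List Bool) =>
    E.domTest x.1 x.2.1 x.2.2.1 x.2.2.2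
  blankWord : _root_.Computable E.blankWord

section computability

open Computable

variable {α σ ι τ : Type} [Primcodable α] [Primcodable σ] [Primcodable ι] [Primcodable τ]

theorem computable_sum_elim {β γ : Type} [Primcodable β] [Primcodable γ] {f : α × (β ⊕ γ) → σ}
    (hl : Computable fun x : α × β => f (x.1, .inl x.2))
    (hr : Computable fun x : α × γ => f (x.1, .inr x.2)) : Computable f := by
  refine (sumCasesOn snd (hl.comp ((fst.comp fst).pair snd)).to₂
    (hr.comp ((fst.comp fst).pair snd)).to₂).of_eq ?_
  rintro ⟨a, b | c⟩ <;> rfl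

/-- Case distinction on commands is transported along the sum type that defines their coding. -/
theorem computable_instr_casesOn {f : α → Instr ι τ → σ} {o : α → Instr ι τ} (ho : Computable o)
    (hinc : Computable fun x : α × ℕ => f x.1 (.inc x.2))
    (hdec : Computable fun x : α × ℕ => f x.1 (.dec x.2))
    (hjump : Computable fun x : α × ℕ × ℕ => f x.1 (.jumpZero x.2.1 x.2.2))
    (hcopy : Computable fun a => f a .copy)
    (happly : Computable fun x : α × ι => f x.1 (.apply x.2))
    (htest : Computable fun x : α × τ × ℕ => f x.1 (.test x.2.1 x.2.2))
    (hhalt : Computable fun a => f a .halt) : Computable fun a => f a (o a) := by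
  have he : Computable fun a => (a, Instr.equivSum ι τ (o a)) :=
    Computable.id.pair ((Primrec.of_equiv (e := Instr.equivSum ι τ)).to_comp.comp ho)
  have h : Computable fun x : α × (ℕ ⊕ ℕ ⊕ (ℕ × ℕ) ⊕ Unit ⊕ ι ⊕ (τ × ℕ) ⊕ Unit) =>
      f x.1 ((Instr.equivSum ι τ).symm x.2) := by
    refine computable_sum_elim ?_ (computable_sum_elim ?_ (computable_sum_elim ?_
      (computable_sum_elim ?_ (computable_sum_elim ?_ (computable_sum_elim ?_ ?_)))))
    · exact hinc
    · exact hdec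
    · exact hjump
    · exact hcopy.comp fst
    · exact happly
    · exact htest
    · exact hhalt.comp fst
  refine (h.comp he).of_eq fun a => ?_
  simp only [Equiv.symm_apply_apply]

theorem computable_farBelow {u v i : α → ℕ} (hu : Computable u) (hv : Computable v)
    (hi : Computable i) : Computable fun x => farBelow (u x) (v x) (i x) := by
  have h := primrec_farBelow.to_comp
  have h' := h.comp (hu.pair (hv.pair hi))
  exact h'

theorem computable_sepTest {lt : α → Bool} {w₁ w₂ : α → List Bool} {i : α → ℕ}
    (hlt : Computable lt) (h₁ : Computable w₁) (h₂ : Computable w₂) (hi : Computable i) :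
    Computable fun a => sepTest (lt a) (w₁ a) (w₂ a) (i a) := by
  have b {β : Type} [Primcodable β] {w : β → List Bool} {i : β → ℕ} (h : Computable w)
      (hi : Computable i) : Computable fun a => (blocks (w a))[i a]? :=
    list_getElem?.comp (primrec_blocks.to_comp.comp h) hi
  have c1 : Computable fun x : (α × ℕ) × ℕ => x.1.2 := snd.comp fst
  have ci : Computable fun x : (α × ℕ) × ℕ => i x.1.1 := hi.comp (fst.comp fst)
  have f1 := computable_farBelow c1 snd ci
  have f2 := computable_farBelow snd c1 ci
  have f3 : Computable fun x : (α × ℕ) × ℕ => !lt x.1.1 :=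
    Primrec.not.to_comp.comp (hlt.comp (fst.comp fst))
  have f4 : Computable fun x : (α × ℕ) × ℕ => !lt x.1.1 && farBelow x.2 x.1.2 (i x.1.1) :=
    Primrec.and.to_comp.comp f3 f2
  have f5 : Computable fun x : (α × ℕ) × ℕ => farBelow x.1.2 x.2 (i x.1.1) ||
      (!lt x.1.1 && farBelow x.2 x.1.2 (i x.1.1)) := Primrec.or.to_comp.comp f1 f4
  have f6 : Computable fun x : α × ℕ => (blocks (w₂ x.1))[i x.1]?.map fun y =>
      farBelow x.2 y (i x.1) || (!lt x.1 && farBelow y x.2 (i x.1)) :=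
    option_map (b (h₂.comp fst) (hi.comp fst)) f5.to₂
  have f7 := option_bind (b h₁ hi) f6.to₂
  simpa only [sepTest] using f7

theorem computable_testViolated {lt : α → Bool} {g : α → Bool × ℕ} {k : α → ℕ}
    {w₁ w₂ : α → List Bool} (hlt : Computable lt) (hg : Computable g) (hk : Computable k)
    (h₁ : Computable w₁) (h₂ : Computable w₂) :
    Computable fun a => testViolated (lt a) (g a) (k a) (w₁ a) (w₂ a) :=
  Computable.cond (Primrec.beq.to_comp.comp hlt (fst.comp hg))
    (Primrec.eq.decide.to_comp.comp (computable_sepTest hlt h₁ h₂ (snd.comp hg)) (const _))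
    (Primrec.eq.decide.to_comp.comp (computable_sepTest hlt h₁ h₂ (fst.comp (unpair.comp hk)))
      (const _))

theorem computable_idxVal {len : α → ℕ} {s : α → SimState} {n : α → ℕ} (hlen : Computable len)
    (hs : Computable s) (hn : Computable n) : Computable fun a => (s a).idxVal (len a) (n a) :=
  option_getD (Primrec.listLookup.to_comp.comp hn (fst.comp (snd.comp hs)))
    (Computable.cond (Primrec.beq.to_comp.comp hn (const 0)) hlen (const 0))

theorem computable_entryWord : Computable₂ entryWord := by
  have h : Primrec fun x : (List Bool × ℕ) × ℕ => x.1.1[2 * (2 * Nat.pair x.1.2 x.2 + 1) + 1]? := by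
    have h1 : Primrec fun x : (List Bool × ℕ) × ℕ => 2 * Nat.pair x.1.2 x.2 + 1 :=
      Primrec.nat_double_succ.comp
        (Primrec₂.natPair.comp (Primrec.snd.comp Primrec.fst) Primrec.snd)
    exact Primrec.list_getElem?.comp (Primrec.fst.comp Primrec.fst)
      (Primrec.nat_double_succ.comp h1)
  exact computable_collect h.to_comp.to₂ (list_length.comp fst)

variable {E : OpData ι} (hE : E.Computable)

include hE in
theorem computable_regWord {len : α → ℕ} {v : α → List Bool} {s : α → SimState} {n : α → ℕ}
    (hlen : Computable len) (hv : Computable v) (hs : Computable s) (hn : Computable n) :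
    Computable fun a => regWord E (len a) (v a) (s a) (n a) :=
  option_getD (Primrec.listLookup.to_comp.comp hn (snd.comp (snd.comp hs)))
    (Computable.cond (Primrec.or.to_comp.comp (Primrec.beq.to_comp.comp hn (const 0))
      (Primrec.nat_lt.decide.to_comp.comp hlen hn)) (hE.blankWord.comp (list_length.comp hv))
      (computable_entryWord.comp hv (Primrec.nat_sub.to_comp.comp hn (const 1))))

variable {arity : ι → ℕ} {lt : τ → Bool} (harity : Computable arity) (hlt : Computable lt)

include hE harity hlt in
theorem computable_simInstr {len : α → ℕ} {v : α → List Bool} {g : α → Bool × ℕ}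
    {s : α → SimState} {o : α → Option (Instr ι τ)} (hlen : Computable len) (hv : Computable v)
    (hg : Computable g) (hs : Computable s) (ho : Computable o) :
    Computable fun a => simInstr E arity lt (len a) (v a) (g a) (s a) (o a) := by
  have hline : Computable fun a => (s a).1 := fst.comp hs
  have hnext : Computable fun a => (s a).1 + 1 := succ.comp hline
  have hidx : Computable fun a => (s a).2.1 := fst.comp (snd.comp hs)
  have hreg : Computable fun a => (s a).2.2 := snd.comp (snd.comp hs)
  have hfail : Computable fun a => ((true, s a) : Bool × SimState) := (const true).pair hs
  have hval : Computable fun x : α × ℕ => (s x.1).idxVal (len x.1) x.2 :=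
    computable_idxVal (hlen.comp fst) (hs.comp fst) snd
  have hupd {f : α × ℕ → ℕ} (hf : Computable f) : Computable fun x : α × ℕ =>
      ((false, (s x.1).1 + 1, (x.2, f x) :: (s x.1).2.1, (s x.1).2.2) : Bool × SimState) :=
    (const false).pair ((hnext.comp fst).pair
      ((list_cons.comp (snd.pair hf) (hidx.comp fst)).pair (hreg.comp fst)))
  have hrw {β : Type} [Primcodable β] {p : β → α} {n : β → ℕ} (hp : Computable p)
      (hn : Computable n) :
      Computable fun x => regWord E (len (p x)) (v (p x)) (s (p x)) (n x) :=
    computable_regWord hE (hlen.comp hp) (hv.comp hp) (hs.comp hp) hn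
  have hstage : Computable fun a => (v a).length := list_length.comp hv
  have hws : Computable fun x : α × ι => (List.range (arity x.2)).map fun j =>
      regWord E (len x.1) (v x.1) (s x.1) (j + 1) :=
    list_map_range (hrw (fst.comp fst) (succ.comp snd)).to₂ (harity.comp snd)
  have hinc := hupd (succ.comp hval)
  have hdec' : Computable fun x : α × ℕ => (s x.1).idxVal (len x.1) x.2 - 1 :=
    Primrec.nat_sub.to_comp.comp hval (const 1)
  have hdec := hupd hdec'
  have hval' (m : ℕ) : Computable fun a => (s a).idxVal (len a) m :=
    hval.comp (Computable.id.pair (const m))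
  have hcopy := (const false).pair (hnext.pair (hidx.pair
    (list_cons.comp ((hval' 0).pair (hrw Computable.id (hval' 1))) hreg)))
  have hjz : Computable fun x : α × ℕ × ℕ => (s x.1).idxVal (len x.1) x.2.1 :=
    hval.comp (fst.pair (fst.comp snd))
  have hjump := (const false).pair ((Computable.cond (Primrec.beq.to_comp.comp hjz (const 0))
    (snd.comp snd) (hnext.comp fst)).pair (snd.comp (hs.comp fst)))
  have happly := (hE.domTest.comp (snd.pair ((snd.comp (hg.comp fst)).pair
    ((hstage.comp fst).pair hws)))).pair ((hnext.comp fst).pair ((hidx.comp fst).pair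
      (list_cons.comp ((const 0).pair (hE.opWord.comp (snd.pair ((hstage.comp fst).pair
        hws)))) (hreg.comp fst))))
  have htest' : Computable fun x : α × τ × ℕ => testViolated (lt x.2.1) (g x.1) (v x.1).length
      (regWord E (len x.1) (v x.1) (s x.1) 1) (regWord E (len x.1) (v x.1) (s x.1) 2) :=
    computable_testViolated (hlt.comp (fst.comp snd)) (hg.comp fst) (hstage.comp fst)
      (hrw fst (const 1)) (hrw fst (const 2))
  have htest := htest'.pair ((Computable.cond (fst.comp (hg.comp fst)) (snd.comp snd)
    (hnext.comp fst)).pair (snd.comp (hs.comp fst)))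
  have b1 : Computable fun x : (α × Instr ι τ) × ℕ => simInstr E arity lt (len x.1.1) (v x.1.1)
      (g x.1.1) (s x.1.1) (some (.inc x.2)) := by
    have h := hinc.comp (((fst (α := α) (β := Instr ι τ)).comp fst).pair snd)
    exact h
  have b2 : Computable fun x : (α × Instr ι τ) × ℕ => simInstr E arity lt (len x.1.1) (v x.1.1)
      (g x.1.1) (s x.1.1) (some (.dec x.2)) := by
    have h := hdec.comp (((fst (α := α) (β := Instr ι τ)).comp fst).pair snd)
    exact h
  have b3 : Computable fun x : (α × Instr ι τ) × ℕ × ℕ => simInstr E arity lt (len x.1.1) (v x.1.1)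
      (g x.1.1) (s x.1.1) (some (.jumpZero x.2.1 x.2.2)) := by
    have h := hjump.comp (((fst (α := α) (β := Instr ι τ)).comp fst).pair snd)
    exact h
  have b4 : Computable fun x : α × Instr ι τ => simInstr E arity lt (len x.1) (v x.1)
      (g x.1) (s x.1) (some .copy) := by
    have h := hcopy.comp (fst (α := α) (β := Instr ι τ))
    exact h
  have b5 : Computable fun x : (α × Instr ι τ) × ι => simInstr E arity lt (len x.1.1) (v x.1.1)
      (g x.1.1) (s x.1.1) (some (.apply x.2)) := by
    have h := happly.comp (((fst (α := α) (β := Instr ι τ)).comp fst).pair snd)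
    exact h
  have b6 : Computable fun x : (α × Instr ι τ) × τ × ℕ => simInstr E arity lt (len x.1.1) (v x.1.1)
      (g x.1.1) (s x.1.1) (some (.test x.2.1 x.2.2)) := by
    have h := htest.comp (((fst (α := α) (β := Instr ι τ)).comp fst).pair snd)
    exact h
  have b7 : Computable fun x : α × Instr ι τ => simInstr E arity lt (len x.1) (v x.1)
      (g x.1) (s x.1) (some .halt) := by
    have h := hfail.comp (fst (α := α) (β := Instr ι τ))
    exact h
  have hinstr := computable_instr_casesOn (α := α × Instr ι τ)
    (f := fun x i => simInstr E arity lt (len x.1) (v x.1) (g x.1) (s x.1) (some i)) snd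
    b1 b2 b3 b4 b5 b6 b7
  refine (option_casesOn ho hfail hinstr.to₂).of_eq fun a => ?_
  cases o a <;> rfl

theorem computable_isHalt : Computable (isHalt : Option (Instr ι τ) → Bool) := by
  have h : Computable fun i : Instr ι τ => isHalt (some i) :=
    computable_instr_casesOn (α := Instr ι τ) (f := fun _ i => isHalt (some i)) Computable.id
      (const false) (const false) (const false) (const false) (const false) (const false)
      (const true)
  refine (option_casesOn Computable.id (const false) (h.comp snd).to₂).of_eq fun o => ?_
  cases o <;> rfl

include hE harity hlt in
theorem computable_simFails {len : α → ℕ} {v : α → List Bool} {P : α → List (Instr ι τ)}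
    {G : α → List (Bool × ℕ)} (hlen : Computable len) (hv : Computable v) (hP : Computable P)
    (hG : Computable G) :
    Computable fun a => simFails E arity lt (len a) (v a) (P a) (G a) (false, 0, [], []) := by
  have hstep : Computable₂ fun (a : α) (x : (Bool × SimState) × Bool × ℕ) =>
      simStep E arity lt (len a) (v a) (P a) x.1 x.2 := by
    have st : Computable fun y : α × (Bool × SimState) × Bool × ℕ => y.2.1.2 :=
      snd.comp (fst.comp snd)
    have hi : Computable fun y : α × (Bool × SimState) × Bool × ℕ =>
        simInstr E arity lt (len y.1) (v y.1) y.2.2 y.2.1.2 (P y.1)[y.2.1.2.1]? :=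
      computable_simInstr hE harity hlt (hlen.comp fst) (hv.comp fst) (snd.comp snd) st
        (list_getElem?.comp (hP.comp fst) (fst.comp st))
    exact ((Primrec.or.to_comp.comp (fst.comp (fst.comp snd)) (fst.comp hi)).pair
      (snd.comp hi)).to₂
  have hfold := list_foldl hG (const ((false, 0, [], []) : Bool × SimState)) hstep
  exact Primrec.or.to_comp.comp (fst.comp hfold) (Primrec.not.to_comp.comp
    (computable_isHalt.comp (list_getElem?.comp hP (fst.comp (snd.comp hfold)))))

theorem computable_natRefuted {f : ℕ → ℕ} (hf : Computable f) {n : α → ℕ} {v : α → List Bool}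
    (hn : Computable n) (hv : Computable v) : Computable fun a => natRefuted f (n a) (v a) := by
  have hk : Computable fun a => (v a).length.unpair.1 :=
    fst.comp (unpair.comp (list_length.comp hv))
  exact Primrec.eq.decide.to_comp.comp (list_getElem?.comp hv (hf.comp hk))
    (option_some.comp (Primrec.not.to_comp.comp (Primrec.nat_le.decide.to_comp.comp hn hk)))

include hE harity hlt in
theorem computable_refutesHalting : Computable₂ (refutesHalting E arity lt) := by
  have hd : Computable fun y : ℕ × List Bool =>
      (Encodable.decode y.1 : Option (ℕ × ℕ × List (Bool × ℕ))) := Computable.decode.comp fst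
  have hP : Computable fun y : (ℕ × List Bool) × ℕ × ℕ × List (Bool × ℕ) =>
      (Encodable.decode y.2.1 : Option (List (Instr ι τ))) := Computable.decode.comp (fst.comp snd)
  have d : Computable fun z : ((ℕ × List Bool) × ℕ × ℕ × List (Bool × ℕ)) × List (Instr ι τ) =>
    z.1.2 := snd.comp fst
  have v : Computable fun z : ((ℕ × List Bool) × ℕ × ℕ × List (Bool × ℕ)) × List (Instr ι τ) =>
    z.1.1.2 := snd.comp (fst.comp fst)
  have h2 : Primrec fun k : ℕ => 2 * k := Primrec.nat_double
  have h4 : Primrec fun k : ℕ => 2 * (2 * k) + 1 :=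
    Primrec.nat_double_succ.comp Primrec.nat_double
  have hmain := Primrec.or.to_comp.comp (computable_natRefuted h2.to_comp (fst.comp d) v)
    (Primrec.or.to_comp.comp (computable_natRefuted h4.to_comp (fst.comp (snd.comp d)) v)
      (computable_simFails (τ := τ) hE harity hlt (fst.comp (snd.comp d)) v snd
        (snd.comp (snd.comp d))))
  exact option_getD (option_bind hd (option_map hP hmain.to₂).to₂) (const true)

end computability

/-! ### Approximations for computable operations -/

/-- The bits of the name of `(e, u)` that are determined by prefixes of names of the entries
of `u`. -/
def argBit (e : ℕ) (ws : List (List Bool)) (N : ℕ) : Option Bool :=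
  bif N % 2 == 0 then some (decide (e ≤ N / 2))
  else bif N / 2 % 2 == 0 then some (decide (ws.length ≤ N / 2 / 2))
  else ws[(N / 2 / 2).unpair.1]?.elim (some false) fun w => w[(N / 2 / 2).unpair.2]?

/-- The name of `(e, u)` composed of names of the entries of `u`. -/
def argName (e : ℕ) {n : ℕ} (r : Fin n → Cantor) : Cantor := fun N =>
  bif N % 2 == 0 then decide (e ≤ N / 2)
  else bif N / 2 % 2 == 0 then decide (n ≤ N / 2 / 2)
  else if h : (N / 2 / 2).unpair.1 < n then r ⟨_, h⟩ (N / 2 / 2).unpair.2 else false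

/-- The bits of the name of `((e, u), m)`. -/
def argBit₂ (e m : ℕ) (ws : List (List Bool)) (N : ℕ) : Option Bool :=
  bif N % 2 == 0 then argBit e ws (N / 2) else some (decide (m ≤ N / 2))

/-- The name of `((e, u), m)`. -/
def argName₂ (e m : ℕ) {n : ℕ} (r : Fin n → Cantor) : Cantor := fun N =>
  bif N % 2 == 0 then argName e r (N / 2) else decide (m ≤ N / 2)

/-! ### Names of argument tuples assembled from approximations of the entries -/

section arguments

variable {n : ℕ} {ws : ℕ → Fin n → List Bool} {r : Fin n → Cantor}

theorem argBit_sound (h : ∀ j, Converges (fun k => ws k j) (r j)) (e k N : ℕ) (b : Bool)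
    (hb : argBit e (List.ofFn (ws k)) N = some b) : b = argName e r N := by
  rw [argBit] at hb
  rw [argName]
  cases h1 : N % 2 == 0
  · cases h2 : N / 2 % 2 == 0
    · simp only [h1, h2, cond_false] at hb ⊢
      split_ifs with h3
      · rw [List.getElem?_eq_getElem (by simpa using h3)] at hb
        simp only [Option.elim_some, List.getElem_ofFn] at hb
        exact (h _).getElem?_eq hb
      · rw [List.getElem?_eq_none (by simpa using h3)] at hb
        simpa using hb.symm
    · simp only [h1, h2, cond_false, cond_true, List.length_ofFn, Option.some.injEq] at hb ⊢
      exact hb.symm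
  · simp only [h1, cond_true, Option.some.injEq] at hb ⊢
    exact hb.symm

theorem argBit_eventually (h : ∀ j, Converges (fun k => ws k j) (r j)) (e N : ℕ) :
    ∀ᶠ k in atTop, (argBit e (List.ofFn (ws k)) N).isSome := by
  simp only [argBit]
  cases h1 : N % 2 == 0
  · cases h2 : N / 2 % 2 == 0
    · simp only [cond_false]
      by_cases h3 : (N / 2 / 2).unpair.1 < n
      · filter_upwards [(h ⟨_, h3⟩).eventually_getElem? (N / 2 / 2).unpair.2] with k hk
        rw [List.getElem?_eq_getElem (by simpa using h3)]
        simp [hk]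
      · refine Eventually.of_forall fun k => ?_
        rw [List.getElem?_eq_none (by simpa using h3)]
        rfl
    · exact Eventually.of_forall fun k => rfl
  · exact Eventually.of_forall fun k => rfl

theorem converges_argBit (h : ∀ j, Converges (fun k => ws k j) (r j)) (e : ℕ) :
    Converges (fun k => collect (argBit e (List.ofFn (ws k))) k) (argName e r) :=
  converges_collect (fun k N b => argBit_sound h e k N b) (argBit_eventually h e)

theorem converges_argBit₂ (h : ∀ j, Converges (fun k => ws k j) (r j)) (e m : ℕ) :
    Converges (fun k => collect (argBit₂ e m (List.ofFn (ws k))) k) (argName₂ e m r) := by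
  refine converges_collect (fun k N b hb => ?_) fun N => ?_
  · rw [argBit₂] at hb
    rw [argName₂]
    cases h1 : N % 2 == 0
    · simp only [h1, cond_false, Option.some.injEq] at hb ⊢
      exact hb.symm
    · simp only [h1, cond_true] at hb ⊢
      exact argBit_sound h e k _ b hb
  · simp only [argBit₂]
    cases h1 : N % 2 == 0
    · exact Eventually.of_forall fun k => rfl
    · exact argBit_eventually h e _

theorem names_argName {ι : Type} [Encodable ι] (i : ι) {v : Fin n → ℝ}
    (h : ∀ j, realRep.names (r j) (v j)) :
    (prodRep (discreteRep ι) (listRep realRep)).names (argName (Encodable.encode i) r)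
      (i, List.ofFn v) := by
  refine ⟨fun k => ?_, fun k => ?_, fun j hj => ?_⟩
  · have h1 : 2 * k % 2 = 0 := by omega
    have h2 : 2 * k / 2 = k := by omega
    simp [evenPart, argName, h1, h2]
  · have h1 : (2 * (2 * k) + 1) % 2 = 1 := by omega
    have h2 : (2 * (2 * k) + 1) / 2 = 2 * k := by omega
    have h3 : 2 * k % 2 = 0 := by omega
    have h4 : 2 * k / 2 = k := by omega
    simp [evenPart, oddPart, argName, h1, h2, h3, h4]
  · have hj' : j < n := by simpa using hj
    have : (fun k => oddPart (oddPart (argName (Encodable.encode i) r)) (Nat.pair j k)) =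
        r ⟨j, hj'⟩ := by
      funext k
      have h1 : (2 * (2 * Nat.pair j k + 1) + 1) % 2 = 1 := by omega
      have h2 : (2 * (2 * Nat.pair j k + 1) + 1) / 2 = 2 * Nat.pair j k + 1 := by omega
      have h3 : (2 * Nat.pair j k + 1) % 2 = 1 := by omega
      have h4 : (2 * Nat.pair j k + 1) / 2 = Nat.pair j k := by omega
      simp [oddPart, argName, h1, h2, h3, h4, hj']
    show realRep.names (fun k => oddPart (oddPart (argName (Encodable.encode i) r)) (Nat.pair j k))
      ((List.ofFn v)[j])
    rw [this, List.getElem_ofFn]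
    exact h _

theorem names_argName₂ {ι : Type} [Encodable ι] (i : ι) (m : ℕ) {v : Fin n → ℝ}
    (h : ∀ j, realRep.names (r j) (v j)) :
    (prodRep (prodRep (discreteRep ι) (listRep realRep)) natRep).names
      (argName₂ (Encodable.encode i) m r) ((i, List.ofFn v), m) := by
  constructor
  · have : evenPart (argName₂ (Encodable.encode i) m r) = argName (Encodable.encode i) r := by
      funext k
      have h1 : 2 * k % 2 = 0 := by omega
      have h2 : 2 * k / 2 = k := by omega
      simp [evenPart, argName₂, h1, h2]
    simp only [this]
    exact names_argName i h
  · intro k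
    have h1 : (2 * k + 1) % 2 = 1 := by omega
    have h2 : (2 * k + 1) / 2 = k := by omega
    simp [oddPart, argName₂, h1, h2]

end arguments

theorem primrec_argBit : Primrec fun x : (ℕ × List (List Bool)) × ℕ => argBit x.1.1 x.1.2 x.2 := by
  have two : Primrec fun _ : (ℕ × List (List Bool)) × ℕ => 2 := Primrec.const 2
  have z : Primrec fun _ : (ℕ × List (List Bool)) × ℕ => 0 := Primrec.const 0
  have n0 : Primrec fun x : (ℕ × List (List Bool)) × ℕ => x.2 := Primrec.snd
  have n1 : Primrec fun x : (ℕ × List (List Bool)) × ℕ => x.2 / 2 := Primrec.nat_div.comp n0 two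
  have n2 : Primrec fun x : (ℕ × List (List Bool)) × ℕ => x.2 / 2 / 2 :=
    Primrec.nat_div.comp n1 two
  have u := Primrec.unpair.comp n2
  have ws : Primrec fun x : (ℕ × List (List Bool)) × ℕ => x.1.2 := Primrec.snd.comp Primrec.fst
  have h1 : Primrec₂ fun (x : (ℕ × List (List Bool)) × ℕ) (w : List Bool) =>
      w[(x.2 / 2 / 2).unpair.2]? :=
    (Primrec.list_getElem?.comp Primrec.snd ((Primrec.snd.comp u).comp Primrec.fst)).to₂
  have h2 : Primrec fun x : (ℕ × List (List Bool)) × ℕ =>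
      x.1.2[(x.2 / 2 / 2).unpair.1]?.elim (some false) fun w => w[(x.2 / 2 / 2).unpair.2]? := by
    refine (Primrec.option_casesOn (Primrec.list_getElem?.comp ws (Primrec.fst.comp u))
      (Primrec.const (some false)) h1).of_eq fun x => ?_
    cases x.1.2[(x.2 / 2 / 2).unpair.1]? <;> rfl
  exact Primrec.cond (Primrec.beq.comp (Primrec.nat_mod.comp n0 two) z)
    (Primrec.option_some.comp (Primrec.nat_le.decide.comp (Primrec.fst.comp Primrec.fst) n1))
    (Primrec.cond (Primrec.beq.comp (Primrec.nat_mod.comp n1 two) z)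
      (Primrec.option_some.comp (Primrec.nat_le.decide.comp (Primrec.list_length.comp ws) n2)) h2)

theorem primrec_argBit₂ : Primrec fun x : (ℕ × ℕ × List (List Bool)) × ℕ =>
    argBit₂ x.1.1 x.1.2.1 x.1.2.2 x.2 := by
  have two : Primrec fun _ : (ℕ × ℕ × List (List Bool)) × ℕ => 2 := Primrec.const 2
  have n1 : Primrec fun x : (ℕ × ℕ × List (List Bool)) × ℕ => x.2 / 2 :=
    Primrec.nat_div.comp Primrec.snd two
  have c := Primrec.snd.comp (Primrec.fst (α := ℕ × ℕ × List (List Bool)) (β := ℕ))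
  exact Primrec.cond (Primrec.beq.comp (Primrec.nat_mod.comp Primrec.snd two) (Primrec.const 0))
    (primrec_argBit.comp (((Primrec.fst.comp Primrec.fst).pair (Primrec.snd.comp c)).pair n1))
    (Primrec.option_some.comp (Primrec.nat_le.decide.comp (Primrec.fst.comp c) n1))

theorem Converges.exists_true_iff {w : ℕ → List Bool} {q : Cantor} (h : Converges w q) :
    (∃ n, q n = true) ↔ ∃ k, true ∈ w k := by
  constructor
  · rintro ⟨n, hn⟩
    obtain ⟨k, hk⟩ := (h.eventually_getElem? n).exists
    rw [hn] at hk
    exact ⟨k, List.mem_of_getElem? hk⟩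
  · rintro ⟨k, hk⟩
    obtain ⟨n, hn⟩ := List.mem_iff_getElem?.1 hk
    exact ⟨n, (h.getElem?_eq hn).symm⟩

/-- The word functions of the realizers are run on the part of a name of the argument tuple known so
far; monotonicity makes their outputs converge to a name of the value. -/
theorem AlgStructure.exists_computable_opData {ι τ : Type} [Primcodable ι] {𝔄 : AlgStructure ℝ ι τ}
    (hO : 𝔄.OpsComputable) (hD : 𝔄.DomainsEffectiveFSigma) :
    ∃ E : OpData ι, E.Computable ∧ E.Sound 𝔄 := by
  obtain ⟨⟨b, hb, hbn⟩, -, F, ⟨φ, hφ, hφm, hφF⟩, hF⟩ := hO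
  obtain ⟨U, ⟨F', ⟨ψ, hψ, hψm, hψF⟩, hF'⟩, hU⟩ := hD
  refine ⟨⟨fun i k ws => φ (collect (argBit (Encodable.encode i) ws) k),
    -- A `1` among the output bits puts the arguments outside the `m`-th closed set; `idxOf true`
    -- lies below the length iff such a bit occurs.
    fun i m k ws => decide ((ψ (collect (argBit₂ (Encodable.encode i) m ws) k)).idxOf true <
      (ψ (collect (argBit₂ (Encodable.encode i) m ws) k)).length), initSeg b⟩, ⟨?_, ?_, ?_⟩,
    ⟨?_, ?_, ?_⟩⟩
  · have e : Computable fun x : ι × ℕ × List (List Bool) =>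
        (Encodable.encode x.1, x.2.2) := (Computable.encode.comp Computable.fst).pair
      (Computable.snd.comp Computable.snd)
    exact hφ.comp (computable_collect (primrec_argBit.to_comp.comp
      ((e.comp Computable.fst).pair Computable.snd)).to₂ (Computable.fst.comp Computable.snd))
  · have e : Computable fun x : ι × ℕ × ℕ × List (List Bool) =>
        (Encodable.encode x.1, x.2.1, x.2.2.2) := (Computable.encode.comp Computable.fst).pair
      ((Computable.fst.comp Computable.snd).pair
        (Computable.snd.comp (Computable.snd.comp Computable.snd)))
    have hw : Computable fun x : ι × ℕ × ℕ × List (List Bool) =>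
        ψ (collect (argBit₂ (Encodable.encode x.1) x.2.1 x.2.2.2) x.2.2.1) :=
      hψ.comp (computable_collect (primrec_argBit₂.to_comp.comp
        ((e.comp Computable.fst).pair Computable.snd)).to₂
          (Computable.fst.comp (Computable.snd.comp Computable.snd)))
    exact Primrec.nat_lt.decide.to_comp.comp
      (Primrec.list_idxOf.to_comp.comp (Computable.const true) hw) (Computable.list_length.comp hw)
  · exact Computable.list_map_range (hb.comp Computable.snd).to₂ Computable.id
  · exact ⟨b, hbn, converges_initSeg b⟩
  · intro i v y hy ws hws
    choose r hr hrw using hws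
    obtain ⟨q, hq, y', ⟨v', hv', hy'⟩, hqy⟩ := hF _ _ (names_argName i hr) ⟨y, v, rfl, hy⟩
    obtain rfl := List.ofFn_injective hv'
    obtain rfl := Part.mem_unique hy hy'
    exact ⟨q, hqy, (converges_argBit hrw _).of_wordFunction hφm (hφF _ q hq)⟩
  · intro i v ws hws
    choose r hr hrw using hws
    refine (hU i v).trans (exists_congr fun m => ?_)
    obtain ⟨q, hq, s, hs, hqs⟩ := hF' _ _ (names_argName₂ i m hr) (Set.singleton_nonempty _)
    obtain rfl := Set.mem_singleton_iff.1 hs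
    have hc := (converges_argBit₂ hrw (Encodable.encode i) m).of_wordFunction hψm (hψF _ q hq)
    have h1 : U i (List.ofFn v) m ↔ ∃ n, q n = true := hqs
    rw [h1, hc.exists_true_iff]
    simp [List.idxOf_lt_length_iff]

end BSSWeihrauch

namespace BSSWeihrauch

open Filter Topology

/-! ### Approximations for continuous operations -/

/-- The tuples whose entries have names with the given initial segments. -/
def cylinder {n : ℕ} (w : Fin n → List Bool) : Set (Fin n → ℝ) :=
  {v | ∀ j, ∃ p, realRep.names p (v j) ∧ w j = initSeg p (w j).length}

theorem mem_cylinder {n : ℕ} {w : ℕ → Fin n → List Bool} {v : Fin n → ℝ}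
    (h : ∀ j, Represents (fun k => w k j) (v j)) (k : ℕ) : v ∈ cylinder (w k) := fun j => by
  obtain ⟨r, hr, hc⟩ := h j
  exact ⟨r, hr, hc.eq_initSeg k⟩

/-- Once the word contains block `i`, all reals with a name extending it share the `i`-th rational
and so lie within `2 · 2^{-i}` of each other. -/
theorem Represents.eventually_near {w : ℕ → List Bool} {x ε : ℝ} (h : Represents w x)
    (hε : 0 < ε) : ∀ᶠ k in atTop, ∀ p x', realRep.names p x' → w k = initSeg p (w k).length →
      |x' - x| < ε := by
  obtain ⟨r, ⟨s, hs, hx⟩, hc⟩ := h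
  obtain ⟨i, hi⟩ := exists_two_pow_lt (half_pos hε)
  filter_upwards [(hs.converges_blocks hc).eventually_getElem? i] with k hk p x' ⟨s', hs', hx'⟩ hp
  rw [hp] at hk
  have h1 := (hs'.converges_blocks (converges_initSeg p)).getElem?_eq hk
  have h2 := abs_lt.1 (hx i)
  have h3 := abs_lt.1 (hx' i)
  rw [h1] at h2
  rw [abs_lt]
  constructor <;> linarith

theorem eventually_cylinder_subset {n : ℕ} {w : ℕ → Fin n → List Bool} {v : Fin n → ℝ}
    (h : ∀ j, Represents (fun k => w k j) (v j)) {W : Set (Fin n → ℝ)} (hW : W ∈ 𝓝 v) :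
    ∀ᶠ k in atTop, cylinder (w k) ⊆ W := by
  obtain ⟨ε, hε, hW⟩ := Metric.mem_nhds_iff.1 hW
  filter_upwards [eventually_all.2 fun j => (h j).eventually_near hε] with k hk v' hv'
  refine hW ((dist_pi_lt_iff hε).2 fun j => ?_)
  obtain ⟨p, hp, hpw⟩ := hv' j
  exact hk j p (v' j) hp hpw

/-- All values of `f` on the cylinder given by `w` are approximated by `ν_ℚ(c)`. -/
def Approximates {n : ℕ} (f : (Fin n → ℝ) →. ℝ) (w : Fin n → List Bool) (j c : ℕ) : Prop :=
  ∀ v ∈ cylinder w, ∀ y ∈ f v, |y - (nuQ c : ℝ)| < (1 / 2 : ℝ) ^ j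

/-- The prefixes of length `m` determine an approximation of the value of `f`. -/
def Determines {n : ℕ} (f : (Fin n → ℝ) →. ℝ) (w : Fin n → List Bool) (j m : ℕ) : Prop :=
  (∀ l, m ≤ (w l).length) ∧ ∃ c, Approximates f (fun l => (w l).take m) j c

open Classical in
/-- An approximation of the value of `f` that depends only on the shortest prefixes that
determine one. -/
noncomputable def approxCode {n : ℕ} (f : (Fin n → ℝ) →. ℝ) (w : Fin n → List Bool) (j : ℕ) :
    Option ℕ :=
  if h : ∃ m, Determines f w j m then
    some (Classical.epsilon fun c => Approximates f (fun l => (w l).take (Nat.find h)) j c)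
  else none

theorem represents_initSeg {r : Cantor} {x : ℝ} (h : realRep.names r x) :
    Represents (initSeg r) x := ⟨r, h, converges_initSeg r⟩

theorem exists_approximates {n : ℕ} {f : (Fin n → ℝ) →. ℝ} (hf : PartialContinuous f)
    {v : Fin n → ℝ} {y : ℝ} (hy : y ∈ f v) {r : Fin n → Cantor}
    (hr : ∀ j, realRep.names (r j) (v j)) (j : ℕ) :
    ∃ m c, Approximates f (fun l => initSeg (r l) m) j c := by
  obtain ⟨hdom, hval⟩ := hy
  -- Half of the tolerance is for the choice of the rational, half for the variation of `f` on the
  -- cylinder.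
  have hε : (0 : ℝ) < (1 / 2) ^ j / 2 := by positivity
  obtain ⟨q, hq⟩ := exists_rat_near y hε
  obtain ⟨c, rfl⟩ := nuQ_surjective q
  have hc := Metric.continuousAt_iff'.1 (hf.continuousAt (x := ⟨v, hdom⟩)) _ hε
  obtain ⟨W, hW, hWc⟩ := (mem_nhds_induced _ _ _).1 hc
  obtain ⟨m, hm⟩ := (eventually_cylinder_subset (w := fun m l => initSeg (r l) m)
    (fun l => represents_initSeg (hr l)) hW).exists
  refine ⟨m, c, fun v' hv' y' hy' => ?_⟩
  obtain ⟨hdom', hval'⟩ := hy'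
  have h1 : dist (f.fn v' hdom') (f.fn v hdom) < (1 / 2) ^ j / 2 :=
    @hWc ⟨v', hdom'⟩ (hm hv')
  have e1 : f.fn v' hdom' = y' := hval'
  have e2 : f.fn v hdom = y := hval
  rw [e1, e2, Real.dist_eq] at h1
  calc |y' - (nuQ c : ℝ)| ≤ |y' - y| + |y - (nuQ c : ℝ)| := abs_sub_le _ _ _
    _ < (1 / 2) ^ j / 2 + (1 / 2) ^ j / 2 := add_lt_add h1 hq
    _ = _ := add_halves _

/-- Approximations chosen anew at each stage need not form one sequence. Taking the shortest
determining prefixes makes the choice depend on the names alone, since later stages only lengthen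
the available prefixes. -/
theorem represents_approxCode {n : ℕ} {f : (Fin n → ℝ) →. ℝ} (hf : PartialContinuous f)
    {v : Fin n → ℝ} {y : ℝ} (hy : y ∈ f v) {w : ℕ → Fin n → List Bool}
    (hw : ∀ j, Represents (fun k => w k j) (v j)) :
    Represents (fun k => blockWord (collect (approxCode f (w k)) k)) y := by
  classical
  choose r hr hc using hw
  have hQ := exists_approximates hf hy hr
  let m₀ : ℕ → ℕ := fun j => Nat.find (hQ j)
  have hm₀ : ∀ j, ∃ c, Approximates f (fun l => initSeg (r l) (m₀ j)) j c :=
    fun j => Nat.find_spec (hQ j)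
  let s : ℕ → ℕ := fun j =>
    Classical.epsilon fun c => Approximates f (fun l => initSeg (r l) (m₀ j)) j c
  have hs : ∀ j, Approximates f (fun l => initSeg (r l) (m₀ j)) j (s j) :=
    fun j => Classical.epsilon_spec (hm₀ j)
  have htake : ∀ k m, (∀ l, m ≤ (w k l).length) →
      (fun l => (w k l).take m) = fun l => initSeg (r l) m := by
    intro k m h
    funext l
    have h1 : w k l = initSeg (r l) (w k l).length := (hc l).eq_initSeg k
    rw [h1, take_initSeg _ (h l)]
  have hdet : ∀ k j, (∀ l, m₀ j ≤ (w k l).length) → Determines f (w k) j (m₀ j) := by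
    intro k j h
    exact ⟨h, by rw [htake k _ h]; exact hm₀ j⟩
  refine ⟨blockSeq s, ⟨s, isBlockCode_blockSeq s, fun j => ?_⟩,
    (converges_collect (fun k j c hk => ?_) fun j => ?_).blockWord⟩
  · exact hs j v (mem_cylinder (w := fun m l => initSeg (r l) m)
      (fun l => represents_initSeg (hr l)) (m₀ j)) y hy
  · rw [approxCode] at hk
    split_ifs at hk with h
    obtain ⟨h1, h2⟩ := Nat.find_spec h
    -- The minimal length found at stage `k` agrees with the minimal length `m₀ j` for the full
    -- names, so the same code is selected.
    have h3 : m₀ j ≤ Nat.find h := Nat.find_min' (hQ j) (by rw [htake k _ h1] at h2; exact h2)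
    have h4 : Nat.find h = m₀ j :=
      le_antisymm (Nat.find_min' h (hdet k j fun l => h3.trans (h1 l))) h3
    rw [htake k _ h1, h4] at hk
    exact (Option.some.inj hk).symm
  · have h : ∀ᶠ k in atTop, ∀ l, m₀ j ≤ (w k l).length :=
      eventually_all.2 fun l => (hc l).2.eventually_ge_atTop (m₀ j)
    filter_upwards [h] with k hk
    rw [approxCode, dif_pos ⟨_, hdet k j hk⟩]
    rfl

open Classical in
theorem AlgStructure.exists_sound_opData {ι τ : Type} {𝔄 : AlgStructure ℝ ι τ}
    (hO : 𝔄.OpsContinuous) (hD : 𝔄.DomainsFSigma) : ∃ E : OpData ι, E.Sound 𝔄 := by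
  choose C hC hCD using hD
  obtain ⟨b, hb⟩ := realRep.surj 𝔄.blank
  have hget : ∀ {n : ℕ} (w : Fin n → List Bool), (fun j : Fin n => (List.ofFn w).getD j []) = w := by
    intro n w
    funext j
    simp [List.getD_eq_getElem?_getD]
  refine ⟨⟨fun i k ws => blockWord (collect (approxCode (𝔄.op i)
      fun j : Fin (𝔄.arity i) => ws.getD j []) k),
    fun i m _ ws => decide (¬ (cylinder (fun j : Fin (𝔄.arity i) => ws.getD j []) ∩
      C i m).Nonempty), initSeg b⟩, represents_initSeg hb, ?_, ?_⟩
  · intro i v y hy ws hws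
    simp only [hget]
    exact represents_approxCode (hO i) hy hws
  · intro i v ws hws
    simp only [hget, decide_eq_false_iff_not, not_not]
    have h1 : (𝔄.op i v).Dom ↔ ∃ m, v ∈ C i m := by
      have : v ∈ (𝔄.op i).Dom ↔ v ∈ ⋃ m, C i m := by rw [hCD i]
      exact this.trans Set.mem_iUnion
    rw [h1]
    -- A point of a closed set is never separated from it, as it lies in all its cylinders; a point
    -- outside has a cylinder that misses the set.
    refine exists_congr fun m => ⟨fun hv k => ⟨v, mem_cylinder hws k, hv⟩, fun h => ?_⟩
    by_contra hv
    obtain ⟨k, hk⟩ := (eventually_cylinder_subset hws ((hC i m).isOpen_compl.mem_nhds hv)).exists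
    obtain ⟨v', hv', hvC⟩ := h k
    exact hk hv' hvC

end BSSWeihrauch

/-! ### Assembly of the reductions -/

theorem mainTheorem4 {ι τ : Type} [Primcodable ι] [Primcodable τ] [Finite τ]
    (𝔄 : AlgStructure ℝ ι τ) (hadd : 𝔄.HasAdd) (heq : 𝔄.HasEq) (htests : 𝔄.TestsEqOrLt) :
    -- computable operations: pairwise Weihrauch equivalence
    (𝔄.OpsComputable → 𝔄.DomainsEffectiveFSigma →
      WeihrauchEquiv chiRat 𝔄.chiHalting ∧
      WeihrauchEquiv 𝔄.chiHalting isInfinite ∧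
      WeihrauchEquiv chiRat isInfinite) ∧
    -- continuous operations: pairwise continuous Weihrauch equivalence
    (𝔄.OpsContinuous → 𝔄.DomainsFSigma →
      ContWeihrauchEquiv chiRat 𝔄.chiHalting ∧
      ContWeihrauchEquiv 𝔄.chiHalting isInfinite ∧
      ContWeihrauchEquiv chiRat isInfinite) ∧
    -- topological undecidability
    ¬ ContWeihrauchLE 𝔄.chiHalting closedChoiceNat ∧
    (∀ (ι' τ' : Type) (𝔅 : AlgStructure ℝ ι' τ'), 𝔅.TestsEqOrLt → 𝔅.OpsContinuous →
      ¬ ∃ P : List (Instr ι' τ'), 𝔅.Decides P 𝔄.HaltingProblem) := by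
  classical
  obtain ⟨g, hg⟩ := 𝔄.exists_reducesVia_halting hadd heq
  have hIQ := reducesVia_infinite_rational
  have hQI := reducesVia_rational_infinite
  have hIH := AlgStructure.reducesVia_infinite_halting hg
  have cIQ := causalComputable_seriesName
  have cQI := causalComputable_refutationMoves computable_refutesRat
  have cIH := causalComputable_searchName g
  obtain ⟨lt, hlt⟩ : ∃ lt : τ → Bool, ∀ t, if lt t then 𝔄.IsLtTest t else 𝔄.IsEqTest t := by
    refine ⟨fun t => decide (𝔄.IsLtTest t), fun t => ?_⟩
    by_cases h : 𝔄.IsLtTest t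
    · simp [h]
    · simpa [h] using (htests t).resolve_right h
  rw [chiRat_eq, isInfinite_eq, 𝔄.chiHalting_eq]
  refine ⟨fun hO hD => ?_, fun hO hD => ?_,
    hIH.not_contWeihrauchLE_closedChoiceNat cIH.continuous, ?_⟩
  · obtain ⟨E, hE, hES⟩ := AlgStructure.exists_computable_opData hO hD
    have hHI := reducesVia_halting_infinite hES hlt
    have cHI := causalComputable_refutationMoves
      (computable_refutesHalting hE hO.2.1 (Primrec.dom_finite lt).to_comp)
    -- Rationality and halting are compared through `isInfinite`; the two negations cancel.
    exact ⟨⟨(hIH.comp hQI).weihrauchLE (cIH.comp cQI), (hIQ.comp hHI).weihrauchLE (cIQ.comp cHI)⟩,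
      ⟨hHI.weihrauchLE cHI, hIH.weihrauchLE cIH⟩, hQI.weihrauchLE cQI, hIQ.weihrauchLE cIQ⟩
  · obtain ⟨E, hES⟩ := AlgStructure.exists_sound_opData hO hD
    have hHI := reducesVia_halting_infinite hES hlt
    have cHI := continuous_refutationMoves (refutesHalting E 𝔄.arity lt)
    exact ⟨⟨(hIH.comp hQI).contWeihrauchLE (cIH.continuous.comp cQI.continuous),
        (hIQ.comp hHI).contWeihrauchLE (cIQ.continuous.comp cHI)⟩,
      ⟨hHI.contWeihrauchLE cHI, hIH.contWeihrauchLE cIH.continuous⟩,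
      hQI.contWeihrauchLE cQI.continuous, hIQ.contWeihrauchLE cIQ.continuous⟩
  · rintro ι' τ' 𝔅 hT hO ⟨P, hP⟩
    exact AlgStructure.not_decides hT hO hg hP
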